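/- **Conventions.** Let $(V,\Omega)$ be a finite-dimensional real symplectic vector space, $j$ a positive compatible complex structure on it (that is, $j^2=-\mathrm{Id}$, $\Omega(jv,jw)=\Omega(v,w)$ and $\Omega(v,jv)>0$ for $v\neq 0$), and $\hbar>0$, $h=2\pi\hbar$, $\dim_{\mathbb R}V=2n$. Put $\langle v,w\rangle_j=\Omega(v,jw)-i\,\Omega(v,w)$ and $|v|_j^2=\langle v,v\rangle_j$. Let $\mathcal H(V,\Omega,j)$ be the Fock space of holomorphic functions $f$ on $(V,j)$ with $\|f\|_j^2=h^{-n}\int_V|f(z)|^2e^{-|z|_j^2/2\hbar}\,dz<\infty$, with the operators $(U_j(v,t)f)(z)=e^{-it/\hbar+\langle z,v\rangle_j/2\hbar-|v|_j^2/4\hbar}f(z-v)$, $v\in V$, $t\in\mathbb R$. The group $Mp^c(V,\Omega,j)$ consists of the pairs $(U,g)$ of a unitary operator $U$ of $\mathcal H(V,\Omega,j)$ and $g\in Sp(V,\Omega)$ with $U_j(gv,t)=U\,U_j(v,t)\,U^{-1}$ for all $(v,t)$; $\sigma(U,g)=g$. It is a Lie group, whose manifold structure is the one for which $(U,g)\mapsto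 (g,(U1)(0))\in \mathrm{End}(V)\times\mathbb C$ is an embedding onto a closed submanifold. For a symplectic manifold $(M,\omega)$ let $Sp(M,\omega)$ be the bundle of symplectic frames $b:(V,\Omega)\to(T_xM,\omega_x)$. An $Mp^c$-structure on $(M,\omega)$ is a smooth principal $Mp^c(V,\Omega,j)$-bundle $P\to M$ with a smooth fibre-preserving map $\phi:P\to Sp(M,\omega)$ such that $\phi(p\cdot A)=\phi(p)\circ\sigma(A)$. If a Lie group $G$ acts symplectically on $M$, the structure is called $G$-invariant when it comes with a smooth action of $G$ on $P$ which commutes with the right action of $Mp^c(V,\Omega,j)$ and satisfies $\phi(g\cdot p)=g_*\circ\phi(p)$. Isomorphisms of $G$-invariant $Mp^c$-structures are isomorphisms of principal bundles over $M$ compatible with the maps $\phi$ and the actions of $G$. **Proposition.** Let a (second countable) Lie group $G$ act smoothly, transitively and symplectically on a symplectic manifold $(M,\omega)$ (Hausdorff and second countable). Let $p_0\in M$, let $K\subset G$ be the stabilizer of $p_0$, let $f_0:(V,\Omega)\to(T_{p_0}M,\omega_{p_0})$ be a symplectic frame at $p_0$, and let $$\tau:K\to Sp(V,\Omega),\qquad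 \tau(k)=f_0^{-1}\circ (k_*)_{p_0}\circ f_0$$ be the isotropy representation. Then $(M,\omega)$ admits a $G$-invariant $Mp^c$-structure if and only if $\tau$ has a lift, i.e. there is a smooth homomorphism $\tilde\tau:K\to Mp^c(V,\Omega,j)$ with $\sigma\circ\tilde\tau=\tau$. Furthermore, every $G$-invariant $Mp^c$-structure on $M$ is isomorphic, for some such lift $\tilde\tau$, to the $G$-invariant $Mp^c$-structure $$P=G\times_{K,\tilde\tau}Mp^c(V,\Omega,j)=\bigl(G\times Mp^c(V,\Omega,j)\bigr)/\bigl((g,B)\sim(gk,\tilde\tau(k)^{-1}B),\ k\in K\bigr)$$ with projection $[g,B]\mapsto g p_0$, right action $[g,B]\cdot A=[g,BA]$, map $\phi[g,B]=g_*\circ f_0\circ\sigma(B)$, $G$-action $g\cdot[g',B]=[gg',B]$, and the smooth structure for which the local sections $x\mapsto[t(x),1]$ are smooth, $t$ running through the smooth local sections of the map $G\to M$, $g\mapsto gp_0$. -/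

import Mathlib

open scoped Manifold ContDiff
open MeasureTheory

universe uV uE uM uF uG uP uP'

namespace MpcTheory

noncomputable section

/-! ### Symplectic vector spaces and positive compatible complex structures -/

/-- A symplectic form on the real vector space `V`: a non-degenerate alternating bilinear form. -/
structure SymplecticForm (V : Type uV) [AddCommGroup V] [Module ℝ V] where
  form : V →ₗ[ℝ] V →ₗ[ℝ] ℝ
  alt : ∀ v, form v v = 0
  nondeg : ∀ v, (∀ w, form v w = 0) → v = 0

/-- A positive compatible complex structure `j` on `(V, Ω)`: it is symplectic, `j² = -Id`, and the
form `(v, w) ↦ Ω(v, j w)` is positive definite. -/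
structure PCCS {V : Type uV} [AddCommGroup V] [Module ℝ V] (Ω : SymplecticForm V) where
  j : V →ₗ[ℝ] V
  sq : ∀ v, j (j v) = -v
  symp : ∀ v w, Ω.form (j v) (j w) = Ω.form v w
  pos : ∀ v, v ≠ 0 → 0 < Ω.form v (j v)

section LinearAlgebra

variable {V : Type uV} [AddCommGroup V] [Module ℝ V] {Ω : SymplecticForm V}

theorem SymplecticForm.skew (Ω : SymplecticForm V) (v w : V) :
    Ω.form v w = -Ω.form w v := by
  have h := Ω.alt (v + w)
  simp only [map_add, LinearMap.add_apply, Ω.alt] at h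
  linarith

/-- The symplectic group `Sp(V, Ω)`. -/
def Sp (Ω : SymplecticForm V) : Subgroup (V ≃ₗ[ℝ] V) where
  carrier := {g | ∀ v w, Ω.form (g v) (g w) = Ω.form v w}
  mul_mem' := by
    intro a b ha hb v w
    rw [LinearEquiv.mul_apply, LinearEquiv.mul_apply, ha, hb]
  one_mem' := fun v w => rfl
  inv_mem' := by
    intro a ha v w
    have h := ha (a⁻¹ v) (a⁻¹ w)
    have e : ∀ u, a (a⁻¹ u) = u := fun u => a.apply_symm_apply u
    rw [e, e] at h
    exact h.symm

/-- The complex vector space `(V, j)`; it carries the Hermitian structure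
`⟨v, w⟩_j = Ω(v, j w) - i Ω(v, w)` (complex linear in the first argument), which in the convention
of `inner`, conjugate linear in the first argument, is `⟨v, w⟩_j = inner ℂ w v`. -/
def Herm (_ : PCCS Ω) : Type uV := V

variable (J : PCCS Ω)

instance : AddCommGroup (Herm J) := inferInstanceAs (AddCommGroup V)

/-- The identity map of `V`, seen as an additive isomorphism of `V` with `(V, j)`. -/
def toHermAdd : V ≃+ Herm J := AddEquiv.refl V

theorem PCCS.skew_j (v w : V) : Ω.form (J.j v) w = -Ω.form v (J.j w) := by
  have h := J.symp v (J.j w)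
  rw [J.sq] at h
  simp only [map_neg] at h
  linarith

theorem PCCS.form_j_symm (v w : V) : Ω.form v (J.j w) = Ω.form w (J.j v) := by
  rw [Ω.skew v, J.skew_j, neg_neg]

/-- Multiplication by complex scalars on `(V, j)`: `(a + i b) v = a v + b (j v)`. -/
def PCCS.csmul (z : ℂ) (v : V) : V := z.re • v + z.im • J.j v

/-- The Hermitian form `⟨v, w⟩_j = Ω(v, j w) - i Ω(v, w)`. -/
def PCCS.herm (v w : V) : ℂ := ⟨Ω.form v (J.j w), -Ω.form v w⟩

theorem PCCS.csmul_one (v : V) : J.csmul 1 v = v := by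
  simp [PCCS.csmul]

theorem PCCS.csmul_mul (a b : ℂ) (v : V) : J.csmul (a * b) v = J.csmul a (J.csmul b v) := by
  simp only [PCCS.csmul, Complex.mul_re, Complex.mul_im, map_add, map_smul, J.sq]
  module

theorem PCCS.csmul_add (a : ℂ) (v w : V) : J.csmul a (v + w) = J.csmul a v + J.csmul a w := by
  simp only [PCCS.csmul, map_add]
  module

theorem PCCS.add_csmul (a b : ℂ) (v : V) : J.csmul (a + b) v = J.csmul a v + J.csmul b v := by
  simp only [PCCS.csmul, Complex.add_re, Complex.add_im]
  module

theorem PCCS.herm_conj (v w : V) : starRingEnd ℂ (J.herm v w) = J.herm w v := by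
  apply Complex.ext
  · exact J.form_j_symm v w
  · change - -Ω.form v w = -Ω.form w v
    rw [neg_neg]; exact Ω.skew _ _

theorem PCCS.herm_csmul (v w : V) (a : ℂ) :
    J.herm w (J.csmul a v) = starRingEnd ℂ a * J.herm w v := by
  apply Complex.ext
  · simp only [PCCS.herm, PCCS.csmul, Complex.mul_re, Complex.conj_re, Complex.conj_im,
      map_add, map_smul, J.sq, smul_neg, map_neg, smul_eq_mul]
    ring
  · simp only [PCCS.herm, PCCS.csmul, Complex.mul_im, Complex.conj_re, Complex.conj_im,
      map_add, map_smul, smul_eq_mul]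
    ring

theorem PCCS.herm_add (u v w : V) : J.herm w (u + v) = J.herm w u + J.herm w v := by
  apply Complex.ext
  · simp [PCCS.herm]
  · simp only [PCCS.herm, Complex.add_im, map_add]
    ring

theorem PCCS.herm_self_nonneg (v : V) : 0 ≤ (J.herm v v).re := by
  change 0 ≤ Ω.form v (J.j v)
  by_cases h : v = 0
  · rw [h]; simp
  · exact (J.pos _ h).le

theorem PCCS.herm_definite (v : V) (h : J.herm v v = 0) : v = 0 := by
  by_contra hv
  have h1 := J.pos v hv
  have h2 : Ω.form v (J.j v) = 0 := congrArg Complex.re h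
  linarith

instance : Module ℂ (Herm J) where
  smul z v := toHermAdd J (J.csmul z ((toHermAdd J).symm v))
  one_smul v := J.csmul_one ((toHermAdd J).symm v)
  mul_smul a b v := J.csmul_mul a b _
  smul_zero a := show J.csmul a 0 = 0 by simp [PCCS.csmul]
  smul_add a v w := J.csmul_add a _ _
  add_smul a b v := J.add_csmul a b _
  zero_smul v := show J.csmul 0 _ = 0 by simp [PCCS.csmul]

/-- The Hermitian inner product of `(V, Ω, j)`. -/
@[reducible]
def hermCore : InnerProductSpace.Core ℂ (Herm J) where
  inner v w := J.herm ((toHermAdd J).symm w) ((toHermAdd J).symm v)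
  conj_inner_symm _ _ := J.herm_conj _ _
  re_inner_nonneg _ := J.herm_self_nonneg _
  add_left _ _ _ := J.herm_add _ _ _
  smul_left _ _ _ := J.herm_csmul _ _ _
  definite _ h := J.herm_definite _ h

instance : NormedAddCommGroup (Herm J) :=
  @InnerProductSpace.Core.toNormedAddCommGroup ℂ (Herm J) _ _ _ (hermCore J)

instance : InnerProductSpace ℂ (Herm J) := InnerProductSpace.ofCore (hermCore J).toCore

instance : MeasurableSpace (Herm J) := borel (Herm J)

instance : BorelSpace (Herm J) := ⟨rfl⟩

/-- The identity map of `V`, seen as a real linear isomorphism of `V` with `(V, j)`. -/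
def toHerm : V ≃ₗ[ℝ] Herm J where
  toAddEquiv := toHermAdd J
  map_smul' r v := by
    change r • v = J.csmul (r : ℂ) v
    simp [PCCS.csmul]

instance [FiniteDimensional ℝ V] : FiniteDimensional ℂ (Herm J) :=
  have : FiniteDimensional ℝ (Herm J) := (toHerm J).finiteDimensional
  FiniteDimensional.right ℝ ℂ (Herm J)

theorem inner_toHerm (v w : V) : inner ℂ (toHerm J w) (toHerm J v) =
    (Ω.form v (J.j w) : ℂ) - Complex.I * (Ω.form v w : ℂ) := by
  apply Complex.ext
  · have : (inner ℂ (toHerm J w) (toHerm J v)).re = Ω.form v (J.j w) := rfl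
    simp [this]
  · have : (inner ℂ (toHerm J w) (toHerm J v)).im = -Ω.form v w := rfl
    simp [this]

end LinearAlgebra

/-! ### The Fock space and the Heisenberg representation -/

section Fock

variable (hbar : ℝ) (W : Type uV) [NormedAddCommGroup W] [InnerProductSpace ℂ W]
  [FiniteDimensional ℂ W] [MeasurableSpace W] [BorelSpace W]

/-- The Lebesgue measure of `W`, normalised by its Euclidean norm `‖z‖² = ⟨z, z⟩`. -/
def hermVolume : Measure W :=
  letI : InnerProductSpace ℝ W := InnerProductSpace.complexToReal
  volume

instance : (hermVolume W).IsAddHaarMeasure :=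
  letI : InnerProductSpace ℝ W := InnerProductSpace.complexToReal
  inferInstanceAs (volume : Measure W).IsAddHaarMeasure

/-- The Fock space: the holomorphic functions `f` on the Hermitian space `W` for which
`|f(z)|² exp(-|z|² / 2ħ)` is Lebesgue integrable. -/
def Fock : Submodule ℂ (W → ℂ) where
  carrier := {f | Differentiable ℂ f ∧
    MemLp (fun z => f z * Real.exp (-‖z‖ ^ 2 / (4 * hbar))) 2 (hermVolume W)}
  add_mem' := by
    rintro f g ⟨hf, hf'⟩ ⟨hg, hg'⟩
    refine ⟨hf.add hg, ?_⟩
    have := hf'.add hg'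
    refine this.ae_eq (Filter.Eventually.of_forall fun z => ?_)
    simp only [Pi.add_apply]; ring
  zero_mem' := by
    refine ⟨differentiable_const 0, ?_⟩
    simp
  smul_mem' := by
    rintro c f ⟨hf, hf'⟩
    refine ⟨hf.const_smul c, ?_⟩
    have := hf'.const_smul c
    refine this.ae_eq (Filter.Eventually.of_forall fun z => ?_)
    simp only [Pi.smul_apply, smul_eq_mul]; ring

variable {hbar W}

/-- The square of the norm, `‖f‖² = h⁻ⁿ ∫ |f(z)|² exp(-|z|² / 2ħ) dz`, with `h = 2πħ` and `n` the
complex dimension of `W`. -/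
def fockNormSq (f : Fock hbar W) : ℝ :=
  ((2 * Real.pi * hbar) ^ Module.finrank ℂ W)⁻¹ *
    ∫ z : W, ‖f.1 z‖ ^ 2 * Real.exp (-‖z‖ ^ 2 / (2 * hbar)) ∂hermVolume W

/-- The function `U(v,t) f : z ↦ exp(-it/ħ + ⟨z,v⟩/2ħ - |v|²/4ħ) f(z - v)`. -/
def heisenbergFun (hbar : ℝ) (v : W) (t : ℝ) (f : W → ℂ) : W → ℂ := fun z =>
  Complex.exp (-Complex.I * t / hbar + inner ℂ v z / (2 * hbar) - (‖v‖ : ℂ) ^ 2 / (4 * hbar)) *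
    f (z - v)

theorem heisenbergFun_mem (v : W) (t : ℝ) (f : Fock hbar W) :
    heisenbergFun hbar v t f.1 ∈ Fock hbar W := by
  obtain ⟨hf, hf'⟩ := f.2
  have hdiff : Differentiable ℂ (heisenbergFun hbar v t f.1) := by
    have h1 : Differentiable ℂ (fun z : W => inner ℂ v z) := (innerSL ℂ v).differentiable
    have h2 : Differentiable ℂ (fun z : W => f.1 (z - v)) :=
      hf.comp (differentiable_id.sub_const v)
    unfold heisenbergFun
    refine Differentiable.mul ?_ h2
    simp only [div_eq_mul_inv]
    exact ((((h1.mul_const _).const_add _).sub_const _)).cexp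
  refine ⟨hdiff, ?_⟩
  have hm : MemLp (fun z => f.1 (z - v) * Real.exp (-‖z - v‖ ^ 2 / (4 * hbar))) 2 (hermVolume W) :=
    hf'.comp_measurePreserving (measurePreserving_sub_right (hermVolume W) v)
  refine hm.of_le ?_ (Filter.Eventually.of_forall fun z => le_of_eq ?_)
  · exact (hdiff.continuous.mul (by fun_prop)).aestronglyMeasurable
  · have key : ‖Complex.exp (-Complex.I * t / hbar + inner ℂ v z / (2 * hbar)
        - (‖v‖ : ℂ) ^ 2 / (4 * hbar))‖ * Real.exp (-‖z‖ ^ 2 / (4 * hbar)) =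
        Real.exp (-‖z - v‖ ^ 2 / (4 * hbar)) := by
      rw [Complex.norm_exp, ← Real.exp_add]
      congr 1
      have e1 : (-Complex.I * t / hbar : ℂ).re = 0 := by
        have : (-Complex.I * t / hbar : ℂ) = ((-t / hbar : ℝ) : ℂ) * Complex.I := by
          push_cast; ring
        rw [this]; simp
      have e2 : (inner ℂ v z / (2 * hbar) : ℂ).re = (inner ℂ v z).re / (2 * hbar) := by
        rw [show (2 * (hbar : ℂ)) = ((2 * hbar : ℝ) : ℂ) by push_cast; ring, Complex.div_ofReal_re]
      have e3 : ((‖v‖ : ℂ) ^ 2 / (4 * hbar) : ℂ).re = ‖v‖ ^ 2 / (4 * hbar) := by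
        rw [show ((‖v‖ : ℂ) ^ 2 / (4 * hbar) : ℂ) = ((‖v‖ ^ 2 / (4 * hbar) : ℝ) : ℂ) by
          push_cast; ring, Complex.ofReal_re]
      have e4 : ‖z - v‖ ^ 2 = ‖z‖ ^ 2 - 2 * (inner ℂ v z).re + ‖v‖ ^ 2 := by
        rw [@norm_sub_sq ℂ, ← inner_conj_symm]
        simp only [RCLike.re_eq_complex_re, Complex.conj_re]
      rw [Complex.sub_re, Complex.add_re, e1, e2, e3, e4]
      ring
    have h4 : ‖heisenbergFun hbar v t f.1 z * (Real.exp (-‖z‖ ^ 2 / (4 * hbar)) : ℂ)‖ =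
        ‖Complex.exp (-Complex.I * t / hbar + inner ℂ v z / (2 * hbar)
        - (‖v‖ : ℂ) ^ 2 / (4 * hbar))‖ * Real.exp (-‖z‖ ^ 2 / (4 * hbar)) * ‖f.1 (z - v)‖ := by
      unfold heisenbergFun
      rw [norm_mul, norm_mul, Complex.norm_real, Real.norm_of_nonneg (Real.exp_pos _).le]
      ring
    rw [h4, key, norm_mul, Complex.norm_real, Real.norm_of_nonneg (Real.exp_pos _).le]
    ring

/-- The operator `U(v,t)` of the Heisenberg representation on the Fock space. -/
def heisenberg (v : W) (t : ℝ) (f : Fock hbar W) : Fock hbar W :=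
  ⟨heisenbergFun hbar v t f.1, heisenbergFun_mem v t f⟩

theorem memLp_vacuum (hbar : ℝ) [hpos : Fact (0 < hbar)] (W : Type uV) [NormedAddCommGroup W]
    [InnerProductSpace ℂ W] [FiniteDimensional ℂ W] [MeasurableSpace W] [BorelSpace W] :
    MemLp (fun z : W => (1 : ℂ) * Real.exp (-‖z‖ ^ 2 / (4 * hbar))) 2 (hermVolume W) := by
  let _ : InnerProductSpace ℝ W := InnerProductSpace.complexToReal
  have hb := hpos.out
  have h1 : Integrable (fun z : W => Real.exp (-(1 / (2 * hbar)) * ‖z‖ ^ 2)) (hermVolume W) := by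
    have h0 : Integrable (fun z : W => Complex.exp (-((1 / (2 * hbar) : ℝ) : ℂ) * (‖z‖ : ℂ) ^ 2 +
        0 * (inner ℝ (0 : W) z : ℂ))) (hermVolume W) :=
      GaussianFourier.integrable_cexp_neg_mul_sq_norm_add (V := W)
        (b := ((1 / (2 * hbar) : ℝ) : ℂ)) (by rw [Complex.ofReal_re]; positivity) 0 0
    refine h0.re.congr (Filter.Eventually.of_forall fun z => ?_)
    simp only [zero_mul, add_zero, RCLike.re_eq_complex_re]
    rw [show (-((1 / (2 * hbar) : ℝ) : ℂ) * (‖z‖ : ℂ) ^ 2)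
      = ((-(1 / (2 * hbar)) * ‖z‖ ^ 2 : ℝ) : ℂ) by push_cast; ring, Complex.exp_ofReal_re]
  rw [memLp_two_iff_integrable_sq_norm]
  · refine h1.congr (Filter.Eventually.of_forall fun z => ?_)
    simp only [one_mul, Complex.norm_real, Real.norm_of_nonneg (Real.exp_pos _).le]
    rw [← Real.exp_nat_mul]
    congr 1
    push_cast
    field_simp
    ring
  · exact Continuous.aestronglyMeasurable (by fun_prop)

/-- The constant function `1`, i.e. the coherent state `e_0`. -/
def vacuum (hbar : ℝ) [hpos : Fact (0 < hbar)] (W : Type uV) [NormedAddCommGroup W]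
    [InnerProductSpace ℂ W] [FiniteDimensional ℂ W] [MeasurableSpace W] [BorelSpace W] :
    Fock hbar W :=
  ⟨fun _ => 1, differentiable_const 1, memLp_vacuum hbar W⟩

end Fock

/-! ### The group `Mp^c` -/

section MpcGroup

variable {V : Type uV} [AddCommGroup V] [Module ℝ V] [FiniteDimensional ℝ V]
  {Ω : SymplecticForm V}

/-- The group `Mp^c(V, Ω, j)`: the pairs `(U, g)` of a unitary operator `U` of the Fock space of
`(V, Ω, j)` (a norm preserving linear bijection) and `g ∈ Sp(V, Ω)` such that
`U_j(g v, t) = U U_j(v, t) U⁻¹` for all `(v, t)`. -/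
def Mpc (hbar : ℝ) (J : PCCS Ω) :
    Subgroup ((Fock hbar (Herm J) ≃ₗ[ℂ] Fock hbar (Herm J)) × Sp Ω) where
  carrier := {A | (∀ f, fockNormSq (A.1 f) = fockNormSq f) ∧
    ∀ (v : V) (t : ℝ) (f : Fock hbar (Herm J)),
      heisenberg (toHerm J (A.2.1 v)) t f =
        A.1 (heisenberg (toHerm J v) t (A.1⁻¹ f))}
  mul_mem' := by
    rintro A B ⟨hA, hA'⟩ ⟨hB, hB'⟩
    refine ⟨fun f => (hA _).trans (hB f), fun v t f => ?_⟩
    have h1 := hA' (B.2.1 v) t f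
    rw [hB' v t] at h1
    exact h1
  one_mem' := ⟨fun f => rfl, fun v t f => rfl⟩
  inv_mem' := by
    rintro A ⟨hA, hA'⟩
    have e : ∀ f, A.1 (A.1⁻¹ f) = f := fun f => A.1.apply_symm_apply f
    have e' : ∀ f, A.1⁻¹ (A.1 f) = f := fun f => A.1.symm_apply_apply f
    refine ⟨fun f => ?_, fun v t f => ?_⟩
    · have := hA (A.1⁻¹ f)
      rw [e] at this
      exact this.symm
    · have h := hA' (A.2.1⁻¹ v) t (A.1 f)
      have e2 : A.2.1 (A.2.1⁻¹ v) = v := A.2.1.apply_symm_apply v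
      rw [e2, e'] at h
      change heisenberg (toHerm J (A.2.1⁻¹ v)) t f =
        A.1⁻¹ (heisenberg (toHerm J v) t (A.1⁻¹⁻¹ f))
      rw [inv_inv, h, e']

/-- The homomorphism `σ : Mp^c(V, Ω, j) → Sp(V, Ω)`, `(U, g) ↦ g`. -/
def sigma (hbar : ℝ) (J : PCCS Ω) : Mpc hbar J →* Sp Ω :=
  (MonoidHom.snd _ _).comp (Mpc hbar J).subtype

/-- The parameter `λ = (U e_0)(0)` of an element `(U, g)` of `Mp^c(V, Ω, j)`. -/
def mpcParam {hbar : ℝ} [Fact (0 < hbar)] {J : PCCS Ω} (A : Mpc hbar J) : ℂ :=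
  (A.1.1 (vacuum hbar (Herm J))).1 0

/-- Smoothness on a subset `s` of a manifold `N` of a map `c : N → Mp^c(V, Ω, j)`. The manifold
structure of `Mp^c(V, Ω, j)` is the one given by the parameters `(g, λ)`, which embed it as a closed
submanifold in `End(V) × ℂ`; hence `c` is smooth if and only if its symplectic part (tested on
vectors) and its parameter `λ` are smooth. -/
def SmoothMpcOn {hbar : ℝ} [Fact (0 < hbar)] {J : PCCS Ω}
    {F : Type uF} [NormedAddCommGroup F] [NormedSpace ℝ F]
    {H : Type*} [TopologicalSpace H] (I : ModelWithCorners ℝ F H)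
    {N : Type*} [TopologicalSpace N] [ChartedSpace H N]
    (c : N → Mpc hbar J) (s : Set N) : Prop :=
  (∀ v : V, ContMDiffOn I 𝓘(ℝ, Herm J) ∞
    (fun n => toHerm J ((sigma hbar J (c n)).1 v)) s) ∧
  ContMDiffOn I 𝓘(ℝ, ℂ) ∞ (fun n => mpcParam (c n)) s

end MpcGroup

/-! ### Symplectic manifolds, symplectic frames, symplectic actions -/

section Manifold

variable {E : Type uE} [NormedAddCommGroup E] [NormedSpace ℝ E]
  {M : Type uM} [TopologicalSpace M] [ChartedSpace E M]

/-- The expression of a field of alternating 2-forms in the preferred chart at `x₀`. -/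
def twoFormInChart (ωM : ∀ x : M, TangentSpace 𝓘(ℝ, E) x [⋀^Fin 2]→L[ℝ] ℝ) (x₀ : M) (y : E) :
    E [⋀^Fin 2]→L[ℝ] ℝ :=
  (ωM ((extChartAt 𝓘(ℝ, E) x₀).symm y)).compContinuousLinearMap
    (mfderiv 𝓘(ℝ, E) 𝓘(ℝ, E) (extChartAt 𝓘(ℝ, E) x₀).symm y)

variable (E M) in
/-- A symplectic structure on `M`: a smooth closed non-degenerate 2-form. -/
structure SymplecticStructure where
  form : ∀ x : M, TangentSpace 𝓘(ℝ, E) x [⋀^Fin 2]→L[ℝ] ℝ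
  smooth : ∀ x₀ : M, ContDiffOn ℝ ∞ (twoFormInChart form x₀) (extChartAt 𝓘(ℝ, E) x₀).target
  closed : ∀ x₀ : M, ∀ y ∈ (extChartAt 𝓘(ℝ, E) x₀).target, extDeriv (twoFormInChart form x₀) y = 0
  nondeg : ∀ (x : M) (v : TangentSpace 𝓘(ℝ, E) x), (∀ w, form x ![v, w] = 0) → v = 0

variable {V : Type uV} [AddCommGroup V] [Module ℝ V]

/-- A symplectic frame at `x`: a symplectic isomorphism `(V, Ω) → (T_x M, ω_x)`. -/
structure SympFrame (Ω : SymplecticForm V) (ωM : SymplecticStructure E M) (x : M) where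
  equiv : V ≃ₗ[ℝ] TangentSpace 𝓘(ℝ, E) x
  map_form : ∀ v w, ωM.form x ![equiv v, equiv w] = Ω.form v w

/-- The symplectic frame bundle `Sp(M, ω)`, as a set: the pairs of a point of `M` and a symplectic
frame at this point. -/
structure SpBundle (Ω : SymplecticForm V) (ωM : SymplecticStructure E M) where
  base : M
  frame : SympFrame Ω ωM base

variable {Ω : SymplecticForm V} {ωM : SymplecticStructure E M}

/-- A frame at `x`, as a point of `Sp(M, ω)`. -/
def SympFrame.pt {x : M} (b : SympFrame Ω ωM x) : SpBundle Ω ωM := ⟨x, b⟩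

/-- The value `b(v)` of a frame on `v ∈ V`, as a point of the tangent bundle. -/
def SpBundle.eval (b : SpBundle Ω ωM) (v : V) : TangentBundle 𝓘(ℝ, E) M := ⟨b.base, b.frame.equiv v⟩

/-- The right action `b ↦ b ∘ A` of `Sp(V, Ω)` on `Sp(M, ω)`. -/
def SpBundle.rmul (b : SpBundle Ω ωM) (A : Sp Ω) : SpBundle Ω ωM :=
  ⟨b.base, A.1.trans b.frame.equiv, fun v w => (b.frame.map_form _ _).trans (A.2 v w)⟩

theorem SpBundle.ext_eval {b b' : SpBundle Ω ωM} (h : ∀ v, b.eval v = b'.eval v) : b = b' := by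
  obtain ⟨x, e, he⟩ := b
  obtain ⟨y, e', he'⟩ := b'
  have hxy : x = y := congrArg (fun p : TangentBundle 𝓘(ℝ, E) M => p.1) (h 0)
  subst hxy
  have : e = e' := by
    ext v
    have := h v
    simpa [SpBundle.eval] using this
  subst this
  rfl

variable {F : Type uF} [NormedAddCommGroup F] [NormedSpace ℝ F]
  {G : Type uG} [TopologicalSpace G] [ChartedSpace F G] [Group G]
  [MulAction G M]

variable (F G) in
/-- The action of `G` on `M` is a symplectic action: it is smooth, as a map `G × M → M`, and every
`g ∈ G` preserves `ω`. -/
structure IsSymplecticAction (ωM : SymplecticStructure E M) : Prop where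
  smooth : ContMDiff (𝓘(ℝ, F).prod 𝓘(ℝ, E)) 𝓘(ℝ, E) ∞ (fun y : G × M => y.1 • y.2)
  preserves : ∀ (g : G) (x : M) (v w : TangentSpace 𝓘(ℝ, E) x),
    ωM.form (g • x) ![mfderiv 𝓘(ℝ, E) 𝓘(ℝ, E) (fun y : M => g • y) x v,
      mfderiv 𝓘(ℝ, E) 𝓘(ℝ, E) (fun y : M => g • y) x w] = ωM.form x ![v, w]

/-- The differential `g_* : T_x M → T_{gx} M` of the action of `g`. -/
def actTangent (hG : IsSymplecticAction F G ωM) (g : G) (x : M) :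
    TangentSpace 𝓘(ℝ, E) x ≃ₗ[ℝ] TangentSpace 𝓘(ℝ, E) (g • x) :=
  have : ContMDiffSMul 𝓘(ℝ, F) 𝓘(ℝ, E) ∞ G M := ⟨hG.smooth⟩
  ((Diffeomorph.smul 𝓘(ℝ, F) 𝓘(ℝ, E) ∞ g).mfderivToContinuousLinearEquiv
    (by simp) x).toLinearEquiv

theorem actTangent_apply (hG : IsSymplecticAction F G ωM) (g : G) (x : M)
    (v : TangentSpace 𝓘(ℝ, E) x) : actTangent hG g x v =
      mfderiv 𝓘(ℝ, E) 𝓘(ℝ, E) (fun y : M => g • y) x v := rfl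

/-- The action of `G` on `Sp(M, ω)` induced by a symplectic action: `b ↦ g_* ∘ b`. -/
def SpBundle.push (hG : IsSymplecticAction F G ωM) (g : G) (b : SpBundle Ω ωM) : SpBundle Ω ωM :=
  ⟨g • b.base, b.frame.equiv.trans (actTangent hG g b.base),
    fun v w => (hG.preserves g b.base _ _).trans (b.frame.map_form v w)⟩

theorem SpBundle.push_eval (hG : IsSymplecticAction F G ωM) (g : G) (b : SpBundle Ω ωM) (v : V) :
    (b.push hG g).eval v = tangentMap 𝓘(ℝ, E) 𝓘(ℝ, E) (fun y : M => g • y) (b.eval v) := rfl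

theorem SpBundle.push_mul (hG : IsSymplecticAction F G ωM) (g h : G) (b : SpBundle Ω ωM) :
    b.push hG (g * h) = (b.push hG h).push hG g := by
  have : ContMDiffSMul 𝓘(ℝ, F) 𝓘(ℝ, E) ∞ G M := ⟨hG.smooth⟩
  have hd : ∀ g : G, MDifferentiable 𝓘(ℝ, E) 𝓘(ℝ, E) (fun y : M => g • y) := fun g =>
    (ContMDiffSMul.contMDiff_const_smul (I := 𝓘(ℝ, F)) (n := ∞) g).mdifferentiable (by simp)
  refine SpBundle.ext_eval fun v => ?_
  rw [push_eval, push_eval, push_eval]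
  have : (fun y : M => (g * h) • y) = (fun y : M => g • y) ∘ (fun y : M => h • y) := by
    funext y; exact mul_smul g h y
  rw [this, tangentMap_comp (hd g) (hd h)]
  rfl

theorem SpBundle.push_rmul (hG : IsSymplecticAction F G ωM) (g : G) (b : SpBundle Ω ωM)
    (A : Sp Ω) : (b.rmul A).push hG g = (b.push hG g).rmul A := rfl

theorem SpBundle.rmul_mul (b : SpBundle Ω ωM) (A B : Sp Ω) :
    b.rmul (A * B) = (b.rmul A).rmul B := rfl

variable (E) in
/-- The identification of the tangent spaces at two equal points. -/
def tangentCast {x y : M} (h : x = y) :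
    TangentSpace 𝓘(ℝ, E) x ≃ₗ[ℝ] TangentSpace 𝓘(ℝ, E) y :=
  h ▸ LinearEquiv.refl ℝ (TangentSpace 𝓘(ℝ, E) x)

theorem tangentCast_eval {x y : M} (h : x = y) (v : TangentSpace 𝓘(ℝ, E) x) :
    (⟨y, tangentCast E h v⟩ : TangentBundle 𝓘(ℝ, E) M) = ⟨x, v⟩ := by
  subst h; rfl

theorem tangentCast_form {x y : M} (h : x = y) (v w : TangentSpace 𝓘(ℝ, E) x) :
    ωM.form y ![tangentCast E h v, tangentCast E h w] = ωM.form x ![v, w] := by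
  subst h; rfl

variable {p₀ : M}

/-- The isotropy representation `τ(k) = f₀⁻¹ ∘ (k_*)_{p₀} ∘ f₀ ∈ Sp(V, Ω)` of the stabilizer
`K` of `p₀`, relative to a symplectic frame `f₀` at `p₀`. -/
def isotropyRep (hG : IsSymplecticAction F G ωM) (f₀ : SympFrame Ω ωM p₀)
    (k : MulAction.stabilizer G p₀) : Sp Ω :=
  have hk : (k : G) • p₀ = p₀ := k.2
  ⟨f₀.equiv.trans ((actTangent hG (k : G) p₀).trans ((tangentCast E hk).trans f₀.equiv.symm)), by
    intro v w
    rw [← f₀.map_form]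
    simp only [LinearEquiv.trans_apply, LinearEquiv.apply_symm_apply]
    rw [tangentCast_form]
    exact (hG.preserves _ _ _ _).trans (f₀.map_form v w)⟩

theorem push_eq_rmul_isotropyRep (hG : IsSymplecticAction F G ωM) (f₀ : SympFrame Ω ωM p₀)
    (k : MulAction.stabilizer G p₀) :
    f₀.pt.push hG (k : G) = f₀.pt.rmul (isotropyRep hG f₀ k) := by
  have hk : (k : G) • p₀ = p₀ := k.2
  refine SpBundle.ext_eval fun v => ?_
  change _ = (⟨p₀, f₀.equiv (f₀.equiv.symm (tangentCast E hk
    (actTangent hG (k : G) p₀ (f₀.equiv v))))⟩ : TangentBundle 𝓘(ℝ, E) M)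
  rw [LinearEquiv.apply_symm_apply, tangentCast_eval]
  rfl

/-! ### Lifts of the isotropy representation -/

variable [FiniteDimensional ℝ V] {hbar : ℝ} [Fact (0 < hbar)] {J : PCCS Ω}

variable (hbar J) in
/-- A lift of the isotropy representation `τ : K → Sp(V, Ω)` to `Mp^c(V, Ω, j)`: a smooth
homomorphism `τ'` with `σ ∘ τ' = τ`. Smoothness on the closed subgroup `K` of `G` means that `τ'`
extends locally to a smooth map defined on an open subset of `G`. -/
structure IsotropyLift (hG : IsSymplecticAction F G ωM) (f₀ : SympFrame Ω ωM p₀) where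
  hom : MulAction.stabilizer G p₀ →* Mpc hbar J
  smooth : ∀ k₀ : MulAction.stabilizer G p₀, ∃ (u : Set G) (c : G → Mpc hbar J),
    IsOpen u ∧ (k₀ : G) ∈ u ∧ SmoothMpcOn 𝓘(ℝ, F) c u ∧
      ∀ k : MulAction.stabilizer G p₀, (k : G) ∈ u → c k = hom k
  lifts : ∀ k, sigma hbar J (hom k) = isotropyRep hG f₀ k

/-! ### `Mp^c`-structures and invariant `Mp^c`-structures -/

variable (M hbar J) in
/-- The data of a principal `Mp^c(V, Ω, j)`-bundle over `M` with total space `P`: the projection,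
the right action, and a bundle atlas, given as a set of local sections `(u, s)`, `s : u → P`
(each one being the same thing as a local trivialisation `(x, A) ↦ s(x)·A` over `u`; the values of
`s` outside `u` are irrelevant). -/
structure MpcBundleData (P : Type uP) where
  proj : P → M
  rmul : P → Mpc hbar J → P
  sections : Set (Set M × (M → P))

variable (E) in
/-- The axioms of a smooth principal bundle: a right action which is simply transitive on the
fibres, and local sections over the sets of an open cover, with smooth transition functions. -/
structure MpcBundleData.IsPrincipal {P : Type uP} (B : MpcBundleData M hbar J P) : Prop where
  rmul_one : ∀ p, B.rmul p 1 = p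
  rmul_mul : ∀ p A A', B.rmul p (A * A') = B.rmul (B.rmul p A) A'
  proj_rmul : ∀ p A, B.proj (B.rmul p A) = B.proj p
  simply_transitive : ∀ p q, B.proj p = B.proj q → ∃! A, B.rmul p A = q
  isOpen : ∀ a ∈ B.sections, IsOpen a.1
  proj_section : ∀ a ∈ B.sections, ∀ x ∈ a.1, B.proj (a.2 x) = x
  cover : ∀ x, ∃ a ∈ B.sections, x ∈ a.1
  transition : ∀ a ∈ B.sections, ∀ a' ∈ B.sections, ∃ c : M → Mpc hbar J,
    (∀ x ∈ a.1 ∩ a'.1, a'.2 x = B.rmul (a.2 x) (c x)) ∧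
      SmoothMpcOn 𝓘(ℝ, E) c (a.1 ∩ a'.1)

variable (ωM hbar J) in
/-- The data of an `Mp^c`-structure `(P, φ)`. -/
structure MpcStructureData (P : Type uP) extends MpcBundleData M hbar J P where
  φ : P → SpBundle Ω ωM

/-- The axioms of an `Mp^c`-structure: a principal bundle with a smooth fibre-preserving map `φ` to
`Sp(M, ω)` such that `φ(p·A) = φ(p)·σ(A)`. -/
structure MpcStructureData.IsMpcStructure [IsManifold 𝓘(ℝ, E) ∞ M] {P : Type uP}
    (S : MpcStructureData ωM hbar J P) : Prop where
  principal : S.toMpcBundleData.IsPrincipal E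
  fibre_preserving : ∀ p, (S.φ p).base = S.proj p
  equivariant : ∀ p A, S.φ (S.rmul p A) = (S.φ p).rmul (sigma hbar J A)
  smooth : ∀ a ∈ S.sections, ∀ v : V,
    ContMDiffOn 𝓘(ℝ, E) 𝓘(ℝ, E).tangent ∞ (fun x => (S.φ (a.2 x)).eval v) a.1

variable (ωM G hbar J) in
/-- The data of a `G`-invariant `Mp^c`-structure `(P, φ, ρ^P)`, with `smul g p = ρ^P(g) p`. -/
structure InvMpcData (P : Type uP) extends MpcStructureData ωM hbar J P where
  smul : G → P → P

/-- The axioms of a `G`-invariant `Mp^c`-structure: an `Mp^c`-structure with a smooth action of `G`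
on `P` which commutes with the right action of `Mp^c` and such that `φ` is equivariant. Smoothness
of the action `G × P → P` is expressed in the local trivialisations. -/
structure InvMpcData.IsInvariant [IsManifold 𝓘(ℝ, E) ∞ M] {P : Type uP} (S : InvMpcData ωM G hbar J P)
    (hG : IsSymplecticAction F G ωM) : Prop where
  mpc : S.toMpcStructureData.IsMpcStructure
  one_smul : ∀ p, S.smul 1 p = p
  mul_smul : ∀ g h p, S.smul (g * h) p = S.smul g (S.smul h p)
  smul_rmul : ∀ g p A, S.smul g (S.rmul p A) = S.rmul (S.smul g p) A
  φ_smul : ∀ g p, S.φ (S.smul g p) = (S.φ p).push hG g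
  smooth_smul : ∀ a ∈ S.sections, ∀ a' ∈ S.sections, ∃ c : G × M → Mpc hbar J,
    (∀ y : G × M, y.2 ∈ a.1 → y.1 • y.2 ∈ a'.1 →
      S.smul y.1 (a.2 y.2) = S.rmul (a'.2 (y.1 • y.2)) (c y)) ∧
    SmoothMpcOn (𝓘(ℝ, F).prod 𝓘(ℝ, E)) c {y | y.2 ∈ a.1 ∧ y.1 • y.2 ∈ a'.1}

/-- An isomorphism of `G`-invariant `Mp^c`-structures: an isomorphism of principal bundles over `M`
(a bijection which is smooth in the local trivialisations; so is then its inverse) which is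
compatible with the maps to `Sp(M, ω)` and with the actions of `G`. -/
structure InvMpcIso {P : Type uP} {P' : Type uP'} (S : InvMpcData ωM G hbar J P)
    (S' : InvMpcData ωM G hbar J P') where
  equiv : P ≃ P'
  proj_equiv : ∀ p, S'.proj (equiv p) = S.proj p
  map_rmul : ∀ p A, equiv (S.rmul p A) = S'.rmul (equiv p) A
  φ_equiv : ∀ p, S'.φ (equiv p) = S.φ p
  map_smul : ∀ g p, equiv (S.smul g p) = S'.smul g (equiv p)
  smooth : ∀ a ∈ S.sections, ∀ a' ∈ S'.sections, ∃ c : M → Mpc hbar J,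
    (∀ x ∈ a.1 ∩ a'.1, equiv (a.2 x) = S'.rmul (a'.2 x) (c x)) ∧
      SmoothMpcOn 𝓘(ℝ, E) c (a.1 ∩ a'.1)

/-! ### The structure `G ×_{K,τ'} Mp^c(V, Ω, j)` -/

variable {hG : IsSymplecticAction F G ωM} {f₀ : SympFrame Ω ωM p₀}

/-- The equivalence relation `(g, B) ∼ (g k, τ'(k)⁻¹ B)`, `k ∈ K`, on `G × Mp^c`. -/
def assocSetoid (L : IsotropyLift hbar J hG f₀) : Setoid (G × Mpc hbar J) where
  r y y' := ∃ k : MulAction.stabilizer G p₀, y' = (y.1 * k, (L.hom k)⁻¹ * y.2)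
  iseqv :=
    { refl := fun y => ⟨1, by simp⟩
      symm := by
        rintro y _ ⟨k, rfl⟩
        exact ⟨k⁻¹, by simp⟩
      trans := by
        rintro y _ _ ⟨k, rfl⟩ ⟨l, rfl⟩
        exact ⟨k * l, by simp [mul_assoc]⟩ }

/-- The set `G ×_{K,τ'} Mp^c(V, Ω, j)`. -/
def AssocSpace (L : IsotropyLift hbar J hG f₀) : Type (max uG uV) := Quotient (assocSetoid L)

/-- The class `[g, B]`. -/
def AssocSpace.mk (L : IsotropyLift hbar J hG f₀) (g : G) (B : Mpc hbar J) : AssocSpace L :=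
  Quotient.mk (assocSetoid L) (g, B)

/-- `G ×_{K,τ'} Mp^c(V, Ω, j)`, with `[g, B] ↦ g p₀` as projection, the right action
`[g, B]·A = [g, B A]`, the map `φ[g, B] = g_* ∘ f₀ ∘ σ(B)` and the action `g·[g', B] = [g g', B]`
of `G`. The bundle atlas consists of the local sections `x ↦ [t(x), 1]`, where `t` is a smooth
local section of the map `G → M`, `g ↦ g p₀`. -/
def assocMpc (L : IsotropyLift hbar J hG f₀) : InvMpcData ωM G hbar J (AssocSpace L) where
  proj := Quotient.lift (fun y => y.1 • p₀) (by
    rintro y _ ⟨k, rfl⟩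
    have hk : (k : G) • p₀ = p₀ := k.2
    simp [mul_smul, hk])
  rmul q A := Quotient.lift (fun y => AssocSpace.mk L y.1 (y.2 * A)) (by
    rintro y _ ⟨k, rfl⟩
    exact Quotient.sound ⟨k, by simp [mul_assoc]⟩) q
  sections := {a | IsOpen a.1 ∧ ∃ t : M → G, ContMDiffOn 𝓘(ℝ, E) 𝓘(ℝ, F) ∞ t a.1 ∧
    (∀ x ∈ a.1, t x • p₀ = x) ∧ ∀ x, a.2 x = AssocSpace.mk L (t x) 1}
  φ := Quotient.lift (fun y => (f₀.pt.push hG y.1).rmul (sigma hbar J y.2)) (by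
    rintro y _ ⟨k, rfl⟩
    rw [SpBundle.push_mul, push_eq_rmul_isotropyRep, SpBundle.push_rmul, ← SpBundle.rmul_mul,
      map_mul, map_inv, L.lifts, mul_inv_cancel_left])
  smul g := Quotient.lift (fun y => AssocSpace.mk L (g * y.1) y.2) (by
    rintro y _ ⟨k, rfl⟩
    exact Quotient.sound ⟨k, by simp [mul_assoc]⟩)

end Manifold

end

end MpcTheory

/-! An invariant structure on a homogeneous space is determined by what the stabilizer does to one
point over p₀. Choose p with φ(p) = f₀. For k in K the point k·p lies in the fibre of p, so k·p =
p·τ'(k) for a unique τ'(k). The left and right actions commute, so τ' is a homomorphism; applying φ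
to the relation gives σ∘τ' = τ. The map [g, B] ↦ g·(p·B) is then an isomorphism from the associated
structure. Conversely, any lift makes G ×_K Mp^c an invariant structure.

This argument rests on three facts, which take up most of the proof.

Surjectivity of σ (`sigma_surjective`), needed for p to exist. To implement g, coherent states U(w)1
are sent to multiples of U(gw)γ, where γ is the Gaussian with exponent given by Z_g. The inner
products of the two families agree, up to normalisation, because exp(|w|²/4ħ)⟨U(gw)γ, γ⟩ is entire
in w and Hermitian symmetric, hence constant (`SympPair.overlap_eq`). Total coherent states and a
complete Fock space give an isometry; Schur's lemma makes it unitary.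

Smoothness of the group operations of Mp^c in the parameters (g, λ). The reproducing property ties
U1 to U⁻¹1; differentiating this relation gives a first order equation whose only solutions are λγ
(`GaussRel.fderiv_eq`). Hence λ(AB) is λ(A)λ(B) times a Gaussian integral (`mpcParam_mul`), which is
smooth in the quadratic forms since differentiation under the integral can be repeated indefinitely.

Smooth local sections of g ↦ g p₀ (`exists_local_section_orbit`). The map is open by a Baire
argument, has constant rank by homogeneity, and an open map of constant rank is a submersion. -/

namespace MpcTheory

noncomputable section

set_option linter.unusedSectionVars false

/-! ### Smoothness of exponential integrals in a parameter -/

section ExponentialIntegral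

open Metric

variable {X : Type*} [MeasurableSpace X] {𝕜 : Type*} [RCLike 𝕜] [NormedAlgebra 𝕜 ℂ]
  {B : Type uV} [NormedAddCommGroup B] [NormedSpace 𝕜 B]

/-- Local exponential domination of the integrand `exp (ℓ z b) • p z`. -/
def ExpDominated {Y : Type*} [NormedAddCommGroup Y] (μ : Measure X) (ℓ : X → B →L[𝕜] ℂ)
    (U : Set B) (p : X → Y) : Prop :=
  ∀ b ∈ U, ∃ r > 0,
    Integrable (fun z => Real.exp (r * ‖ℓ z‖) * Real.exp (ℓ z b).re * ‖p z‖) μ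

variable {Y : Type uM} [NormedAddCommGroup Y] [NormedSpace ℂ Y] [NormedSpace 𝕜 Y]
  [SMulCommClass 𝕜 ℂ Y] [IsScalarTower 𝕜 ℂ Y]
  {μ : Measure X} {ℓ : X → B →L[𝕜] ℂ} {U : Set B} {p : X → Y}

/-- The factor of `exp (ℓ z b)` in the derivative of `b ↦ exp (ℓ z b) • p z`. -/
def expDerivFactor (ℓ : X → B →L[𝕜] ℂ) (p : X → Y) (z : X) : B →L[𝕜] Y :=
  ((ContinuousLinearMap.lsmul 𝕜 ℂ : ℂ →L[𝕜] Y →L[𝕜] Y).flip (p z)).comp (ℓ z)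

theorem norm_expDerivFactor_le (z : X) : ‖expDerivFactor ℓ p z‖ ≤ ‖ℓ z‖ * ‖p z‖ := by
  refine ContinuousLinearMap.opNorm_le_bound _ (by positivity) fun b => ?_
  change ‖ℓ z b • p z‖ ≤ _
  rw [norm_smul, mul_right_comm]
  gcongr
  exact (ℓ z).le_opNorm b

theorem aestronglyMeasurable_expDerivFactor (hℓ : AEStronglyMeasurable ℓ μ)
    (hp : AEStronglyMeasurable p μ) : AEStronglyMeasurable (expDerivFactor ℓ p) μ := by
  have hc : Continuous fun q : (B →L[𝕜] ℂ) × Y =>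
      ((ContinuousLinearMap.lsmul 𝕜 ℂ : ℂ →L[𝕜] Y →L[𝕜] Y).flip q.2).comp q.1 := by
    fun_prop
  have h := hc.comp_aestronglyMeasurable (hℓ.prodMk hp)
  exact h

theorem aestronglyMeasurable_exp_smul (hℓ : AEStronglyMeasurable ℓ μ)
    (hp : AEStronglyMeasurable p μ) (b : B) :
    AEStronglyMeasurable (fun z => Complex.exp (ℓ z b) • p z) μ := by
  have hc : Continuous fun q : (B →L[𝕜] ℂ) × Y => Complex.exp (q.1 b) • q.2 :=
    (Complex.continuous_exp.comp (((ContinuousLinearMap.apply 𝕜 ℂ b).continuous).comp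
      continuous_fst)).smul continuous_snd
  exact hc.comp_aestronglyMeasurable (hℓ.prodMk hp)

theorem ExpDominated.integrable (h : ExpDominated μ ℓ U p) (hℓ : AEStronglyMeasurable ℓ μ)
    (hp : AEStronglyMeasurable p μ) {b : B} (hb : b ∈ U) :
    Integrable (fun z => Complex.exp (ℓ z b) • p z) μ := by
  obtain ⟨r, hr, hi⟩ := h b hb
  refine hi.mono' (aestronglyMeasurable_exp_smul hℓ hp b) (Filter.Eventually.of_forall fun z => ?_)
  rw [norm_smul, Complex.norm_exp]
  gcongr
  exact le_mul_of_one_le_left (Real.exp_pos _).le (Real.one_le_exp (by positivity))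

/-- Half of the exponential margin absorbs the factor ‖ℓ z‖ produced by a derivative, since t ≤
(2/r) exp(rt/2). The domination condition is therefore stable under differentiation, at the cost of
halving r. -/
theorem ExpDominated.expDerivFactor (h : ExpDominated μ ℓ U p) (hℓ : AEStronglyMeasurable ℓ μ)
    (hp : AEStronglyMeasurable p μ) : ExpDominated μ ℓ U (expDerivFactor ℓ p) := by
  intro b hb
  obtain ⟨r, hr, hi⟩ := h b hb
  refine ⟨r / 2, by positivity, ?_⟩
  refine (hi.const_mul (2 / r)).mono' ?_ (Filter.Eventually.of_forall fun z => ?_)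
  · have hm := (aestronglyMeasurable_expDerivFactor hℓ hp).norm
    have hc : Continuous fun q : B →L[𝕜] ℂ =>
        Real.exp (r / 2 * ‖q‖) * Real.exp (q b).re :=
      (Real.continuous_exp.comp (continuous_const.mul continuous_norm)).mul
        (Real.continuous_exp.comp (Complex.continuous_re.comp
          (ContinuousLinearMap.apply 𝕜 ℂ b).continuous))
    exact (hc.comp_aestronglyMeasurable hℓ).mul hm
  · rw [Real.norm_of_nonneg (by positivity)]
    have h1 : ‖ℓ z‖ ≤ 2 / r * Real.exp (r / 2 * ‖ℓ z‖) := by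
      have h2 := Real.add_one_le_exp (r / 2 * ‖ℓ z‖)
      have h3 : r / 2 * ‖ℓ z‖ ≤ Real.exp (r / 2 * ‖ℓ z‖) := by linarith
      calc ‖ℓ z‖ = 2 / r * (r / 2 * ‖ℓ z‖) := by field_simp
        _ ≤ _ := by gcongr
    have h4 : Real.exp (r * ‖ℓ z‖) = Real.exp (r / 2 * ‖ℓ z‖) * Real.exp (r / 2 * ‖ℓ z‖) := by
      rw [← Real.exp_add]; congr 1; ring
    calc Real.exp (r / 2 * ‖ℓ z‖) * Real.exp (ℓ z b).re * ‖MpcTheory.expDerivFactor ℓ p z‖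
        ≤ Real.exp (r / 2 * ‖ℓ z‖) * Real.exp (ℓ z b).re *
          ((2 / r * Real.exp (r / 2 * ‖ℓ z‖)) * ‖p z‖) := by
          gcongr
          exact (norm_expDerivFactor_le z).trans (by gcongr)
      _ = _ := by rw [h4]; ring

/-- On the ball of radius r about b the real part of the exponent varies by at most r‖ℓ z‖, so the
domination at b bounds the derivative uniformly on that ball. -/
theorem ExpDominated.hasFDerivAt (h : ExpDominated μ ℓ U p)
    (hℓ : AEStronglyMeasurable ℓ μ) (hp : AEStronglyMeasurable p μ) {b : B} (hb : b ∈ U) :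
    HasFDerivAt (fun b => ∫ z, Complex.exp (ℓ z b) • p z ∂μ)
      (∫ z, Complex.exp (ℓ z b) • MpcTheory.expDerivFactor ℓ p z ∂μ) b := by
  obtain ⟨r, hr, hi⟩ := h.expDerivFactor hℓ hp b hb
  refine hasFDerivAt_integral_of_dominated_of_fderiv_le (s := ball b r)
    (F := fun b z => Complex.exp (ℓ z b) • p z)
    (F' := fun b z => Complex.exp (ℓ z b) • MpcTheory.expDerivFactor ℓ p z)
    (bound := fun z => Real.exp (r * ‖ℓ z‖) * Real.exp (ℓ z b).re *
      ‖MpcTheory.expDerivFactor ℓ p z‖) (ball_mem_nhds b hr)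
    (Filter.Eventually.of_forall fun x => aestronglyMeasurable_exp_smul hℓ hp x)
    (h.integrable hℓ hp hb) ?_ (Filter.Eventually.of_forall fun z x hx => ?_) hi
    (Filter.Eventually.of_forall fun z x _ => ?_)
  · exact aestronglyMeasurable_exp_smul hℓ (aestronglyMeasurable_expDerivFactor hℓ hp) b
  · rw [norm_smul, Complex.norm_exp, ← Real.exp_add]
    gcongr
    have h1 : (ℓ z x).re - (ℓ z b).re ≤ ‖ℓ z‖ * r := by
      rw [← Complex.sub_re, ← map_sub]
      refine (Complex.re_le_norm _).trans (((ℓ z).le_opNorm _).trans ?_)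
      gcongr
      exact (mem_ball_iff_norm.1 hx).le
    linarith
  · have h1 : HasFDerivAt (fun b => Complex.exp (ℓ z b)) (Complex.exp (ℓ z x) • ℓ z) x :=
      (ℓ z).hasFDerivAt.cexp
    have h2 := ((ContinuousLinearMap.lsmul 𝕜 ℂ : ℂ →L[𝕜] Y →L[𝕜] Y).flip
      (p z)).hasFDerivAt.comp x h1
    refine h2.congr_fderiv ?_
    ext y
    simp [MpcTheory.expDerivFactor, smul_smul]

/-- The derivative is an integral of the same shape with values in `B →L[𝕜] Y`, so the induction
must range over all target spaces. The universe `max uV uM` is closed under this change of target.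
-/
theorem ExpDominated.contDiffOn_nat (hU : IsOpen U) (hℓ : AEStronglyMeasurable ℓ μ) (n : ℕ) :
    ∀ (Y : Type (max uV uM)) [NormedAddCommGroup Y] [NormedSpace ℂ Y]
      [NormedSpace 𝕜 Y] [SMulCommClass 𝕜 ℂ Y] [IsScalarTower 𝕜 ℂ Y] (p : X → Y),
      ExpDominated μ ℓ U p → AEStronglyMeasurable p μ →
        ContDiffOn 𝕜 n (fun b => ∫ z, Complex.exp (ℓ z b) • p z ∂μ) U := by
  induction n with
  | zero =>
    intro Y _ _ _ _ _ p h hp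
    exact contDiffOn_zero.2 fun b hb => (h.hasFDerivAt hℓ hp hb).continuousAt.continuousWithinAt
  | succ n ih =>
    intro Y _ _ _ _ _ p h hp
    rw [Nat.cast_add, Nat.cast_one, contDiffOn_succ_iff_fderiv_of_isOpen hU]
    refine ⟨fun b hb => (h.hasFDerivAt hℓ hp hb).differentiableAt.differentiableWithinAt,
      fun hn => absurd hn (by simp), ?_⟩
    refine (ih (B →L[𝕜] Y) _ (h.expDerivFactor hℓ hp)
      (aestronglyMeasurable_expDerivFactor hℓ hp)).congr fun b hb => ?_
    exact (h.hasFDerivAt hℓ hp hb).fderiv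

/-- The integral `∫ exp (ℓ z b) • p z ∂μ(z)` is a smooth function of `b`. -/
theorem ExpDominated.contDiffOn (hU : IsOpen U) (h : ExpDominated μ ℓ U p)
    (hℓ : AEStronglyMeasurable ℓ μ) (hp : AEStronglyMeasurable p μ) :
    ContDiffOn 𝕜 ∞ (fun b => ∫ z, Complex.exp (ℓ z b) • p z ∂μ) U := by
  refine (contDiffOn_infty_iff_fderiv_of_isOpen hU).2
    ⟨fun b hb => (h.hasFDerivAt hℓ hp hb).differentiableAt.differentiableWithinAt,
      contDiffOn_infty.2 fun n => ?_⟩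
  -- One derivative is taken by hand because `Y` itself lies in `uM`, while its first derivative
  -- already takes values in the universe of the induction.
  refine (contDiffOn_nat.{uV, uM} hU hℓ n (B →L[𝕜] Y) _ (h.expDerivFactor hℓ hp)
    (aestronglyMeasurable_expDerivFactor hℓ hp)).congr fun b hb => ?_
  exact (h.hasFDerivAt hℓ hp hb).fderiv

end ExponentialIntegral

/-! ### Symplectic maps of a Hermitian space -/

section SymplecticMaps

variable {W : Type uV} [NormedAddCommGroup W] [InnerProductSpace ℂ W]

/-- `g` is a linear automorphism of the symplectic form `im ⟨v, w⟩`, with inverse `gi`. -/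
structure SympPair (g gi : W →L[ℝ] W) : Prop where
  left_inv : ∀ x, gi (g x) = x
  right_inv : ∀ x, g (gi x) = x
  im_inner : ∀ v w, (inner ℂ (g v) (g w)).im = (inner ℂ v w).im

theorem SympPair.symm {g gi : W →L[ℝ] W} (h : SympPair g gi) : SympPair gi g where
  left_inv := h.right_inv
  right_inv := h.left_inv
  im_inner v w := by rw [← h.im_inner, h.right_inv, h.right_inv]

theorem SympPair.refl : SympPair (ContinuousLinearMap.id ℝ W) (ContinuousLinearMap.id ℝ W) :=
  ⟨fun _ => rfl, fun _ => rfl, fun _ _ => rfl⟩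

theorem im_inner_I_right (v w : W) : (inner ℂ v (Complex.I • w)).im = (inner ℂ v w).re := by
  simp

theorem re_inner_I_right (v w : W) : (inner ℂ v (Complex.I • w)).re = -(inner ℂ v w).im := by
  simp

theorem im_inner_I_left (v w : W) : (inner ℂ (Complex.I • v) w).im = -(inner ℂ v w).re := by
  simp

theorem re_inner_I_left (v w : W) : (inner ℂ (Complex.I • v) w).re = (inner ℂ v w).im := by
  simp

theorem im_inner_swap (v w : W) : (inner ℂ v w).im = -(inner ℂ w v).im := by
  rw [← inner_conj_symm, Complex.conj_im]

theorem re_inner_swap (v w : W) : (inner ℂ v w).re = (inner ℂ w v).re := by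
  rw [← inner_conj_symm, Complex.conj_re]

/-- Twice `i` times the complex linear part of `g`. -/
def linPart (g : W →L[ℝ] W) : W →L[ℝ] W :=
  Complex.I • g + g.comp (Complex.I • ContinuousLinearMap.id ℝ W)

/-- Twice `i` times the antilinear part of `g`. -/
def antiPart (g : W →L[ℝ] W) : W →L[ℝ] W :=
  Complex.I • g - g.comp (Complex.I • ContinuousLinearMap.id ℝ W)

theorem linPart_apply (g : W →L[ℝ] W) (x : W) :
    linPart g x = Complex.I • g x + g (Complex.I • x) := rfl

theorem antiPart_apply (g : W →L[ℝ] W) (x : W) :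
    antiPart g x = Complex.I • g x - g (Complex.I • x) := rfl

theorem I_smul_I_smul (x : W) : Complex.I • Complex.I • x = -x := by
  rw [smul_smul, Complex.I_mul_I, neg_one_smul]

theorem linPart_I (g : W →L[ℝ] W) (x : W) :
    linPart g (Complex.I • x) = Complex.I • linPart g x := by
  simp only [linPart_apply, I_smul_I_smul, smul_add, map_neg]
  abel

theorem antiPart_I (g : W →L[ℝ] W) (x : W) :
    antiPart g (Complex.I • x) = -(Complex.I • antiPart g x) := by
  simp only [antiPart_apply, I_smul_I_smul, smul_sub, map_neg]
  abel

theorem linPart_add_antiPart (g : W →L[ℝ] W) (x : W) :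
    linPart g x + antiPart g x = (2 : ℂ) • Complex.I • g x := by
  rw [linPart_apply, antiPart_apply, two_smul]; abel

variable {g gi : W →L[ℝ] W}

/-- Polarisation: the two squared norms differ by 4 Re⟨i g x, g(ix)⟩, which is 4‖x‖² because g
preserves the imaginary part. This is the Bogoliubov relation; it makes the linear part invertible
and Z_g a strict contraction. -/
theorem SympPair.norm_linPart (h : SympPair g gi) (x : W) :
    ‖linPart g x‖ ^ 2 = ‖antiPart g x‖ ^ 2 + 4 * ‖x‖ ^ 2 := by
  have h1 := @norm_add_sq ℂ W _ _ _ (Complex.I • g x) (g (Complex.I • x))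
  have h2 := @norm_sub_sq ℂ W _ _ _ (Complex.I • g x) (g (Complex.I • x))
  rw [linPart_apply, antiPart_apply, h1, h2]
  have h3 : (inner ℂ (Complex.I • g x) (g (Complex.I • x))).re = ‖x‖ ^ 2 := by
    rw [re_inner_I_left, h.im_inner, im_inner_I_right]
    exact @inner_self_eq_norm_sq ℂ W _ _ _ x
  simp only [RCLike.re_eq_complex_re, h3]
  ring

theorem SympPair.linPart_injective (h : SympPair g gi) : Function.Injective (linPart g) := by
  rw [injective_iff_map_eq_zero]
  intro x hx
  have h1 := h.norm_linPart x
  rw [hx] at h1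
  have h2 : ‖x‖ ^ 2 ≤ 0 := by nlinarith [sq_nonneg ‖antiPart g x‖, norm_zero (E := W)]
  exact norm_eq_zero.1 (pow_eq_zero_iff (two_ne_zero) |>.1 (le_antisymm h2 (sq_nonneg _)))

/-- Two complex linear functions with the same imaginary part agree. -/
theorem eq_of_im_eq {a b : W → ℂ} (ha : ∀ x, a (Complex.I • x) = Complex.I * a x)
    (hb : ∀ x, b (Complex.I • x) = Complex.I * b x) (h : ∀ x, (a x).im = (b x).im) (x : W) :
    a x = b x := by
  refine Complex.ext ?_ (h x)
  have := h (Complex.I • x)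
  rw [ha, hb] at this
  simpa using this

/-- Both sides are complex linear in x, so only imaginary parts need comparing, and those are
controlled by the symplectic form. This is the symmetry of the quadratic form attached to Z_g. -/
theorem SympPair.inner_antiPart_linPart (h : SympPair g gi) (x y : W) :
    inner ℂ (antiPart g x) (linPart g y) = inner ℂ (antiPart g y) (linPart g x) := by
  refine eq_of_im_eq (a := fun x => inner ℂ (antiPart g x) (linPart g y))
    (b := fun x => inner ℂ (antiPart g y) (linPart g x)) ?_ ?_ ?_ x
  · intro x; simp [antiPart_I, inner_smul_left]
  · intro x; simp [linPart_I]
  · intro x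
    simp only [antiPart_apply, linPart_apply, inner_add_right, inner_sub_left, Complex.add_im,
      Complex.sub_im]
    rw [im_inner_I_left (g x), im_inner_I_left (g y), re_inner_I_right, re_inner_I_right,
      im_inner_swap (g (Complex.I • x)) (Complex.I • g y),
      im_inner_swap (g (Complex.I • y)) (Complex.I • g x),
      h.im_inner, h.im_inner, h.im_inner, h.im_inner, im_inner_I_right, im_inner_I_right,
      re_inner_I_left, re_inner_I_left, im_inner_swap y x]
    ring

/-- The symplectic adjoint of g is its inverse, so on complex linear parts the Hermitian adjoint is
given by g⁻¹; the sign comes from the factor 2i in `linPart`. -/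
theorem SympPair.inner_linPart (h : SympPair g gi) (a w : W) :
    inner ℂ a (linPart g w) = -inner ℂ (linPart gi a) w := by
  refine eq_of_im_eq (a := fun w => inner ℂ a (linPart g w))
    (b := fun w => -inner ℂ (linPart gi a) w) ?_ ?_ ?_ w
  · intro x; simp [linPart_I]
  · intro x; simp
  · intro w
    simp only [linPart_apply, inner_add_right, inner_add_left, Complex.add_im, Complex.neg_im]
    rw [← h.im_inner (gi _) w, ← h.symm.im_inner a (g (Complex.I • w)), h.left_inv,
      h.right_inv, im_inner_I_left, im_inner_I_right, im_inner_I_left, im_inner_I_right]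
    ring

/-- The operator `Z_g = (j - g j g⁻¹)(j + g j g⁻¹)⁻¹`. -/
def sympZ (g : W →L[ℝ] W) : W →L[ℝ] W := antiPart g * Ring.inverse (linPart g)

variable [FiniteDimensional ℂ W]

theorem isUnit_of_injective {T : W →L[ℝ] W} (h : Function.Injective T) : IsUnit T := by
  let e := LinearEquiv.ofInjectiveEndo (T : W →ₗ[ℝ] W) h
  let e' := e.toContinuousLinearEquiv
  refine ⟨⟨T, e'.symm, ?_, ?_⟩, rfl⟩
  · ext x; exact e.apply_symm_apply x
  · ext x; exact e.symm_apply_apply x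

theorem SympPair.isUnit_linPart (h : SympPair g gi) : IsUnit (linPart g) :=
  isUnit_of_injective h.linPart_injective

theorem SympPair.exists_linPart_eq (h : SympPair g gi) (y : W) : ∃ x, linPart g x = y := by
  refine ⟨Ring.inverse (linPart g) y, ?_⟩
  change (linPart g * Ring.inverse (linPart g)) y = y
  rw [Ring.mul_inverse_cancel _ h.isUnit_linPart]; rfl

theorem SympPair.sympZ_linPart (h : SympPair g gi) (x : W) :
    sympZ g (linPart g x) = antiPart g x := by
  change (antiPart g * Ring.inverse (linPart g) * linPart g) x = _
  rw [mul_assoc, Ring.inverse_mul_cancel _ h.isUnit_linPart, mul_one]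

theorem SympPair.sympZ_I (h : SympPair g gi) (y : W) :
    sympZ g (Complex.I • y) = -(Complex.I • sympZ g y) := by
  obtain ⟨x, rfl⟩ := h.exists_linPart_eq y
  rw [← linPart_I, h.sympZ_linPart, h.sympZ_linPart, antiPart_I]

theorem SympPair.inner_sympZ_comm (h : SympPair g gi) (x y : W) :
    inner ℂ (sympZ g x) y = inner ℂ (sympZ g y) x := by
  obtain ⟨x, rfl⟩ := h.exists_linPart_eq x
  obtain ⟨y, rfl⟩ := h.exists_linPart_eq y
  rw [h.sympZ_linPart, h.sympZ_linPart, h.inner_antiPart_linPart]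

theorem SympPair.norm_sympZ_apply_lt (h : SympPair g gi) {y : W} (hy : y ≠ 0) :
    ‖sympZ g y‖ < ‖y‖ := by
  obtain ⟨x, rfl⟩ := h.exists_linPart_eq y
  rw [h.sympZ_linPart]
  refine lt_of_pow_lt_pow_left₀ 2 (norm_nonneg _) ?_
  rw [h.norm_linPart]
  have : x ≠ 0 := by rintro rfl; simp at hy
  have : 0 < ‖x‖ := norm_pos_iff.2 this
  nlinarith [sq_pos_of_pos this]

theorem norm_lt_one_of_apply_lt {T : W →L[ℝ] W} (h : ∀ y, y ≠ 0 → ‖T y‖ < ‖y‖) : ‖T‖ < 1 := by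
  have : ProperSpace W := FiniteDimensional.proper ℂ W
  -- Compactness of the unit sphere turns the pointwise strict inequality into a uniform one; the
  -- sphere is empty exactly when the space is zero.
  obtain hs | hs := (Metric.sphere (0 : W) 1).eq_empty_or_nonempty
  · refine lt_of_le_of_lt (T.opNorm_le_bound le_rfl fun x => ?_) zero_lt_one
    by_cases hx : x = 0
    · simp [hx]
    · refine absurd (hs ▸ (?_ : ((‖x‖⁻¹ : ℝ) • x) ∈ Metric.sphere (0 : W) 1)) (by simp)
      simp [norm_smul, hx]
  · obtain ⟨x, hx, hmax⟩ := (isCompact_sphere (0 : W) 1).exists_isMaxOn hs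
      (f := fun y => ‖T y‖) (by fun_prop)
    have hx1 : ‖x‖ = 1 := by simpa using hx
    have hx0 : x ≠ 0 := by rintro rfl; simp at hx1
    refine lt_of_le_of_lt (T.opNorm_le_bound (norm_nonneg (T x)) fun y => ?_) (hx1 ▸ h x hx0)
    by_cases hy : y = 0
    · simp [hy]
    · have h1 : ((‖y‖⁻¹ : ℝ) • y) ∈ Metric.sphere (0 : W) 1 := by simp [norm_smul, hy]
      have h2 : ‖T ((‖y‖⁻¹ : ℝ) • y)‖ ≤ ‖T x‖ := hmax h1
      rw [map_smul, norm_smul, norm_inv, norm_norm, inv_mul_le_iff₀ (norm_pos_iff.2 hy)] at h2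
      linarith

theorem SympPair.norm_sympZ_lt_one (h : SympPair g gi) : ‖sympZ g‖ < 1 :=
  norm_lt_one_of_apply_lt fun _ hy => h.norm_sympZ_apply_lt hy

theorem sympZ_id : sympZ (ContinuousLinearMap.id ℝ W) = 0 := by
  have : antiPart (ContinuousLinearMap.id ℝ W) = 0 := by ext x; simp [antiPart_apply]
  rw [sympZ, this, zero_mul]

/-- The complex linear operator `(1 + Z_g) g`. -/
def cohOp (g : W →L[ℝ] W) : W →L[ℝ] W := (1 + sympZ g) * g

theorem cohOp_apply (w : W) : cohOp g w = g w + sympZ g (g w) := rfl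

/-- Since g∘`linPart gi` = `linPart g`∘gi, applying 1 + Z_g produces the sum of the linear and
antilinear parts. Thus `cohOp g` is 2i times the inverse of a complex linear operator, and so is
itself complex linear. -/
theorem SympPair.cohOp_linPart (h : SympPair g gi) (a : W) :
    cohOp g (linPart gi a) = (2 : ℂ) • Complex.I • a := by
  have h1 : g (linPart gi a) = linPart g (gi a) := by
    rw [linPart_apply, linPart_apply, map_add, h.right_inv, h.right_inv, add_comm]
  rw [cohOp_apply, h1, h.sympZ_linPart, linPart_add_antiPart, h.right_inv]

theorem SympPair.cohOp_I (h : SympPair g gi) (w : W) :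
    cohOp g (Complex.I • w) = Complex.I • cohOp g w := by
  obtain ⟨a, rfl⟩ := h.symm.exists_linPart_eq w
  rw [← linPart_I, h.cohOp_linPart, h.cohOp_linPart, smul_comm (2 : ℂ)]

theorem SympPair.inner_cohOp_linPart (h : SympPair g gi) (w : W) :
    inner ℂ (cohOp g w) (linPart g w) = 2 * Complex.I * (‖w‖ : ℂ) ^ 2 := by
  obtain ⟨a, ha⟩ := h.symm.exists_linPart_eq w
  have h2 : inner ℂ w w = (‖w‖ : ℂ) ^ 2 := inner_self_eq_norm_sq_to_K w
  nth_rw 1 [← ha]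
  rw [h.cohOp_linPart, inner_smul_left, inner_smul_left, h.inner_linPart, ha, h2,
    Complex.conj_I, Complex.conj_ofNat]
  ring

/-- The right side is antiholomorphic in w: the first slot is conjugate linear and `antiPart g` is
antilinear. This removes the apparent dependence of the exponent on both w and its conjugate. -/
theorem SympPair.inner_cohOp (h : SympPair g gi) (w : W) :
    (‖w‖ : ℂ) ^ 2 - inner ℂ (cohOp g w) (g w) =
      Complex.I / 2 * inner ℂ (cohOp g w) (antiPart g w) := by
  have h1 := congrArg (inner ℂ (cohOp g w)) (linPart_add_antiPart g w)
  rw [inner_add_right, h.inner_cohOp_linPart, inner_smul_right, inner_smul_right] at h1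
  have h2 := Complex.I_sq
  linear_combination (-Complex.I / 2) * h1 + ((‖w‖ : ℂ) ^ 2 - inner ℂ (cohOp g w) (g w)) * h2

end SymplecticMaps

/-! ### Gaussians attached to symplectic maps -/

section Gaussian

variable {W : Type uV} [NormedAddCommGroup W] [InnerProductSpace ℂ W] {g gi : W →L[ℝ] W}

theorem hasDerivAt_norm_sq_line (u b : W) :
    HasDerivAt (fun t : ℝ => ‖u + t • b‖ ^ 2) (2 * (inner ℂ u b).re) 0 := by
  have h1 : (fun t : ℝ => ‖u + t • b‖ ^ 2) =
      fun t : ℝ => ‖u‖ ^ 2 + 2 * (inner ℂ u b).re * t + ‖b‖ ^ 2 * t ^ 2 := by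
    funext t
    have h2 : t • b = (t : ℂ) • b := (Complex.coe_smul t b).symm
    rw [@norm_add_sq ℂ, norm_smul, h2, inner_smul_right]
    simp only [RCLike.re_eq_complex_re, Complex.re_ofReal_mul, Real.norm_eq_abs, mul_pow, sq_abs]
    ring
  rw [h1]
  have h3 := (((hasDerivAt_id (0 : ℝ)).const_mul (2 * (inner ℂ u b).re)).const_add
    (‖u‖ ^ 2)).add (((hasDerivAt_id (0 : ℝ)).pow 2).const_mul (‖b‖ ^ 2))
  refine h3.congr_deriv ?_
  simp

/-- Complex derivatives are restricted to real lines because g is only real linear. -/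
theorem hasDerivAt_comp_line {ψ : W → ℂ} (hψ : Differentiable ℂ ψ) (u b : W) :
    HasDerivAt (fun t : ℝ => ψ (u + t • b)) (fderiv ℂ ψ u b) 0 := by
  have h1 : HasDerivAt (fun t : ℝ => u + t • b) b 0 := by
    simpa using ((hasDerivAt_id (0 : ℝ)).smul_const b).const_add u
  have h2 : HasFDerivAt ψ ((fderiv ℂ ψ u).restrictScalars ℝ) (u + (0 : ℝ) • b) := by
    rw [zero_smul, add_zero]
    exact (hψ u).hasFDerivAt.restrictScalars ℝ
  exact h2.comp_hasDerivAt (0 : ℝ) h1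

/-- The relation between `U 1` and `U⁻¹ 1` for an operator `U` which implements `g`. -/
def GaussRel (hbar : ℝ) (g : W →L[ℝ] W) (ψ ψ' : W → ℂ) : Prop :=
  ∀ x, ψ (g x) = Complex.exp (((‖g x‖ ^ 2 - ‖x‖ ^ 2) / (4 * hbar) : ℝ) : ℂ) *
    starRingEnd ℂ (ψ' (-x))

variable {hbar : ℝ} {ψ ψ' : W → ℂ}

theorem GaussRel.fderiv_apply (hr : GaussRel hbar g ψ ψ') (hψ : Differentiable ℂ ψ)
    (hψ' : Differentiable ℂ ψ') (x a : W) :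
    fderiv ℂ ψ (g x) (g a) =
      (((inner ℂ (g x) (g a)).re - (inner ℂ x a).re) / (2 * hbar) : ℝ) * ψ (g x) -
      Complex.exp (((‖g x‖ ^ 2 - ‖x‖ ^ 2) / (4 * hbar) : ℝ) : ℂ) *
        starRingEnd ℂ (fderiv ℂ ψ' (-x) a) := by
  have h1 := hasDerivAt_comp_line hψ (g x) (g a)
  have h2 : HasDerivAt (fun t : ℝ => starRingEnd ℂ (ψ' (-x + t • -a)))
      (starRingEnd ℂ (fderiv ℂ ψ' (-x) (-a))) 0 :=
    (Complex.conjCLE.toContinuousLinearMap.hasFDerivAt).comp_hasDerivAt (0 : ℝ)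
      (hasDerivAt_comp_line hψ' (-x) (-a))
  have h3 : HasDerivAt
      (fun t : ℝ => Complex.exp (((‖g x + t • g a‖ ^ 2 - ‖x + t • a‖ ^ 2) / (4 * hbar) : ℝ) : ℂ))
      (Complex.exp (((‖g x‖ ^ 2 - ‖x‖ ^ 2) / (4 * hbar) : ℝ) : ℂ) *
        (((2 * (inner ℂ (g x) (g a)).re - 2 * (inner ℂ x a).re) / (4 * hbar) : ℝ) : ℂ)) 0 := by
    have h4 := (((hasDerivAt_norm_sq_line (g x) (g a)).sub
      (hasDerivAt_norm_sq_line x a)).div_const (4 * hbar)).ofReal_comp.cexp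
    simpa using h4
  have h5 := h3.mul h2
  have h6 : (fun t : ℝ => ψ (g x + t • g a)) = fun t : ℝ =>
      Complex.exp (((‖g x + t • g a‖ ^ 2 - ‖x + t • a‖ ^ 2) / (4 * hbar) : ℝ) : ℂ) *
        starRingEnd ℂ (ψ' (-x + t • -a)) := by
    funext t
    have := hr (x + t • a)
    rw [map_add, map_smul] at this
    rw [this]
    congr 3
    rw [smul_neg, neg_add]
  rw [h6] at h1
  have h7 := h1.unique h5
  rw [h7, hr x]
  simp only [zero_smul, add_zero, map_neg]
  push_cast
  ring

variable [FiniteDimensional ℂ W]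

/-- In i times the relation for a plus the relation for ia, the unknown terms with ψ' cancel, since
conjugation turns i into -i. What remains is the derivative of ψ along `linPart g a`, and every
vector has this form. -/
theorem GaussRel.fderiv_eq (hg : SympPair g gi) (hr : GaussRel hbar g ψ ψ')
    (hψ : Differentiable ℂ ψ) (hψ' : Differentiable ℂ ψ') (v y : W) :
    fderiv ℂ ψ v y = -(inner ℂ (sympZ g y) v / (2 * hbar)) * ψ v := by
  obtain ⟨a, rfl⟩ := hg.exists_linPart_eq y
  obtain ⟨x, rfl⟩ : ∃ x, g x = v := ⟨gi v, hg.right_inv v⟩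
  have h1 := hr.fderiv_apply hψ hψ' x a
  have h2 := hr.fderiv_apply hψ hψ' x (Complex.I • a)
  have h3 : fderiv ℂ ψ (g x) (linPart g a) =
      Complex.I * fderiv ℂ ψ (g x) (g a) + fderiv ℂ ψ (g x) (g (Complex.I • a)) := by
    rw [linPart_apply, map_add, map_smul, smul_eq_mul]
  have hρ : ∀ a, (inner ℂ (g x) (g a)).re - (inner ℂ x a).re =
      (inner ℂ (g x) (antiPart g a)).im := by
    intro a
    rw [antiPart_apply, inner_sub_right, Complex.sub_im, hg.im_inner, im_inner_I_right,
      im_inner_I_right]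
  have hz : inner ℂ (sympZ g (linPart g a)) (g x) =
      (((inner ℂ (g x) (antiPart g a)).re : ℝ) : ℂ) -
        Complex.I * (((inner ℂ (g x) (antiPart g a)).im : ℝ) : ℂ) := by
    rw [hg.sympZ_linPart]
    apply Complex.ext
    · simpa using re_inner_swap _ _
    · simpa using im_inner_swap _ _
  rw [hρ] at h1 h2
  rw [antiPart_I, inner_neg_right, Complex.neg_im, im_inner_I_right] at h2
  have h4 : fderiv ℂ ψ' (-x) (Complex.I • a) = Complex.I * fderiv ℂ ψ' (-x) a := by
    rw [map_smul, smul_eq_mul]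
  rw [h4, map_mul, Complex.conj_I] at h2
  rw [h3, h1, h2, hz]
  push_cast
  ring

/-- The Gaussian function with quadratic exponent `inner (Z v) v`. -/
def gaussFun (hbar : ℝ) (Z : W →L[ℝ] W) (v : W) : ℂ :=
  Complex.exp (-(inner ℂ (Z v) v / (4 * hbar)))

/-- The derivative formula, restricted to the line through 0 and v, is an ordinary differential
equation; multiplying by the inverse Gaussian gives a function with zero derivative, compared at t =
1 and t = 0. -/
theorem GaussRel.eq_gaussFun (hg : SympPair g gi) (hr : GaussRel hbar g ψ ψ')
    (hψ : Differentiable ℂ ψ) (hψ' : Differentiable ℂ ψ') (v : W) :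
    ψ v = ψ 0 * gaussFun hbar (sympZ g) v := by
  have hlin : ∀ t : ℝ, HasDerivAt (fun t : ℝ => ψ (t • v)) (fderiv ℂ ψ (t • v) v) t := by
    intro t
    have h1 : HasDerivAt (fun t : ℝ => t • v) v t := by
      simpa using (hasDerivAt_id t).smul_const v
    exact ((hψ (t • v)).hasFDerivAt.restrictScalars ℝ).comp_hasDerivAt t h1
  set c : ℂ := inner ℂ (sympZ g v) v / (4 * hbar) with hc
  have hd : ∀ t : ℝ, HasDerivAt (fun t : ℝ => ψ (t • v) * Complex.exp (c * ((t ^ 2 : ℝ) : ℂ))) 0 t := by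
    intro t
    have h1 : HasDerivAt (fun t : ℝ => Complex.exp (c * ((t ^ 2 : ℝ) : ℂ)))
        (Complex.exp (c * ((t ^ 2 : ℝ) : ℂ)) * (c * ((2 * t : ℝ) : ℂ))) t := by
      have := (((hasDerivAt_id t).pow 2).ofReal_comp.const_mul c).cexp
      simpa using this
    have h2 := (hlin t).mul h1
    refine h2.congr_deriv ?_
    rw [hr.fderiv_eq hg hψ hψ', ← Complex.coe_smul, inner_smul_right, hc]
    push_cast
    ring
  have h1 := is_const_of_deriv_eq_zero (fun t => (hd t).differentiableAt)
    (fun t => (hd t).deriv) 1 0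
  simp only [one_smul, one_pow, Complex.ofReal_one, mul_one, zero_smul, ne_eq, OfNat.ofNat_ne_zero,
    not_false_eq_true, zero_pow, Complex.ofReal_zero, mul_zero, Complex.exp_zero] at h1
  rw [gaussFun, ← hc, ← h1, mul_assoc, ← Complex.exp_add]
  simp

end Gaussian

/-! ### The Fock space as a space of square integrable functions -/

section FockL2

variable {hbar : ℝ} {W : Type uV} [NormedAddCommGroup W] [InnerProductSpace ℂ W]
  [FiniteDimensional ℂ W] [MeasurableSpace W] [BorelSpace W]

/-- The isometric embedding `f ↦ f exp (-|z|² / 4ħ)` of the Fock space, up to a constant factor. -/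
def toL2 : Fock hbar W →ₗ[ℂ] Lp ℂ 2 (hermVolume W) where
  toFun f := f.2.2.toLp _
  map_add' f g := by
    rw [← MemLp.toLp_add f.2.2 g.2.2]
    congr 1
    funext z
    exact add_mul _ _ _
  map_smul' c f := by
    rw [RingHom.id_apply, ← MemLp.toLp_const_smul c f.2.2]
    congr 1
    funext z
    exact mul_assoc _ _ _

theorem toL2_coeFn (f : Fock hbar W) :
    toL2 f =ᵐ[hermVolume W] fun z => f.1 z * Real.exp (-‖z‖ ^ 2 / (4 * hbar)) :=
  f.2.2.coeFn_toLp

theorem exp_quarter_sq (x : ℝ) :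
    Real.exp (-x / (4 * hbar)) * Real.exp (-x / (4 * hbar)) = Real.exp (-x / (2 * hbar)) := by
  rw [← Real.exp_add]; congr 1
  -- For ħ = 0 all the quotients are 0 by convention, so positivity of ħ is not needed here.
  by_cases h : hbar = 0
  · simp [h]
  · field_simp; ring

theorem inner_toL2 (f g : Fock hbar W) : inner ℂ (toL2 f) (toL2 g) =
    ∫ z, starRingEnd ℂ (f.1 z) * g.1 z * Real.exp (-‖z‖ ^ 2 / (2 * hbar)) ∂hermVolume W := by
  rw [L2.inner_def]
  refine integral_congr_ae ?_
  filter_upwards [toL2_coeFn f, toL2_coeFn g] with z hf hg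
  rw [hf, hg, RCLike.inner_apply, map_mul, Complex.conj_ofReal, ← exp_quarter_sq]
  push_cast
  ring

theorem norm_sq_toL2 (f : Fock hbar W) : ‖toL2 f‖ ^ 2 =
    ∫ z, ‖f.1 z‖ ^ 2 * Real.exp (-‖z‖ ^ 2 / (2 * hbar)) ∂hermVolume W := by
  have h1 := (inner_self_eq_norm_sq_to_K (𝕜 := ℂ) (toL2 f)).symm.trans (inner_toL2 f f)
  apply Complex.ofReal_injective
  rw [Complex.ofReal_pow, ← integral_complex_ofReal]
  refine h1.trans ?_
  refine integral_congr_ae (Filter.Eventually.of_forall fun z => ?_)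
  simp only [Complex.conj_mul']
  push_cast
  rfl

theorem integrable_conj_mul (f g : Fock hbar W) :
    Integrable (fun z => starRingEnd ℂ (f.1 z) * g.1 z *
      (Real.exp (-‖z‖ ^ 2 / (2 * hbar)) : ℂ)) (hermVolume W) := by
  refine (L2.integrable_inner (𝕜 := ℂ) (toL2 f) (toL2 g)).congr ?_
  filter_upwards [toL2_coeFn f, toL2_coeFn g] with z hf hg
  rw [hf, hg, RCLike.inner_apply, map_mul, Complex.conj_ofReal, ← exp_quarter_sq]
  push_cast
  ring

theorem fockNormSq_eq (f : Fock hbar W) :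
    fockNormSq f = ((2 * Real.pi * hbar) ^ Module.finrank ℂ W)⁻¹ * ‖toL2 f‖ ^ 2 := by
  rw [norm_sq_toL2, fockNormSq]

theorem fock_ext {f g : Fock hbar W} (h : ∀ z, f.1 z = g.1 z) : f = g :=
  Subtype.ext (funext h)

/-- Continuous functions that agree almost everywhere for Haar measure agree everywhere, and the
Gaussian weight never vanishes. -/
theorem toL2_injective : Function.Injective (toL2 : Fock hbar W → _) := by
  intro f g h
  have h1 : (fun z => f.1 z * (Real.exp (-‖z‖ ^ 2 / (4 * hbar)) : ℂ)) =ᵐ[hermVolume W]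
      fun z => g.1 z * (Real.exp (-‖z‖ ^ 2 / (4 * hbar)) : ℂ) :=
    (toL2_coeFn f).symm.trans ((by rw [h] : toL2 f =ᵐ[hermVolume W] toL2 g).trans (toL2_coeFn g))
  have hf := f.2.1.continuous
  have hg := g.2.1.continuous
  have h2 := Continuous.ae_eq_iff_eq (hermVolume W) (by fun_prop) (by fun_prop) |>.1 h1
  refine fock_ext fun z => ?_
  have h3 := congrFun h2 z
  exact mul_right_cancel₀ (Complex.ofReal_ne_zero.2 (Real.exp_pos _).ne') h3

/-! ### The Weyl operators -/

/-- The Weyl operator `U(v, 0)`. -/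
def weyl (v : W) : Fock hbar W →ₗ[ℂ] Fock hbar W where
  toFun := heisenberg v 0
  map_add' _ _ := fock_ext fun _ => mul_add _ _ _
  map_smul' _ _ := fock_ext fun _ => mul_left_comm _ _ _

theorem weyl_apply (v : W) (f : Fock hbar W) (z : W) : (weyl v f).1 z =
    Complex.exp (inner ℂ v z / (2 * hbar) - (‖v‖ : ℂ) ^ 2 / (4 * hbar)) * f.1 (z - v) := by
  change Complex.exp _ * _ = _
  congr 2
  simp

theorem heisenberg_eq (v : W) (t : ℝ) (f : Fock hbar W) :
    heisenberg v t f = Complex.exp (-Complex.I * t / hbar) • weyl v f := by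
  refine fock_ext fun z => ?_
  change _ = _ * (weyl v f).1 z
  rw [weyl_apply, ← mul_assoc, ← Complex.exp_add, ← add_sub_assoc]
  rfl

theorem weyl_zero (f : Fock hbar W) : weyl 0 f = f := by
  refine fock_ext fun z => ?_
  rw [weyl_apply]; simp

theorem weyl_weyl (v w : W) (f : Fock hbar W) : weyl v (weyl w f) =
    Complex.exp (Complex.I * (inner ℂ v w).im / (2 * hbar)) • weyl (v + w) f := by
  refine fock_ext fun z => ?_
  change _ = _ * (weyl (v + w) f).1 z
  rw [weyl_apply, weyl_apply, weyl_apply, sub_sub, ← mul_assoc, ← mul_assoc, ← Complex.exp_add,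
    ← Complex.exp_add]
  congr 2
  have h1 : ((‖v + w‖ : ℂ)) ^ 2 = (‖v‖ : ℂ) ^ 2 + 2 * ((inner ℂ v w).re : ℂ) + (‖w‖ : ℂ) ^ 2 := by
    have := @norm_add_sq ℂ W _ _ _ v w
    simp only [RCLike.re_eq_complex_re] at this
    exact_mod_cast congrArg (fun x : ℝ => (x : ℂ)) this
  have h2 : inner ℂ w v = ((inner ℂ v w).re : ℂ) - Complex.I * ((inner ℂ v w).im : ℂ) := by
    apply Complex.ext
    · simpa using re_inner_swap _ _
    · simpa using im_inner_swap _ _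
  rw [h1, inner_sub_right, inner_add_left, h2]
  ring

theorem weyl_neg_weyl (v : W) (f : Fock hbar W) : weyl (-v) (weyl v f) = f := by
  have : (inner ℂ v v).im = 0 := inner_self_im (𝕜 := ℂ) v
  rw [weyl_weyl, neg_add_cancel, weyl_zero, inner_neg_left, Complex.neg_im, this]
  simp

/-- The exponential factor completes the square in the weight, so on weighted moduli the Weyl
operator is a translation; unitarity is then translation invariance of Lebesgue measure. -/
theorem norm_weyl_apply (v : W) (f : Fock hbar W) (z : W) :
    ‖(weyl v f).1 z‖ ^ 2 * Real.exp (-‖z‖ ^ 2 / (2 * hbar)) =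
      ‖f.1 (z - v)‖ ^ 2 * Real.exp (-‖z - v‖ ^ 2 / (2 * hbar)) := by
  rw [weyl_apply, norm_mul, mul_pow, Complex.norm_exp, ← Real.exp_nat_mul, mul_right_comm,
    ← Real.exp_add, mul_comm]
  congr 2
  have e1 : (inner ℂ v z / (2 * hbar) - (‖v‖ : ℂ) ^ 2 / (4 * hbar)).re =
      (inner ℂ v z).re / (2 * hbar) - ‖v‖ ^ 2 / (4 * hbar) := by
    rw [Complex.sub_re, show (2 * (hbar : ℂ)) = ((2 * hbar : ℝ) : ℂ) by push_cast; ring,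
      Complex.div_ofReal_re, show ((‖v‖ : ℂ) ^ 2 / (4 * hbar) : ℂ) =
        ((‖v‖ ^ 2 / (4 * hbar) : ℝ) : ℂ) by push_cast; ring, Complex.ofReal_re]
  have e2 : ‖z - v‖ ^ 2 = ‖z‖ ^ 2 - 2 * (inner ℂ v z).re + ‖v‖ ^ 2 := by
    rw [@norm_sub_sq ℂ, RCLike.re_eq_complex_re, re_inner_swap z v]
  rw [e1, e2]
  by_cases h : hbar = 0
  · simp [h]
  · push_cast
    field_simp
    ring

theorem norm_weyl (v : W) (f : Fock hbar W) : ‖toL2 (weyl v f)‖ = ‖toL2 f‖ := by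
  refine (pow_left_inj₀ (norm_nonneg _) (norm_nonneg _) two_ne_zero).1 ?_
  rw [norm_sq_toL2, norm_sq_toL2]
  simp only [norm_weyl_apply]
  exact integral_sub_right_eq_self
    (fun z => ‖f.1 z‖ ^ 2 * Real.exp (-‖z‖ ^ 2 / (2 * hbar))) v

/-- A norm preserving linear map of the Fock space preserves inner products. -/
theorem inner_map_map_of_norm (U : Fock hbar W →ₗ[ℂ] Fock hbar W)
    (h : ∀ f, ‖toL2 (U f)‖ = ‖toL2 f‖) (f k : Fock hbar W) :
    inner ℂ (toL2 (U f)) (toL2 (U k)) = inner ℂ (toL2 f) (toL2 k) := by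
  rw [inner_eq_sum_norm_sq_div_four, inner_eq_sum_norm_sq_div_four (toL2 f)]
  simp only [← map_smul, ← map_add, ← map_sub, h]

theorem inner_weyl_weyl (v : W) (f k : Fock hbar W) :
    inner ℂ (toL2 (weyl v f)) (toL2 (weyl v k)) = inner ℂ (toL2 f) (toL2 k) :=
  inner_map_map_of_norm _ (norm_weyl v) f k

theorem inner_weyl_left (v : W) (f k : Fock hbar W) :
    inner ℂ (toL2 (weyl v f)) (toL2 k) = inner ℂ (toL2 f) (toL2 (weyl (-v) k)) := by
  rw [← inner_weyl_weyl (-v), weyl_neg_weyl]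

/-! ### The reproducing property -/

/-- Multiplication by a complex number of modulus one as a real linear isometry. -/
def circleIsometry (c : Circle) : letI : InnerProductSpace ℝ W := InnerProductSpace.complexToReal
    W ≃ₗᵢ[ℝ] W :=
  letI : InnerProductSpace ℝ W := InnerProductSpace.complexToReal
  { toFun := fun z => (c : ℂ) • z
    invFun := fun z => ((c⁻¹ : Circle) : ℂ) • z
    map_add' := fun x y => smul_add _ _ _
    map_smul' := fun r x => smul_comm _ _ _
    left_inv := fun z => by simp [smul_smul]
    right_inv := fun z => by simp [smul_smul]
    norm_map' := fun z => by
      change ‖(c : ℂ) • z‖ = _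
      rw [norm_smul, Circle.norm_coe, one_mul] }

theorem integral_circle_smul (c : Circle) (F : W → ℂ) :
    ∫ z, F ((c : ℂ) • z) ∂hermVolume W = ∫ z, F z ∂hermVolume W := by
  let _ : InnerProductSpace ℝ W := InnerProductSpace.complexToReal
  exact (circleIsometry (W := W) c).measurePreserving.integral_comp
    (circleIsometry (W := W) c).toHomeomorph.measurableEmbedding F

variable [Fact (0 < hbar)]

/-- The squared norm of the vacuum, for the unnormalised measure. -/
def vacuumMass (hbar : ℝ) (W : Type uV) [NormedAddCommGroup W] [InnerProductSpace ℂ W]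
    [FiniteDimensional ℂ W] [MeasurableSpace W] [BorelSpace W] : ℝ :=
  ∫ z : W, Real.exp (-‖z‖ ^ 2 / (2 * hbar)) ∂hermVolume W

theorem vacuum_apply (z : W) : (vacuum hbar W).1 z = 1 := rfl

theorem norm_sq_vacuum : ‖toL2 (vacuum hbar W)‖ ^ 2 = vacuumMass hbar W := by
  rw [norm_sq_toL2]
  simp [vacuum_apply, vacuumMass]

theorem vacuum_ne_zero : vacuum hbar W ≠ 0 := fun h => by
  have : (vacuum hbar W).1 0 = (0 : Fock hbar W).1 0 := by rw [h]
  exact one_ne_zero this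

theorem vacuumMass_pos : 0 < vacuumMass hbar W := by
  rw [← norm_sq_vacuum]
  have : toL2 (vacuum hbar W) ≠ 0 := fun h =>
    vacuum_ne_zero (toL2_injective (h.trans (map_zero toL2).symm))
  positivity

/-- Mean value property of the entire function c ↦ f(cz) on the unit circle. -/
theorem circle_average_fock (f : Fock hbar W) (z : W) :
    ∫ θ in (0 : ℝ)..2 * Real.pi, f.1 ((Circle.exp θ : ℂ) • z) = 2 * Real.pi * f.1 0 := by
  have hd : Differentiable ℂ fun c : ℂ => f.1 (c • z) :=
    f.2.1.comp (differentiable_id.smul_const z)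
  have h1 := hd.diffContOnCl.circleAverage (c := 0) (R := 1)
  rw [Real.circleAverage_def] at h1
  simp only [zero_smul] at h1
  rw [← h1]
  simp only [circleMap, zero_add, Complex.ofReal_one, one_mul, Circle.coe_exp]
  rw [Complex.real_smul]
  push_cast
  field_simp
  simp only [mul_comm]

/-- The Gaussian weight is invariant under z ↦ e^{iθ}z, so f may be averaged over θ under the
integral; the average is f(0) by the mean value property. -/
theorem inner_vacuum (f : Fock hbar W) :
    inner ℂ (toL2 (vacuum hbar W)) (toL2 f) = vacuumMass hbar W * f.1 0 := by
  rw [inner_toL2]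
  simp only [vacuum_apply, map_one, one_mul]
  have : ProperSpace W := FiniteDimensional.proper ℂ W
  set w : W → ℂ := fun z => (Real.exp (-‖z‖ ^ 2 / (2 * hbar)) : ℂ) with hw
  have hint : Integrable (fun z => f.1 z * w z) (hermVolume W) := by
    have := integrable_conj_mul (vacuum hbar W) f
    simpa only [vacuum_apply, map_one, one_mul] using this
  have hwc : ∀ (c : Circle) (z : W), w ((c : ℂ) • z) = w z := by
    intro c z; simp only [hw, norm_smul, Circle.norm_coe, one_mul]
  have hrot : ∀ c : Circle, ∫ z, f.1 ((c : ℂ) • z) * w z ∂hermVolume W =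
      ∫ z, f.1 z * w z ∂hermVolume W := by
    intro c
    rw [← integral_circle_smul c fun z => f.1 z * w z]
    simp only [hwc]
  have hcont : Continuous fun q : ℝ × W => f.1 ((Circle.exp q.1 : ℂ) • q.2) * w q.2 := by
    have := f.2.1.continuous
    simp only [hw]
    fun_prop
  have hrotint : ∀ c : Circle, Integrable (fun z => f.1 ((c : ℂ) • z) * w z) (hermVolume W) := by
    intro c
    let _ : InnerProductSpace ℝ W := InnerProductSpace.complexToReal
    have h1 := ((circleIsometry (W := W) c).measurePreserving.integrable_comp_emb
      (circleIsometry (W := W) c).toHomeomorph.measurableEmbedding (g := fun z => f.1 z * w z)).2 hint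
    refine h1.congr (Filter.Eventually.of_forall fun z => ?_)
    change f.1 ((c : ℂ) • z) * w ((c : ℂ) • z) = _
    rw [hwc]
  have hfub : ∫ θ in (0 : ℝ)..2 * Real.pi, (∫ z, f.1 ((Circle.exp θ : ℂ) • z) * w z ∂hermVolume W) =
      ∫ z, (∫ θ in (0 : ℝ)..2 * Real.pi, f.1 ((Circle.exp θ : ℂ) • z) * w z) ∂hermVolume W := by
    simp only [intervalIntegral.integral_of_le Real.two_pi_pos.le]
    refine integral_integral_swap ?_
    have hmeas : AEStronglyMeasurable
        (Function.uncurry fun (θ : ℝ) (z : W) => f.1 ((Circle.exp θ : ℂ) • z) * w z)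
        ((volume.restrict (Set.Ioc 0 (2 * Real.pi))).prod (hermVolume W)) :=
      hcont.aestronglyMeasurable
    refine (integrable_prod_iff hmeas).2 ⟨Filter.Eventually.of_forall fun θ => hrotint (Circle.exp θ), ?_⟩
    -- The integral of the norm does not depend on θ, so integrability over the finite interval is
    -- immediate and Fubini applies.
    have : (fun θ : ℝ => ∫ z, ‖f.1 ((Circle.exp θ : ℂ) • z) * w z‖ ∂hermVolume W) =
        fun _ => ∫ z, ‖f.1 z * w z‖ ∂hermVolume W := by
      funext θ
      apply Complex.ofReal_injective
      rw [← integral_complex_ofReal, ← integral_complex_ofReal,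
        ← integral_circle_smul (Circle.exp θ) fun z => ((‖f.1 z * w z‖ : ℝ) : ℂ)]
      simp only [hwc]
    exact (this ▸ integrable_const (∫ z, ‖f.1 z * w z‖ ∂hermVolume W) : Integrable
      (fun θ : ℝ => ∫ z, ‖f.1 ((Circle.exp θ : ℂ) • z) * w z‖ ∂hermVolume W)
        (volume.restrict (Set.Ioc 0 (2 * Real.pi))))
  simp only [hrot, intervalIntegral.integral_const, intervalIntegral.integral_mul_const,
    circle_average_fock] at hfub
  rw [sub_zero, Complex.real_smul] at hfub
  have h2 : ∫ z, 2 * (Real.pi : ℂ) * f.1 0 * w z ∂hermVolume W =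
      2 * Real.pi * f.1 0 * vacuumMass hbar W := by
    rw [integral_const_mul, vacuumMass, ← integral_complex_ofReal]
  rw [h2] at hfub
  have hpi : (Real.pi : ℂ) ≠ 0 := Complex.ofReal_ne_zero.2 Real.pi_ne_zero
  push_cast at hfub
  have h3 : (2 * Real.pi : ℂ) * ∫ z, f.1 z * w z ∂hermVolume W =
      (2 * Real.pi : ℂ) * (vacuumMass hbar W * f.1 0) := by
    rw [hfub]; ring
  exact mul_left_cancel₀ (by simp [hpi]) h3

/-- The reproducing property of the coherent states. -/
theorem inner_vacuum_weyl_neg (v : W) (f : Fock hbar W) :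
    inner ℂ (toL2 (vacuum hbar W)) (toL2 (weyl (-v) f)) =
      vacuumMass hbar W * Real.exp (-‖v‖ ^ 2 / (4 * hbar)) * f.1 v := by
  rw [inner_vacuum, weyl_apply]
  simp only [inner_zero_right, zero_div, norm_neg, sub_neg_eq_add, zero_add, mul_assoc, zero_sub]
  congr 2
  push_cast
  rw [neg_div]

end FockL2

/-! ### Gaussian elements of the Fock space -/

section GaussianFock

variable {hbar : ℝ} [hpos : Fact (0 < hbar)] {W : Type uV} [NormedAddCommGroup W]
  [InnerProductSpace ℂ W] [FiniteDimensional ℂ W] [MeasurableSpace W] [BorelSpace W]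
  {g gi : W →L[ℝ] W}

theorem integrable_exp_neg_norm_sq {b : ℝ} (hb : 0 < b) :
    Integrable (fun z : W => Real.exp (-b * ‖z‖ ^ 2)) (hermVolume W) := by
  -- For ħ' = 1/(2b) the squared vacuum, weighted by ħ', is exactly exp(-b‖z‖²).
  have h : Fact (0 < 1 / (2 * b)) := ⟨by positivity⟩
  have h1 := (memLp_two_iff_integrable_sq_norm (memLp_vacuum (1 / (2 * b)) W).1).1
    (memLp_vacuum (1 / (2 * b)) W)
  refine h1.congr (Filter.Eventually.of_forall fun z => ?_)
  simp only [one_mul, Complex.norm_real, Real.norm_of_nonneg (Real.exp_pos _).le]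
  rw [← Real.exp_nat_mul]
  congr 1
  push_cast
  field_simp
  ring

/-- Completing the square absorbs the linear term into half of the quadratic decay, with constant
exp(c²/2b). -/
theorem integrable_exp_linear_sub_sq {b : ℝ} (hb : 0 < b) (c : ℝ) :
    Integrable (fun z : W => Real.exp (c * ‖z‖ - b * ‖z‖ ^ 2)) (hermVolume W) := by
  refine ((integrable_exp_neg_norm_sq (W := W) (half_pos hb)).const_mul
    (Real.exp (c ^ 2 / (2 * b)))).mono' (Continuous.aestronglyMeasurable (by fun_prop))
    (Filter.Eventually.of_forall fun z => ?_)
  rw [Real.norm_of_nonneg (Real.exp_pos _).le, ← Real.exp_add]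
  gcongr
  have h1 : c ^ 2 / (2 * b) + -(b / 2) * ‖z‖ ^ 2 - (c * ‖z‖ - b * ‖z‖ ^ 2) =
      (c - b * ‖z‖) ^ 2 / (2 * b) := by
    field_simp
    ring
  have h2 : 0 ≤ (c - b * ‖z‖) ^ 2 / (2 * b) := by positivity
  linarith

theorem norm_gaussFun_le (Z : W →L[ℝ] W) (z : W) :
    ‖gaussFun hbar Z z‖ ≤ Real.exp (‖Z‖ * ‖z‖ ^ 2 / (4 * hbar)) := by
  have hb := hpos.out
  rw [gaussFun, Complex.norm_exp]
  gcongr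
  refine (Complex.re_le_norm _).trans ?_
  rw [norm_neg, norm_div, norm_mul, Complex.norm_real, Real.norm_of_nonneg hb.le]
  norm_num
  gcongr
  refine (norm_inner_le_norm _ _).trans ?_
  rw [sq, ← mul_assoc]
  gcongr
  exact Z.le_opNorm z

theorem continuous_gaussFun (Z : W →L[ℝ] W) : Continuous (gaussFun hbar Z) := by
  unfold gaussFun
  fun_prop

/-- Here the strict contraction matters: the weighted square of the Gaussian decays at least like
exp(-(1 - ‖Z‖)‖z‖²/2ħ). -/
theorem memLp_gaussFun {Z : W →L[ℝ] W} (hZ : ‖Z‖ < 1) :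
    MemLp (fun z : W => gaussFun hbar Z z * Real.exp (-‖z‖ ^ 2 / (4 * hbar))) 2
      (hermVolume W) := by
  have hb := hpos.out
  have hc : Continuous fun z : W => gaussFun hbar Z z * (Real.exp (-‖z‖ ^ 2 / (4 * hbar)) : ℂ) :=
    (continuous_gaussFun Z).mul (by fun_prop)
  rw [memLp_two_iff_integrable_sq_norm hc.aestronglyMeasurable]
  have hε : 0 < (1 - ‖Z‖) / (2 * hbar) := div_pos (by linarith) (by linarith)
  refine (integrable_exp_neg_norm_sq (W := W) hε).mono' (hc.norm.pow 2).aestronglyMeasurable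
    (Filter.Eventually.of_forall fun z => ?_)
  rw [norm_pow, norm_norm, norm_mul, mul_pow, Complex.norm_real,
    Real.norm_of_nonneg (Real.exp_pos _).le]
  calc ‖gaussFun hbar Z z‖ ^ 2 * Real.exp (-‖z‖ ^ 2 / (4 * hbar)) ^ 2
      ≤ Real.exp (‖Z‖ * ‖z‖ ^ 2 / (4 * hbar)) ^ 2 * Real.exp (-‖z‖ ^ 2 / (4 * hbar)) ^ 2 := by
        gcongr
        exact norm_gaussFun_le Z z
    _ = _ := by
        rw [← mul_pow, ← Real.exp_add, ← Real.exp_nat_mul]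
        congr 1
        push_cast
        field_simp
        ring

/-- The complex bilinear form `(x, y) ↦ inner (T x) y` of an antilinear operator `T`. -/
def antiForm (T : W →L[ℝ] W) (hT : ∀ x, T (Complex.I • x) = -(Complex.I • T x)) :
    W →L[ℂ] W →L[ℂ] ℂ :=
  LinearMap.toContinuousLinearMap
    { toFun := fun x => innerSL ℂ (T x)
      map_add' := fun x y => by rw [map_add, map_add]
      map_smul' := fun c x => by
        have hc : T (c • x) = starRingEnd ℂ c • T x := by
          have h1 : c • x = c.re • x + c.im • Complex.I • x := by
            rw [← Complex.coe_smul, ← Complex.coe_smul, smul_smul, ← add_smul, Complex.re_add_im]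
          have h2 : starRingEnd ℂ c = (c.re : ℂ) - (c.im : ℂ) * Complex.I := by
            apply Complex.ext <;> simp
          rw [h1, map_add, map_smul, map_smul, hT, h2, sub_smul, mul_smul,
            Complex.coe_smul, Complex.coe_smul, smul_neg, ← sub_eq_add_neg]
        ext y
        simp [hc] }

theorem antiForm_apply (T : W →L[ℝ] W) (hT : ∀ x, T (Complex.I • x) = -(Complex.I • T x))
    (x y : W) : antiForm T hT x y = inner ℂ (T x) y := rfl

theorem SympPair.differentiable_gaussFun (h : SympPair g gi) :
    Differentiable ℂ (gaussFun hbar (sympZ g)) := by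
  have h1 : Differentiable ℂ fun v => antiForm (sympZ g) h.sympZ_I v v :=
    (ContinuousLinearMap.differentiable _).clm_apply differentiable_id
  have h2 : gaussFun hbar (sympZ g) =
      fun v => Complex.exp (-(antiForm (sympZ g) h.sympZ_I v v / (4 * hbar))) := rfl
  rw [h2]
  simp only [div_eq_mul_inv]
  exact (h1.mul_const _).neg.cexp

/-- The Gaussian `exp (-⟨z, Z_g z⟩ / 4ħ)` as an element of the Fock space. -/
def SympPair.gauss (h : SympPair g gi) (hbar : ℝ) [Fact (0 < hbar)] : Fock hbar W :=
  ⟨gaussFun hbar (sympZ g), h.differentiable_gaussFun, memLp_gaussFun h.norm_sympZ_lt_one⟩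

theorem SympPair.gauss_apply (h : SympPair g gi) (z : W) :
    (h.gauss hbar).1 z = gaussFun hbar (sympZ g) z := rfl

theorem SympPair.gauss_zero (h : SympPair g gi) : (h.gauss hbar).1 0 = 1 := by
  simp [h.gauss_apply, gaussFun]

theorem gauss_refl : (SympPair.refl (W := W)).gauss hbar = vacuum hbar W := by
  refine fock_ext fun z => ?_
  simp [SympPair.gauss_apply, gaussFun, sympZ_id, vacuum_apply]

/-! ### Operators which implement a symplectic map -/

/-- The operator `U` intertwines `U(v, 0)` and `U(g v, 0)`. -/
def Implements (g : W →L[ℝ] W) (U : Fock hbar W →ₗ[ℂ] Fock hbar W) : Prop :=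
  ∀ v f, U (weyl v f) = weyl (g v) (U f)

/-- Evaluate ⟨1, U(-gx) U 1⟩ twice. The reproducing property gives the value of U1 at gx. Moving the
Weyl operator through U and using that k plays the role of U*1 gives the conjugate of the value of k
at -x. -/
theorem Implements.gaussRel {U : Fock hbar W →ₗ[ℂ] Fock hbar W} (hU : Implements g U)
    {k : Fock hbar W} (hk : ∀ f, inner ℂ (toL2 (vacuum hbar W)) (toL2 (U f)) =
      inner ℂ (toL2 k) (toL2 f)) :
    GaussRel hbar g (U (vacuum hbar W)).1 k.1 := by
  intro x
  have h1 := inner_vacuum_weyl_neg (g x) (U (vacuum hbar W))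
  rw [← map_neg, ← hU, hk, ← inner_conj_symm, inner_weyl_left, inner_vacuum_weyl_neg] at h1
  have h2 : (vacuumMass hbar W : ℂ) ≠ 0 := Complex.ofReal_ne_zero.2 vacuumMass_pos.ne'
  simp only [map_mul, Complex.conj_ofReal, norm_neg, mul_assoc] at h1
  have h3 := mul_left_cancel₀ h2 h1
  have h4 : (Real.exp (-‖x‖ ^ 2 / (4 * hbar)) : ℂ) =
      Real.exp (-‖g x‖ ^ 2 / (4 * hbar)) *
        Complex.exp (((‖g x‖ ^ 2 - ‖x‖ ^ 2) / (4 * hbar) : ℝ) : ℂ) := by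
    rw [← Complex.ofReal_exp, ← Complex.ofReal_mul, ← Real.exp_add]
    congr 2
    ring
  rw [h4, mul_assoc] at h3
  exact (mul_left_cancel₀ (Complex.ofReal_ne_zero.2 (Real.exp_pos _).ne') h3).symm

/-- The symplectic map fixes the image of the vacuum up to a scalar, which is the parameter λ. -/
theorem Implements.apply_vacuum (hg : SympPair g gi) {U : Fock hbar W →ₗ[ℂ] Fock hbar W}
    (hU : Implements g U) {k : Fock hbar W}
    (hk : ∀ f, inner ℂ (toL2 (vacuum hbar W)) (toL2 (U f)) = inner ℂ (toL2 k) (toL2 f)) :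
    U (vacuum hbar W) = (U (vacuum hbar W)).1 0 • hg.gauss hbar :=
  fock_ext fun v => (hU.gaussRel hk).eq_gaussFun hg (U (vacuum hbar W)).2.1 k.2.1 v

/-! ### Smooth dependence of Gaussian integrals on the quadratic form -/

/-- The linear functional `Z ↦ inner z (Z z)`. -/
def quadEval (z : W) : (W →L[ℝ] W) →L[ℝ] ℂ :=
  ((innerSL ℂ z).restrictScalars ℝ).comp (ContinuousLinearMap.apply ℝ W z)

theorem quadEval_apply (z : W) (Z : W →L[ℝ] W) : quadEval z Z = inner ℂ z (Z z) := rfl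

theorem norm_quadEval_apply_le (z : W) (Z : W →L[ℝ] W) :
    ‖quadEval z Z‖ ≤ ‖z‖ ^ 2 * ‖Z‖ := by
  rw [quadEval_apply]
  refine (norm_inner_le_norm _ _).trans ?_
  rw [sq, mul_assoc, mul_comm ‖z‖ ‖Z‖]
  gcongr
  exact Z.le_opNorm z

theorem continuous_quadEval : Continuous (quadEval : W → (W →L[ℝ] W) →L[ℝ] ℂ) := by
  have h1 : Continuous fun z : W => (innerSL ℂ z).restrictScalars ℝ :=
    (ContinuousLinearMap.restrictScalarsL ℂ W ℂ ℝ ℝ).continuous.comp (innerSL ℂ).continuous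
  have h2 : Continuous fun z : W => (ContinuousLinearMap.apply ℝ W z : (W →L[ℝ] W) →L[ℝ] W) :=
    (ContinuousLinearMap.apply ℝ W).continuous
  exact h1.clm_comp h2

/-- The exponent of `conj (γ_Y) * γ_Z` as a linear functional of `(Y, Z)`. -/
def gaussExponent (hbar : ℝ) (z : W) : (W →L[ℝ] W) × (W →L[ℝ] W) →L[ℝ] ℂ :=
  (-(1 / (4 * hbar)) : ℝ) • ((quadEval z).comp
      (ContinuousLinearMap.fst ℝ (W →L[ℝ] W) (W →L[ℝ] W)) +
    (Complex.conjCLE.toContinuousLinearMap.comp (quadEval z)).comp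
      (ContinuousLinearMap.snd ℝ (W →L[ℝ] W) (W →L[ℝ] W)))

theorem gaussExponent_apply (z : W) (b : (W →L[ℝ] W) × (W →L[ℝ] W)) :
    gaussExponent hbar z b = (-(1 / (4 * hbar)) : ℝ) *
      (quadEval z b.1 + starRingEnd ℂ (quadEval z b.2)) := rfl

theorem continuous_gaussExponent :
    Continuous (gaussExponent hbar : W → (W →L[ℝ] W) × (W →L[ℝ] W) →L[ℝ] ℂ) := by
  have := continuous_quadEval (W := W)
  unfold gaussExponent
  refine Continuous.fun_const_smul (Continuous.add ?_ ?_) _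
  · exact this.clm_comp (continuous_const
      (y := ContinuousLinearMap.fst ℝ (W →L[ℝ] W) (W →L[ℝ] W)))
  · exact ((continuous_const (y := Complex.conjCLE.toContinuousLinearMap)).clm_comp
      this).clm_comp (continuous_const
        (y := ContinuousLinearMap.snd ℝ (W →L[ℝ] W) (W →L[ℝ] W)))

theorem norm_gaussExponent_apply_le (z : W) (b : (W →L[ℝ] W) × (W →L[ℝ] W)) :
    ‖gaussExponent hbar z b‖ ≤ ‖z‖ ^ 2 / (4 * hbar) * (‖b.1‖ + ‖b.2‖) := by
  have hb := hpos.out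
  rw [gaussExponent_apply, norm_mul, Complex.norm_real, norm_neg,
    Real.norm_of_nonneg (by positivity)]
  have h1 : ‖quadEval z b.1 + starRingEnd ℂ (quadEval z b.2)‖ ≤
      ‖z‖ ^ 2 * ‖b.1‖ + ‖z‖ ^ 2 * ‖b.2‖ := by
    refine (norm_add_le _ _).trans (add_le_add (norm_quadEval_apply_le _ _) ?_)
    rw [RCLike.norm_conj]
    exact norm_quadEval_apply_le _ _
  calc 1 / (4 * hbar) * ‖quadEval z b.1 + starRingEnd ℂ (quadEval z b.2)‖
      ≤ 1 / (4 * hbar) * (‖z‖ ^ 2 * ‖b.1‖ + ‖z‖ ^ 2 * ‖b.2‖) := by gcongr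
    _ = _ := by ring

theorem norm_gaussExponent_le (z : W) :
    ‖(gaussExponent hbar z : (W →L[ℝ] W) × (W →L[ℝ] W) →L[ℝ] ℂ)‖ ≤ ‖z‖ ^ 2 / (2 * hbar) := by
  have hb := hpos.out
  refine ContinuousLinearMap.opNorm_le_bound _ (by positivity) fun b => ?_
  refine (norm_gaussExponent_apply_le z b).trans ?_
  have h1 : ‖b.1‖ + ‖b.2‖ ≤ 2 * ‖b‖ := by linarith [norm_fst_le b, norm_snd_le b]
  calc ‖z‖ ^ 2 / (4 * hbar) * (‖b.1‖ + ‖b.2‖) ≤ ‖z‖ ^ 2 / (4 * hbar) * (2 * ‖b‖) := by gcongr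
    _ = _ := by field_simp; ring

/-- The inner product of the Gaussians `γ_Y` and `γ_Z`. -/
def gaussInner (hbar : ℝ) (b : (W →L[ℝ] W) × (W →L[ℝ] W)) : ℂ :=
  ∫ z, Complex.exp (gaussExponent hbar z b) • (Real.exp (-‖z‖ ^ 2 / (2 * hbar)) : ℂ) ∂hermVolume W

/-- The exponent is real linear in the pair of operators, so the result on exponential integrals
applies wherever both operators have norm less than 1. -/
theorem contDiffOn_gaussInner : ContDiffOn ℝ ∞ (gaussInner hbar)
    {b : (W →L[ℝ] W) × (W →L[ℝ] W) | ‖b.1‖ < 1 ∧ ‖b.2‖ < 1} := by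
  have hb := hpos.out
  have : ProperSpace W := FiniteDimensional.proper ℂ W
  refine ExpDominated.contDiffOn ?_ ?_ continuous_gaussExponent.aestronglyMeasurable
    (Continuous.aestronglyMeasurable (by fun_prop))
  · exact (isOpen_lt continuous_fst.norm continuous_const).inter
      (isOpen_lt continuous_snd.norm continuous_const)
  · rintro b ⟨h1, h2⟩
    -- Half of the gap between the Gaussian weight and the exponent: one half pays for exp(r‖ℓ‖),
    -- the other remains as decay.
    set r : ℝ := (1 - (‖b.1‖ + ‖b.2‖) / 2) / 2 with hr
    have hr0 : 0 < r := by rw [hr]; linarith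
    refine ⟨r, hr0, ?_⟩
    refine (integrable_exp_neg_norm_sq (W := W) (b := r / (2 * hbar)) (by positivity)).mono' ?_
      (Filter.Eventually.of_forall fun z => ?_)
    · have hc := continuous_gaussExponent (hbar := hbar) (W := W)
      have hc' : Continuous fun z : W => gaussExponent hbar z b := hc.clm_apply continuous_const
      refine Continuous.aestronglyMeasurable ?_
      have := Complex.continuous_re
      fun_prop
    · rw [Real.norm_of_nonneg (by positivity), Complex.norm_real,
        Real.norm_of_nonneg (Real.exp_pos _).le, ← Real.exp_add, ← Real.exp_add]
      gcongr
      have h3 := norm_gaussExponent_le (hbar := hbar) z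
      have h4 := (Complex.re_le_norm _).trans (norm_gaussExponent_apply_le (hbar := hbar) z b)
      have h5 := mul_le_mul_of_nonneg_left h3 hr0.le
      have h6 : r * (‖z‖ ^ 2 / (2 * hbar)) + ‖z‖ ^ 2 / (4 * hbar) * (‖b.1‖ + ‖b.2‖) +
          -‖z‖ ^ 2 / (2 * hbar) = -(r / (2 * hbar)) * ‖z‖ ^ 2 := by
        have h7 : ‖b.1‖ + ‖b.2‖ = 2 - 4 * r := by rw [hr]; ring
        rw [h7]
        field_simp
        ring
      linarith

theorem inner_gauss {g' gi' : W →L[ℝ] W} (h : SympPair g gi) (h' : SympPair g' gi') :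
    inner ℂ (toL2 (h.gauss hbar)) (toL2 (h'.gauss hbar)) =
      gaussInner hbar (sympZ g, sympZ g') := by
  rw [inner_toL2, gaussInner]
  refine integral_congr_ae (Filter.Eventually.of_forall fun z => ?_)
  simp only [h.gauss_apply, h'.gauss_apply, gaussFun, ← Complex.exp_conj, smul_eq_mul,
    ← Complex.exp_add, gaussExponent_apply, quadEval_apply, map_neg, map_div₀, map_mul,
    inner_conj_symm, Complex.conj_ofReal, Complex.conj_ofNat]
  congr 2
  push_cast
  ring

/-- The vacuum expectation of a product of two unitary operators which implement symplectic
maps. -/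
theorem vacuum_coeff_mul {g' gi' : W →L[ℝ] W} (h : SympPair g gi) (h' : SympPair g' gi')
    {U Ui U' Ui' : Fock hbar W →ₗ[ℂ] Fock hbar W} (hUi : Implements gi Ui)
    (hU' : Implements g' U')
    (hadj : ∀ f k, inner ℂ (toL2 k) (toL2 (U f)) = inner ℂ (toL2 (Ui k)) (toL2 f))
    (hadj' : ∀ f k, inner ℂ (toL2 k) (toL2 (U' f)) = inner ℂ (toL2 (Ui' k)) (toL2 f)) :
    (U (U' (vacuum hbar W))).1 0 = (U (vacuum hbar W)).1 0 * (U' (vacuum hbar W)).1 0 *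
      ((vacuumMass hbar W : ℂ)⁻¹ * gaussInner hbar (sympZ gi, sympZ g')) := by
  have hc : (vacuumMass hbar W : ℂ) ≠ 0 := Complex.ofReal_ne_zero.2 vacuumMass_pos.ne'
  have hadj2 : ∀ f k, inner ℂ (toL2 k) (toL2 (Ui f)) = inner ℂ (toL2 (U k)) (toL2 f) := by
    intro f k
    rw [← inner_conj_symm, ← hadj, inner_conj_symm]
  have h1 := inner_vacuum (U (U' (vacuum hbar W)))
  have h2 : (Ui (vacuum hbar W)).1 0 = starRingEnd ℂ ((U (vacuum hbar W)).1 0) := by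
    have h3 := inner_vacuum (Ui (vacuum hbar W))
    rw [hadj2, ← inner_conj_symm, inner_vacuum, map_mul, Complex.conj_ofReal] at h3
    exact (mul_left_cancel₀ hc h3).symm
  -- ⟨1, UU'1⟩ = ⟨U⁻¹1, U'1⟩, and both vectors are multiples of Gaussians; the multiple for U⁻¹ is
  -- the conjugate of the one for U.
  rw [hadj, hUi.apply_vacuum h.symm (fun f => hadj2 f _),
    hU'.apply_vacuum h' (fun f => hadj' f _), map_smul, map_smul, inner_smul_left,
    inner_smul_right, inner_gauss, h2, Complex.conj_conj,
    ← hU'.apply_vacuum h' (fun f => hadj' f _)] at h1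
  rw [← mul_right_inj' hc, ← h1]
  field_simp

theorem vacuum_coeff_inv {U Ui : Fock hbar W →ₗ[ℂ] Fock hbar W}
    (hadj : ∀ f k, inner ℂ (toL2 k) (toL2 (U f)) = inner ℂ (toL2 (Ui k)) (toL2 f)) :
    (Ui (vacuum hbar W)).1 0 = starRingEnd ℂ ((U (vacuum hbar W)).1 0) := by
  have hc : (vacuumMass hbar W : ℂ) ≠ 0 := Complex.ofReal_ne_zero.2 vacuumMass_pos.ne'
  have h3 := inner_vacuum (U (vacuum hbar W))
  rw [hadj, ← inner_conj_symm, inner_vacuum, map_mul, Complex.conj_ofReal] at h3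
  rw [← mul_left_cancel₀ hc h3, Complex.conj_conj]

end GaussianFock

/-! ### Inner products of translated Gaussians -/

section CoherentStates

variable {hbar : ℝ} [hpos : Fact (0 < hbar)] {W : Type uV} [NormedAddCommGroup W]
  [InnerProductSpace ℂ W] [FiniteDimensional ℂ W] [MeasurableSpace W] [BorelSpace W]
  {g gi : W →L[ℝ] W}

/-- The functional `z ↦ inner u z / 2ħ`. -/
def innerFunctional (hbar : ℝ) (u : W) : W →L[ℂ] ℂ := ((1 / (2 * hbar) : ℝ) : ℂ) • innerSL ℂ u

theorem innerFunctional_apply (u z : W) :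
    innerFunctional hbar u z = inner ℂ u z / (2 * hbar) := by
  change ((1 / (2 * hbar) : ℝ) : ℂ) * inner ℂ u z = _
  push_cast
  ring

theorem norm_innerFunctional (u : W) : ‖innerFunctional hbar u‖ = ‖u‖ / (2 * hbar) := by
  have hb := hpos.out
  rw [innerFunctional, norm_smul, innerSL_apply_norm, Complex.norm_real,
    Real.norm_of_nonneg (by positivity)]
  ring

theorem continuous_innerFunctional : Continuous (innerFunctional hbar : W → W →L[ℂ] ℂ) :=
  (innerSL ℂ).continuous.fun_const_smul _

theorem re_innerFunctional_le (u z : W) :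
    (innerFunctional hbar u z).re ≤ ‖z‖ / (2 * hbar) * ‖u‖ := by
  refine (Complex.re_le_norm _).trans (((innerFunctional hbar u).le_opNorm z).trans (le_of_eq ?_))
  rw [norm_innerFunctional]
  ring

/-- Laplace transforms of functions with sufficient decay are entire. -/
theorem differentiable_laplace {p : W → ℂ} (hp : AEStronglyMeasurable p (hermVolume W))
    (h : ∀ c : ℝ, Integrable (fun u => Real.exp (c * ‖u‖) * ‖p u‖) (hermVolume W)) :
    Differentiable ℂ fun z : W => ∫ u, Complex.exp (inner ℂ u z / (2 * hbar)) * p u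
      ∂hermVolume W := by
  have : ProperSpace W := FiniteDimensional.proper ℂ W
  have hm := continuous_innerFunctional (hbar := hbar) (W := W)
  have hd : ExpDominated (hermVolume W) (innerFunctional hbar) Set.univ p := by
    intro z _
    refine ⟨1, one_pos, (h (1 / (2 * hbar) + ‖z‖ / (2 * hbar))).mono' ?_
      (Filter.Eventually.of_forall fun u => ?_)⟩
    · have hc : Continuous fun u : W => Real.exp (1 * ‖innerFunctional hbar u‖) *
          Real.exp (innerFunctional hbar u z).re := by
        have h1 : Continuous fun u : W => innerFunctional hbar u z := hm.clm_apply continuous_const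
        have := Complex.continuous_re
        fun_prop
      exact hc.aestronglyMeasurable.mul hp.norm
    · rw [Real.norm_of_nonneg (by positivity), ← Real.exp_add]
      gcongr
      rw [norm_innerFunctional]
      have := re_innerFunctional_le (hbar := hbar) u z
      calc _ ≤ 1 * (‖u‖ / (2 * hbar)) + ‖z‖ / (2 * hbar) * ‖u‖ := by gcongr
        _ = _ := by ring
  intro z
  have h1 := (hd.hasFDerivAt hm.aestronglyMeasurable hp (Set.mem_univ z)).differentiableAt
  simpa only [innerFunctional_apply, smul_eq_mul] using h1

/-- A real linear operator which commutes with `i` is complex linear. -/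
def complexLinear (T : W →L[ℝ] W) (hT : ∀ x, T (Complex.I • x) = Complex.I • T x) : W →L[ℂ] W :=
  LinearMap.toContinuousLinearMap
    { toFun := T
      map_add' := map_add T
      map_smul' := fun c x => by
        have h1 : c • x = c.re • x + c.im • Complex.I • x := by
          rw [← Complex.coe_smul, ← Complex.coe_smul, smul_smul, ← add_smul, Complex.re_add_im]
        have h2 : c • T x = c.re • T x + c.im • Complex.I • T x := by
          rw [← Complex.coe_smul, ← Complex.coe_smul, smul_smul, ← add_smul, Complex.re_add_im]
        rw [h1, map_add, map_smul, map_smul, hT, RingHom.id_apply, h2] }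

/-- The exponent in the coherent states of a Gaussian. -/
def cohExponent (hbar : ℝ) (g : W →L[ℝ] W) (w : W) : ℂ :=
  ((‖w‖ : ℂ) ^ 2 - inner ℂ (cohOp g w) (g w)) / (4 * hbar)

theorem SympPair.differentiable_conj_cohExponent (h : SympPair g gi) :
    Differentiable ℂ fun w => starRingEnd ℂ (cohExponent hbar g w) := by
  have h1 : (fun w => starRingEnd ℂ (cohExponent hbar g w)) = fun w =>
      antiForm (antiPart g) (antiPart_I g) w (complexLinear (cohOp g) h.cohOp_I w) *
        (-Complex.I / 2 / (4 * hbar)) := by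
    funext w
    rw [cohExponent, h.inner_cohOp, antiForm_apply]
    simp only [map_div₀, map_mul, Complex.conj_I, inner_conj_symm, Complex.conj_ofReal,
      Complex.conj_ofNat]
    change _ = inner ℂ (antiPart g w) (cohOp g w) * _
    ring
  rw [h1]
  exact ((ContinuousLinearMap.differentiable _).clm_apply
    (ContinuousLinearMap.differentiable _)).mul_const _

/-- Multiplying by exp(|w|²/4ħ) leaves only antiholomorphic dependence on w. This uses the symmetry
of Z_g to combine the mixed terms in z and gw. -/
theorem SympPair.weyl_gauss_apply (h : SympPair g gi) (w z : W) :
    Complex.exp ((‖w‖ : ℂ) ^ 2 / (4 * hbar)) * (weyl (g w) (h.gauss hbar)).1 z =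
      Complex.exp (cohExponent hbar g w) * Complex.exp (inner ℂ (cohOp g w) z / (2 * hbar)) *
        (h.gauss hbar).1 z := by
  rw [weyl_apply, h.gauss_apply, h.gauss_apply, gaussFun, gaussFun, ← Complex.exp_add,
    ← Complex.exp_add, ← Complex.exp_add, ← Complex.exp_add]
  congr 1
  have h1 : (‖g w‖ : ℂ) ^ 2 = inner ℂ (g w) (g w) := (inner_self_eq_norm_sq_to_K (g w)).symm
  have h2 := h.inner_sympZ_comm z (g w)
  rw [h1, cohExponent, cohOp_apply, map_sub, inner_sub_left, inner_sub_right, inner_sub_right,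
    inner_add_left, inner_add_left, h2]
  ring

/-- The function `w ↦ exp (|w|² / 4ħ) ⟨U(g w) γ, γ⟩`. -/
def SympPair.overlap (h : SympPair g gi) (hbar : ℝ) [Fact (0 < hbar)] (w : W) : ℂ :=
  Complex.exp ((‖w‖ : ℂ) ^ 2 / (4 * hbar)) *
    inner ℂ (toL2 (weyl (g w) (h.gauss hbar))) (toL2 (h.gauss hbar))

/-- After conjugation the integrand depends holomorphically on w. The overlap is an entire prefactor
times the Laplace transform of |γ|² and its weight, evaluated at the complex linear image `cohOp g
w`. -/
theorem SympPair.differentiable_overlap (h : SympPair g gi) :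
    Differentiable ℂ (h.overlap hbar) := by
  have hb := hpos.out
  have : ProperSpace W := FiniteDimensional.proper ℂ W
  set p : W → ℂ := fun z => starRingEnd ℂ ((h.gauss hbar).1 z) * (h.gauss hbar).1 z *
    (Real.exp (-‖z‖ ^ 2 / (2 * hbar)) : ℂ) with hp
  have hpc : Continuous p := by
    have := (h.gauss hbar).2.1.continuous
    have h2 : Continuous fun z => starRingEnd ℂ ((h.gauss hbar).1 z) :=
      Complex.continuous_conj.comp this
    exact (h2.mul this).mul (by fun_prop)
  have hpi : ∀ c : ℝ, Integrable (fun u => Real.exp (c * ‖u‖) * ‖p u‖) (hermVolume W) := by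
    intro c
    have hε : 0 < (1 - ‖sympZ g‖) / (2 * hbar) :=
      div_pos (by linarith [h.norm_sympZ_lt_one]) (by linarith)
    refine (integrable_exp_linear_sub_sq hε c).mono'
      (Continuous.aestronglyMeasurable (by fun_prop)) (Filter.Eventually.of_forall fun z => ?_)
    rw [Real.norm_of_nonneg (by positivity), sub_eq_add_neg, Real.exp_add]
    gcongr
    simp only [hp, norm_mul, RCLike.norm_conj, Complex.norm_real, h.gauss_apply]
    rw [Real.norm_of_nonneg (Real.exp_pos _).le]
    calc ‖gaussFun hbar (sympZ g) z‖ * ‖gaussFun hbar (sympZ g) z‖ * _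
        ≤ Real.exp (‖sympZ g‖ * ‖z‖ ^ 2 / (4 * hbar)) *
          Real.exp (‖sympZ g‖ * ‖z‖ ^ 2 / (4 * hbar)) * Real.exp (-‖z‖ ^ 2 / (2 * hbar)) := by
          gcongr <;> exact norm_gaussFun_le _ _
      _ = _ := by
          rw [← Real.exp_add, ← Real.exp_add]
          congr 1
          field_simp
          ring
  have h1 : h.overlap hbar = fun w => Complex.exp (starRingEnd ℂ (cohExponent hbar g w)) *
      ∫ u, Complex.exp (inner ℂ u (complexLinear (cohOp g) h.cohOp_I w) / (2 * hbar)) * p u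
        ∂hermVolume W := by
    funext w
    rw [overlap, inner_toL2, ← integral_const_mul, ← integral_const_mul]
    refine integral_congr_ae (Filter.Eventually.of_forall fun z => ?_)
    have h2 := congrArg (starRingEnd ℂ) (h.weyl_gauss_apply (hbar := hbar) w z)
    simp only [map_mul, ← Complex.exp_conj, map_div₀, inner_conj_symm, Complex.conj_ofReal,
      Complex.conj_ofNat, map_pow] at h2
    simp only [hp]
    rw [← mul_assoc, ← mul_assoc, h2]
    change _ = _ * (Complex.exp (inner ℂ z (cohOp g w) / (2 * hbar)) * _)
    ring
  rw [h1]
  exact h.differentiable_conj_cohExponent.cexp.mul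
    ((differentiable_laplace hpc.aestronglyMeasurable hpi).comp
      (ContinuousLinearMap.differentiable _))

/-- Since U(gw)* = U(-gw), the adjoint exchanges w and -w. -/
theorem SympPair.overlap_neg (h : SympPair g gi) (w : W) :
    h.overlap hbar w = starRingEnd ℂ (h.overlap hbar (-w)) := by
  rw [overlap, overlap, map_mul, ← Complex.exp_conj, inner_conj_symm, map_neg, inner_weyl_left]
  simp only [norm_neg, map_div₀, map_pow, map_mul, Complex.conj_ofReal, Complex.conj_ofNat]

/-- The Hermitian symmetry makes this entire function also antiholomorphic, hence constant. In the
proof it is a `GaussRel` for the identity, whose Gaussian has Z = 0. -/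
theorem SympPair.overlap_eq (h : SympPair g gi) (w : W) :
    h.overlap hbar w = (‖toL2 (h.gauss hbar)‖ : ℂ) ^ 2 := by
  have hr : GaussRel hbar (ContinuousLinearMap.id ℝ W) (h.overlap hbar) (h.overlap hbar) := by
    intro x
    simp [← h.overlap_neg]
  rw [hr.eq_gaussFun SympPair.refl h.differentiable_overlap h.differentiable_overlap w]
  have h0 : weyl (g 0) (h.gauss hbar) = h.gauss hbar := by rw [map_zero, weyl_zero]
  rw [overlap, h0, sympZ_id]
  simp only [norm_zero, gaussFun, inner_self_eq_norm_sq_to_K]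
  simp

/-- The normalised inner products of the coherent states. -/
def cohKernel (hbar : ℝ) (w w' : W) : ℂ :=
  starRingEnd ℂ (Complex.exp (Complex.I * (inner ℂ (-w') w).im / (2 * hbar))) *
    Complex.exp (-((‖w - w'‖ : ℂ) ^ 2 / (4 * hbar)))

/-- The Weyl relations reduce to the overlap at w - w', and the phase involves only the imaginary
part, which g preserves. Hence the kernel is independent of g. -/
theorem SympPair.inner_weyl_gauss (h : SympPair g gi) (w w' : W) :
    inner ℂ (toL2 (weyl (g w) (h.gauss hbar))) (toL2 (weyl (g w') (h.gauss hbar))) =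
      cohKernel hbar w w' * (‖toL2 (h.gauss hbar)‖ : ℂ) ^ 2 := by
  have h1 := h.overlap_eq (hbar := hbar) (w - w')
  rw [← h1, overlap, cohKernel, ← inner_weyl_weyl (-(g w')), weyl_neg_weyl, weyl_weyl,
    ← map_neg, h.im_inner, ← map_add, neg_add_eq_sub, map_smul, inner_smul_left, mul_assoc,
    ← mul_assoc (Complex.exp (-_)), ← Complex.exp_add, neg_add_cancel, Complex.exp_zero, one_mul]

theorem inner_weyl_vacuum (w w' : W) :
    inner ℂ (toL2 (weyl w (vacuum hbar W))) (toL2 (weyl w' (vacuum hbar W))) =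
      cohKernel hbar w w' * (‖toL2 (vacuum hbar W)‖ : ℂ) ^ 2 := by
  have := (SympPair.refl (W := W)).inner_weyl_gauss (hbar := hbar) w w'
  rwa [gauss_refl] at this

end CoherentStates

/-! ### The Fock space as a Hilbert space -/

section FockHilbert

variable {hbar : ℝ} [hpos : Fact (0 < hbar)] {W : Type uV} [NormedAddCommGroup W]
  [InnerProductSpace ℂ W] [FiniteDimensional ℂ W] [MeasurableSpace W] [BorelSpace W]
  {g gi : W →L[ℝ] W}

/-- The function `z ↦ exp (|z|² / 4ħ) ⟨φ, U(z, 0) 1⟩` (up to a constant factor). -/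
def fockProj (hbar : ℝ) [Fact (0 < hbar)] (φ : Lp ℂ 2 (hermVolume W)) (z : W) : ℂ :=
  (vacuumMass hbar W : ℂ)⁻¹ * (Complex.exp ((‖z‖ : ℂ) ^ 2 / (4 * hbar)) *
    inner ℂ (toL2 (weyl z (vacuum hbar W))) φ)

/-- This is the reproducing property, so `fockProj` recovers a Fock function pointwise from its
class in L². -/
theorem fockProj_toL2 (f : Fock hbar W) (z : W) : fockProj hbar (toL2 f) z = f.1 z := by
  have hc : (vacuumMass hbar W : ℂ) ≠ 0 := Complex.ofReal_ne_zero.2 vacuumMass_pos.ne'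
  rw [fockProj, inner_weyl_left, inner_vacuum_weyl_neg, inv_mul_eq_iff_eq_mul₀ hc, mul_left_comm,
    mul_assoc]
  congr 1
  rw [mul_left_comm, ← mul_assoc, Complex.ofReal_exp, ← Complex.exp_add]
  push_cast
  rw [neg_div, add_neg_cancel, Complex.exp_zero, one_mul]

theorem continuous_fockProj (z : W) : Continuous fun φ => fockProj hbar φ z := by
  unfold fockProj
  fun_prop

theorem memLp_exp_linear_sub_sq (c : ℝ) : MemLp (fun u : W =>
    Real.exp (c * ‖u‖) * Real.exp (-‖u‖ ^ 2 / (4 * hbar))) 2 (hermVolume W) := by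
  have hb := hpos.out
  have hc : Continuous fun u : W => Real.exp (c * ‖u‖) * Real.exp (-‖u‖ ^ 2 / (4 * hbar)) := by
    fun_prop
  rw [memLp_two_iff_integrable_sq hc.aestronglyMeasurable]
  refine (integrable_exp_linear_sub_sq (W := W) (b := 1 / (2 * hbar)) (by positivity)
    (2 * c)).congr (Filter.Eventually.of_forall fun u => ?_)
  simp only
  rw [← Real.exp_add, ← Real.exp_nat_mul]
  congr 1
  push_cast
  field_simp
  ring

/-- For an arbitrary square integrable φ the function is a Laplace transform of φ times a Gaussian,
with enough decay to be entire. This supplies the limits needed for completeness. -/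
theorem differentiable_fockProj (φ : Lp ℂ 2 (hermVolume W)) :
    Differentiable ℂ (fockProj hbar φ) := by
  have hm : AEStronglyMeasurable
      (fun u => (Real.exp (-‖u‖ ^ 2 / (4 * hbar)) : ℂ) * φ u) (hermVolume W) :=
    (Continuous.aestronglyMeasurable (by fun_prop)).mul (Lp.aestronglyMeasurable φ)
  have hi : ∀ c : ℝ, Integrable (fun u => Real.exp (c * ‖u‖) *
      ‖(Real.exp (-‖u‖ ^ 2 / (4 * hbar)) : ℂ) * φ u‖) (hermVolume W) := by
    intro c
    have h1 := MemLp.integrable_mul (p := 2) (q := 2)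
      (memLp_exp_linear_sub_sq (hbar := hbar) (W := W) c) (Lp.memLp φ).norm
    refine h1.congr (Filter.Eventually.of_forall fun u => ?_)
    simp only [Pi.mul_apply, norm_mul, Complex.norm_real, Real.norm_of_nonneg (Real.exp_pos _).le]
    ring
  have h1 : fockProj hbar φ = fun z => (vacuumMass hbar W : ℂ)⁻¹ *
      ∫ u, Complex.exp (inner ℂ u z / (2 * hbar)) *
        ((Real.exp (-‖u‖ ^ 2 / (4 * hbar)) : ℂ) * φ u) ∂hermVolume W := by
    funext z
    rw [fockProj, L2.inner_def, ← integral_const_mul]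
    congr 1
    refine integral_congr_ae ?_
    filter_upwards [toL2_coeFn (weyl z (vacuum hbar W))] with u hu
    rw [hu, RCLike.inner_apply, weyl_apply, vacuum_apply, mul_one, map_mul, Complex.conj_ofReal,
      ← Complex.exp_conj, map_sub, map_div₀, map_div₀, inner_conj_symm]
    simp only [map_pow, map_mul, Complex.conj_ofReal, Complex.conj_ofNat]
    rw [Complex.exp_sub]
    field_simp
  rw [h1]
  exact (differentiable_laplace hm hi).const_mul _

/-- The image of the Fock space in the space of square integrable functions. -/
def fockRange (hbar : ℝ) (W : Type uV) [NormedAddCommGroup W]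
    [InnerProductSpace ℂ W] [FiniteDimensional ℂ W] [MeasurableSpace W] [BorelSpace W] :
    Submodule ℂ (Lp ℂ 2 (hermVolume W)) :=
  LinearMap.range (toL2 : Fock hbar W →ₗ[ℂ] _)

/-- Convergence in L² forces pointwise convergence to `fockProj hbar φ`, because point evaluations
are inner products. A subsequence converges almost everywhere to φ, so φ is represented by that
entire function. -/
theorem isClosed_fockRange : IsClosed (fockRange hbar W : Set (Lp ℂ 2 (hermVolume W))) := by
  refine isSeqClosed_iff_isClosed.1 fun φs φ hφs hφ => ?_
  choose f hf using hφs
  obtain ⟨ns, hmono, hns⟩ := (tendstoInMeasure_of_tendsto_Lp hφ).exists_seq_tendsto_ae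
  have h1 : ∀ z, Filter.Tendsto (fun n => (f n).1 z) Filter.atTop (nhds (fockProj hbar φ z)) := by
    intro z
    have h2 := ((continuous_fockProj (hbar := hbar) z).tendsto φ).comp hφ
    refine h2.congr fun n => ?_
    rw [Function.comp_apply, ← hf, fockProj_toL2]
  have hae : (fun z => fockProj hbar φ z * (Real.exp (-‖z‖ ^ 2 / (4 * hbar)) : ℂ))
      =ᵐ[hermVolume W] φ := by
    have hall : ∀ᵐ z ∂hermVolume W, ∀ n, φs n z =
        (f n).1 z * (Real.exp (-‖z‖ ^ 2 / (4 * hbar)) : ℂ) := by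
      rw [ae_all_iff]
      intro n
      rw [← hf n]
      exact toL2_coeFn (f n)
    filter_upwards [hns, hall] with z hz hz'
    refine tendsto_nhds_unique ?_ hz
    simp only [hz']
    exact ((h1 z).comp hmono.tendsto_atTop).mul_const _
  have hmem : fockProj hbar φ ∈ Fock hbar W :=
    ⟨differentiable_fockProj φ, (Lp.memLp φ).ae_eq hae.symm⟩
  refine ⟨⟨_, hmem⟩, Lp.ext ((toL2_coeFn _).trans hae)⟩

instance : CompleteSpace (fockRange hbar W) := isClosed_fockRange.completeSpace_coe

/-- The Fock space as a Hilbert space. -/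
def fockEquiv : Fock hbar W ≃ₗ[ℂ] fockRange hbar W :=
  LinearEquiv.ofInjective toL2 toL2_injective

theorem inner_fockEquiv (f k : Fock hbar W) :
    inner ℂ (fockEquiv f) (fockEquiv k) = inner ℂ (toL2 f) (toL2 k) := rfl

theorem norm_fockEquiv (f : Fock hbar W) : ‖fockEquiv f‖ = ‖toL2 f‖ := rfl

/-- The coherent states. -/
def coherent (hbar : ℝ) [Fact (0 < hbar)] (w : W) : fockRange hbar W :=
  fockEquiv (weyl w (vacuum hbar W))

/-- A function orthogonal to every coherent state vanishes at every point, by the reproducing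
property. -/
theorem dense_span_coherent :
    Dense (Submodule.span ℂ (Set.range (coherent hbar : W → _)) : Set (fockRange hbar W)) := by
  rw [Submodule.dense_iff_topologicalClosure_eq_top, Submodule.topologicalClosure_eq_top_iff,
    Submodule.eq_bot_iff]
  intro k hk
  obtain ⟨f, rfl⟩ := fockEquiv.surjective k
  have h1 : f = 0 := by
    refine fock_ext fun z => ?_
    have h2 := (Submodule.mem_orthogonal _ _).1 hk _
      (Submodule.subset_span (Set.mem_range_self z))
    rw [coherent, inner_fockEquiv] at h2
    rw [← fockProj_toL2, fockProj, h2]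
    simp
  rw [h1, map_zero]

/-- A norm preserving operator of the Fock space, as an operator of the Hilbert space. -/
def fockOp (U : Fock hbar W →ₗ[ℂ] Fock hbar W) (hU : ∀ f, ‖toL2 (U f)‖ = ‖toL2 f‖) :
    fockRange hbar W →L[ℂ] fockRange hbar W :=
  LinearMap.mkContinuous (fockEquiv.toLinearMap ∘ₗ U ∘ₗ fockEquiv.symm.toLinearMap) 1 fun k => by
    obtain ⟨f, rfl⟩ := fockEquiv.surjective k
    rw [LinearMap.comp_apply, LinearMap.comp_apply, LinearEquiv.coe_coe, LinearEquiv.coe_coe,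
      LinearEquiv.symm_apply_apply, norm_fockEquiv, norm_fockEquiv, hU, one_mul]

theorem fockOp_apply (U : Fock hbar W →ₗ[ℂ] Fock hbar W) (hU : ∀ f, ‖toL2 (U f)‖ = ‖toL2 f‖)
    (f : Fock hbar W) : fockOp U hU (fockEquiv f) = fockEquiv (U f) := by
  simp [fockOp]

/-- Norm preserving operators of the Fock space which agree on coherent states are equal. -/
theorem fock_hom_ext {U U' : Fock hbar W →ₗ[ℂ] Fock hbar W} (hU : ∀ f, ‖toL2 (U f)‖ = ‖toL2 f‖)
    (hU' : ∀ f, ‖toL2 (U' f)‖ = ‖toL2 f‖)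
    (h : ∀ w, U (weyl w (vacuum hbar W)) = U' (weyl w (vacuum hbar W))) : U = U' := by
  have h1 : fockOp U hU = fockOp U' hU' := by
    refine ContinuousLinearMap.ext_on dense_span_coherent ?_
    rintro _ ⟨w, rfl⟩
    rw [coherent, fockOp_apply, fockOp_apply, h]
  ext1 f
  have h2 := DFunLike.congr_fun h1 (fockEquiv f)
  rw [fockOp_apply, fockOp_apply] at h2
  exact fockEquiv.injective h2

/-- Provides the vector needed in `Implements.gaussRel` for an isometry not yet known to be
surjective; completeness of the Fock space yields the adjoint. -/
theorem exists_adjoint_vacuum (U : Fock hbar W →ₗ[ℂ] Fock hbar W)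
    (hU : ∀ f, ‖toL2 (U f)‖ = ‖toL2 f‖) : ∃ k : Fock hbar W, ∀ f,
      inner ℂ (toL2 (vacuum hbar W)) (toL2 (U f)) = inner ℂ (toL2 k) (toL2 f) := by
  refine ⟨fockEquiv.symm (ContinuousLinearMap.adjoint (fockOp U hU) (fockEquiv (vacuum hbar W))),
    fun f => ?_⟩
  rw [← inner_fockEquiv, ← inner_fockEquiv, LinearEquiv.apply_symm_apply,
    ContinuousLinearMap.adjoint_inner_left, fockOp_apply]

/-- Two families of vectors with the same inner products, one of them total, are related by an
isometry. -/
theorem exists_isometry_of_inner_eq {H ι : Type*} [NormedAddCommGroup H] [InnerProductSpace ℂ H]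
    [CompleteSpace H] {ξ η : ι → H} (hξ : Dense (Submodule.span ℂ (Set.range ξ) : Set H))
    (h : ∀ i i', inner ℂ (ξ i) (ξ i') = inner ℂ (η i) (η i')) :
    ∃ T : H →L[ℂ] H, (∀ i, T (ξ i) = η i) ∧ ∀ x, ‖T x‖ = ‖x‖ := by
  set e : (ι →₀ ℂ) →ₗ[ℂ] H := Finsupp.linearCombination ℂ ξ with he
  set f : (ι →₀ ℂ) →ₗ[ℂ] H := Finsupp.linearCombination ℂ η with hf
  have hd : DenseRange e := by
    have : (Set.range e) = (Submodule.span ℂ (Set.range ξ) : Set H) := by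
      rw [← Finsupp.range_linearCombination]; rfl
    rw [DenseRange, this]
    exact hξ
  -- The norm of a finite combination depends only on the inner products of its terms, so the map is
  -- isometric on the dense span and extends by continuity.
  have hinner : ∀ a, inner ℂ (f a) (f a) = inner ℂ (e a) (e a) := by
    intro a
    simp only [he, hf, Finsupp.linearCombination_apply, Finsupp.sum, sum_inner, inner_sum,
      inner_smul_left, inner_smul_right, h]
  have hn : ∀ a, ‖f a‖ = ‖e a‖ := by
    intro a
    rw [@norm_eq_sqrt_re_inner ℂ, @norm_eq_sqrt_re_inner ℂ _ _ _ _ (e a), hinner]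
  have hb : ∃ C : ℝ, ∀ a, ‖f a‖ ≤ C * ‖e a‖ := ⟨1, fun a => by rw [hn, one_mul]⟩
  refine ⟨f.extendOfNorm e, fun i => ?_, fun x => ?_⟩
  · have h1 := LinearMap.extendOfNorm_eq hd hb (Finsupp.single i 1)
    simpa [he, hf] using h1
  · refine hd.induction (P := fun x => ‖f.extendOfNorm e x‖ = ‖x‖) ?_
      (isClosed_eq (by fun_prop) (by fun_prop)) x
    rintro _ ⟨a, rfl⟩
    rw [LinearMap.extendOfNorm_eq hd hb, hn]

/-- Every symplectic map is implemented by a norm preserving operator. -/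
theorem SympPair.exists_implements_norm (h : SympPair g gi) :
    ∃ U : Fock hbar W →ₗ[ℂ] Fock hbar W, (∀ f, ‖toL2 (U f)‖ = ‖toL2 f‖) ∧ Implements g U := by
  have hne : ∀ f : Fock hbar W, f.1 0 = 1 → ‖toL2 f‖ ≠ 0 := by
    intro f hf h0
    have h1 : f = 0 := toL2_injective ((norm_eq_zero.1 h0).trans (map_zero toL2).symm)
    rw [h1] at hf
    exact zero_ne_one hf
  have hγ := hne _ (h.gauss_zero (hbar := hbar))
  -- This constant gives the Gaussian the norm of the vacuum, so that the two families have equal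
  -- inner products.
  set c : ℂ := ((‖toL2 (vacuum hbar W)‖ / ‖toL2 (h.gauss hbar)‖ : ℝ) : ℂ) with hc
  obtain ⟨T, hT, hTn⟩ := exists_isometry_of_inner_eq (dense_span_coherent (hbar := hbar) (W := W))
    (η := fun w => fockEquiv (c • weyl (g w) (h.gauss hbar))) fun w w' => by
      have hcγ : c * (‖toL2 (h.gauss hbar)‖ : ℂ) = (‖toL2 (vacuum hbar W)‖ : ℂ) := by
        rw [hc, ← Complex.ofReal_mul, div_mul_cancel₀ _ hγ]
      rw [coherent, coherent, inner_fockEquiv, inner_fockEquiv, map_smul, map_smul,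
        inner_smul_left, inner_smul_right, h.inner_weyl_gauss, inner_weyl_vacuum, ← hcγ, hc,
        Complex.conj_ofReal]
      ring
  obtain ⟨U, hUn, hUc⟩ : ∃ U : Fock hbar W →ₗ[ℂ] Fock hbar W, (∀ f, ‖toL2 (U f)‖ = ‖toL2 f‖) ∧
      ∀ w, U (weyl w (vacuum hbar W)) = c • weyl (g w) (h.gauss hbar) := by
    refine ⟨fockEquiv.symm.toLinearMap ∘ₗ T.toLinearMap ∘ₗ fockEquiv.toLinearMap,
      fun f => ?_, fun w => ?_⟩
    · rw [← norm_fockEquiv, ← norm_fockEquiv, ← hTn (fockEquiv f)]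
      simp
    · apply fockEquiv.injective
      rw [← hT w]
      simp [coherent]
  refine ⟨U, hUn, fun v => ?_⟩
  -- It suffices to test on coherent states, where both sides come from the Weyl relations with the
  -- same phase, g being symplectic.
  have h1 : U ∘ₗ weyl v = weyl (g v) ∘ₗ U := by
    refine fock_hom_ext (fun f => ?_) (fun f => ?_) fun w => ?_
    · rw [LinearMap.comp_apply, hUn, norm_weyl]
    · rw [LinearMap.comp_apply, norm_weyl, hUn]
    · rw [LinearMap.comp_apply, LinearMap.comp_apply, weyl_weyl, map_smul, hUc, hUc, map_smul,
        weyl_weyl, h.im_inner, map_add, smul_comm]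
  exact fun f => LinearMap.congr_fun h1 f

/-- Schur's lemma for the Heisenberg representation. -/
theorem Implements.eq_smul {U : Fock hbar W →ₗ[ℂ] Fock hbar W}
    (hU : Implements (ContinuousLinearMap.id ℝ W) U) (hn : ∀ f, ‖toL2 (U f)‖ = ‖toL2 f‖) :
    ∃ c : ℂ, c ≠ 0 ∧ ∀ f, U f = c • f := by
  obtain ⟨k, hk⟩ := exists_adjoint_vacuum U hn
  -- For the identity the Gaussian is the vacuum itself, so the vacuum is an eigenvector;
  -- intertwining carries the eigenvalue to all coherent states.
  have h1 := hU.apply_vacuum SympPair.refl hk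
  rw [gauss_refl] at h1
  set c := (U (vacuum hbar W)).1 0
  have hv : ‖toL2 (vacuum hbar W)‖ ≠ 0 := by
    intro h0
    have := norm_sq_vacuum (hbar := hbar) (W := W)
    rw [h0] at this
    have hp := vacuumMass_pos (hbar := hbar) (W := W)
    rw [← this] at hp
    simp at hp
  have hc : ‖c‖ = 1 := by
    have h2 := hn (vacuum hbar W)
    rw [h1, map_smul, norm_smul] at h2
    exact mul_right_cancel₀ hv (h2.trans (one_mul _).symm)
  refine ⟨c, fun h0 => by simp [h0] at hc, fun f => ?_⟩
  have h2 : U = c • LinearMap.id := by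
    refine fock_hom_ext hn (fun f => ?_) fun w => ?_
    · rw [LinearMap.smul_apply, map_smul, norm_smul, hc, one_mul, LinearMap.id_apply]
    · rw [hU, h1, map_smul]; rfl
  rw [h2]; rfl

/-- Every symplectic map is implemented by a unitary operator of the Fock space. -/
theorem SympPair.exists_implements (h : SympPair g gi) :
    ∃ U : Fock hbar W ≃ₗ[ℂ] Fock hbar W, (∀ f, ‖toL2 (U f)‖ = ‖toL2 f‖) ∧
      Implements g U.toLinearMap := by
  obtain ⟨U, hUn, hU⟩ := h.exists_implements_norm (hbar := hbar)
  obtain ⟨U', hUn', hU'⟩ := h.symm.exists_implements_norm (hbar := hbar)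
  -- Composing with an implementer of the inverse gives a nonzero scalar, which makes the isometry
  -- surjective.
  obtain ⟨c, hc, hcU⟩ := Implements.eq_smul (U := U ∘ₗ U')
    (fun v f => by
      rw [LinearMap.comp_apply, hU', hU, h.right_inv]; rfl)
    (fun f => by rw [LinearMap.comp_apply, hUn, hUn'])
  have hinj : Function.Injective U := by
    rw [injective_iff_map_eq_zero]
    intro f hf
    have h1 := hUn f
    rw [hf, map_zero, norm_zero] at h1
    exact toL2_injective ((norm_eq_zero.1 h1.symm).trans (map_zero toL2).symm)
  have hsurj : Function.Surjective U := by
    intro f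
    refine ⟨c⁻¹ • U' f, ?_⟩
    have h1 := hcU f
    rw [LinearMap.comp_apply] at h1
    rw [map_smul, h1, inv_smul_smul₀ hc]
  exact ⟨LinearEquiv.ofBijective U ⟨hinj, hsurj⟩, hUn, hU⟩

end FockHilbert

/-! ### Smooth maps to the group `Mp^c` -/

section MpcSmooth

variable {V : Type uV} [AddCommGroup V] [Module ℝ V] [FiniteDimensional ℝ V]
  {Ω : SymplecticForm V} {hbar : ℝ} [hpos : Fact (0 < hbar)] {J : PCCS Ω}

/-- A linear automorphism of `V` as an operator of the Hermitian space `(V, Ω, j)`. -/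
def hermMap (J : PCCS Ω) (g : V ≃ₗ[ℝ] V) : Herm J →L[ℝ] Herm J :=
  LinearMap.toContinuousLinearMap
    ((toHerm J).toLinearMap ∘ₗ g.toLinearMap ∘ₗ (toHerm J).symm.toLinearMap)

theorem hermMap_apply (g : V ≃ₗ[ℝ] V) (v : V) :
    hermMap J g (toHerm J v) = toHerm J (g v) := by
  simp [hermMap]

theorem hermMap_mul (g g' : V ≃ₗ[ℝ] V) : hermMap J (g * g') = hermMap J g * hermMap J g' := by
  ext x
  obtain ⟨v, rfl⟩ := (toHerm J).surjective x
  change _ = hermMap J g (hermMap J g' (toHerm J v))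
  rw [hermMap_apply, hermMap_apply, hermMap_apply]; rfl

theorem hermMap_one : hermMap J (1 : V ≃ₗ[ℝ] V) = 1 := by
  ext x
  obtain ⟨v, rfl⟩ := (toHerm J).surjective x
  rw [hermMap_apply]; rfl

theorem im_inner_toHerm (v w : V) : (inner ℂ (toHerm J v) (toHerm J w)).im = Ω.form v w := by
  rw [inner_toHerm]
  simp only [Complex.sub_im, Complex.ofReal_im, Complex.mul_im, Complex.I_re, Complex.I_im,
    Complex.ofReal_re]
  rw [Ω.skew w v]
  ring

theorem sympPair_hermMap (J : PCCS Ω) (g : Sp Ω) :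
    SympPair (hermMap J g.1) (hermMap J (g⁻¹).1) where
  left_inv x := by
    obtain ⟨v, rfl⟩ := (toHerm J).surjective x
    rw [hermMap_apply, hermMap_apply]
    exact congrArg (toHerm J) (g.1.symm_apply_apply v)
  right_inv x := by
    obtain ⟨v, rfl⟩ := (toHerm J).surjective x
    rw [hermMap_apply, hermMap_apply]
    exact congrArg (toHerm J) (g.1.apply_symm_apply v)
  im_inner x y := by
    obtain ⟨v, rfl⟩ := (toHerm J).surjective x
    obtain ⟨w, rfl⟩ := (toHerm J).surjective y
    rw [hermMap_apply, hermMap_apply, im_inner_toHerm, im_inner_toHerm]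
    exact g.2 v w

/-- The unitary operator of an element of `Mp^c`. -/
def mpcOp (A : Mpc hbar J) : Fock hbar (Herm J) →ₗ[ℂ] Fock hbar (Herm J) := A.1.1.toLinearMap

theorem mpcOp_mul (A B : Mpc hbar J) (f : Fock hbar (Herm J)) :
    mpcOp (A * B) f = mpcOp A (mpcOp B f) := rfl

theorem mpcOp_mpcOp_inv (A : Mpc hbar J) (f : Fock hbar (Herm J)) :
    mpcOp A (mpcOp A⁻¹ f) = f := A.1.1.apply_symm_apply f

theorem mpcParam_eq (A : Mpc hbar J) : mpcParam A = (mpcOp A (vacuum hbar (Herm J))).1 0 := rfl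

theorem mpc_implements (A : Mpc hbar J) :
    Implements (hermMap J (sigma hbar J A).1) (mpcOp A) := by
  intro x f
  obtain ⟨v, rfl⟩ := (toHerm J).surjective x
  have h1 := A.2.2 v 0 (A.1.1 f)
  have h2 : A.1.1⁻¹ (A.1.1 f) = f := A.1.1.symm_apply_apply f
  rw [h2] at h1
  rw [hermMap_apply]
  exact h1.symm

theorem fockNormSq_eq_iff (f k : Fock hbar (Herm J)) :
    fockNormSq f = fockNormSq k ↔ ‖toL2 f‖ = ‖toL2 k‖ := by
  have hb := hpos.out
  have h1 : ((2 * Real.pi * hbar) ^ Module.finrank ℂ (Herm J))⁻¹ ≠ 0 := by positivity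
  rw [fockNormSq_eq, fockNormSq_eq, mul_right_inj' h1,
    pow_left_inj₀ (norm_nonneg _) (norm_nonneg _) two_ne_zero]

theorem mpc_norm (A : Mpc hbar J) (f : Fock hbar (Herm J)) : ‖toL2 (mpcOp A f)‖ = ‖toL2 f‖ :=
  (fockNormSq_eq_iff _ _).1 (A.2.1 f)

theorem mpc_adj (A : Mpc hbar J) (f k : Fock hbar (Herm J)) :
    inner ℂ (toL2 k) (toL2 (mpcOp A f)) = inner ℂ (toL2 (mpcOp A⁻¹ k)) (toL2 f) := by
  rw [← inner_map_map_of_norm (mpcOp A) (mpc_norm A) (mpcOp A⁻¹ k), mpcOp_mpcOp_inv]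

/-- The product law in the coordinates (g, λ). Its only analytic ingredient is a Gaussian integral
depending smoothly on the symplectic parts. -/
theorem mpcParam_mul (A B : Mpc hbar J) : mpcParam (A * B) = mpcParam A * mpcParam B *
    ((vacuumMass hbar (Herm J) : ℂ)⁻¹ * gaussInner hbar
      (sympZ (hermMap J ((sigma hbar J A)⁻¹).1), sympZ (hermMap J (sigma hbar J B).1))) := by
  have h1 := mpc_implements A⁻¹
  rw [map_inv] at h1
  rw [mpcParam_eq, mpcOp_mul]
  exact vacuum_coeff_mul (sympPair_hermMap J (sigma hbar J A))
    (sympPair_hermMap J (sigma hbar J B)) h1 (mpc_implements B) (mpc_adj A) (mpc_adj B)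

theorem mpcParam_inv (A : Mpc hbar J) : mpcParam A⁻¹ = starRingEnd ℂ (mpcParam A) :=
  vacuum_coeff_inv (mpc_adj A)

/-- The homomorphism `σ : Mp^c → Sp` is surjective. -/
theorem sigma_surjective : Function.Surjective (sigma hbar J) := by
  intro g
  obtain ⟨U, hUn, hU⟩ := (sympPair_hermMap J g).exists_implements (hbar := hbar)
  refine ⟨⟨(U, g), fun f => (fockNormSq_eq_iff _ _).2 (hUn f), fun v t f => ?_⟩, rfl⟩
  have h1 := hU (toHerm J v) (U.symm f)
  rw [hermMap_apply] at h1
  change heisenberg (toHerm J (g.1 v)) t f = U (heisenberg (toHerm J v) t (U.symm f))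
  -- The central variable t contributes the same phase on both sides, so only t = 0 has to be
  -- checked.
  rw [heisenberg_eq, heisenberg_eq, map_smul]
  congr 1
  refine Eq.trans ?_ h1.symm
  exact congrArg _ (U.apply_symm_apply f).symm

/-! ### Smoothness of multiplication and inversion in Mp^c -/

section

variable {F : Type uF} [NormedAddCommGroup F] [NormedSpace ℝ F]
  {H : Type*} [TopologicalSpace H] {I : ModelWithCorners ℝ F H}
  {N : Type*} [TopologicalSpace N] [ChartedSpace H N] {c c' : N → Mpc hbar J} {s : Set N}

/-- Writes the operator as a linear expression in its values on a finite basis, so smoothness tested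
on vectors becomes smoothness in operator norm. -/
theorem hermMap_eq_sum (g : V ≃ₗ[ℝ] V) : hermMap J g =
    ∑ i, ContinuousLinearMap.smulRightL ℝ (Herm J) (Herm J) (LinearMap.toContinuousLinearMap
      ((Module.finBasis ℝ V).coord i ∘ₗ (toHerm J).symm.toLinearMap))
        (toHerm J (g (Module.finBasis ℝ V i))) := by
  ext x
  obtain ⟨v, rfl⟩ := (toHerm J).surjective x
  rw [hermMap_apply]
  conv_lhs => rw [← (Module.finBasis ℝ V).sum_repr v, map_sum, map_sum]
  simp

/-- Smoothness of a map to `Mp^c`, with an operator valued symplectic part. -/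
theorem smoothMpcOn_iff : SmoothMpcOn I c s ↔
    ContMDiffOn I 𝓘(ℝ, Herm J →L[ℝ] Herm J) ∞ (fun n => hermMap J (sigma hbar J (c n)).1) s ∧
      ContMDiffOn I 𝓘(ℝ, ℂ) ∞ (fun n => mpcParam (c n)) s := by
  refine and_congr_left fun _ => ⟨fun h => ?_, fun h v => ?_⟩
  · simp only [hermMap_eq_sum]
    refine contMDiffOn_finsetSum fun i _ => ?_
    exact (ContinuousLinearMap.contMDiff (ContinuousLinearMap.smulRightL ℝ (Herm J) (Herm J)
      (LinearMap.toContinuousLinearMap ((Module.finBasis ℝ V).coord i ∘ₗ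
        (toHerm J).symm.toLinearMap)))).comp_contMDiffOn (h _)
  · have h1 := (ContinuousLinearMap.contMDiff (n := ∞) (ContinuousLinearMap.apply ℝ (Herm J)
      (toHerm J v) : (Herm J →L[ℝ] Herm J) →L[ℝ] Herm J)).comp_contMDiffOn h
    refine h1.congr fun n _ => ?_
    exact (hermMap_apply _ _).symm

theorem SmoothMpcOn.congr (h : SmoothMpcOn I c s) (hcc : ∀ n ∈ s, c' n = c n) :
    SmoothMpcOn I c' s :=
  ⟨fun v => (h.1 v).congr fun n hn => by rw [hcc n hn], h.2.congr fun n hn => by rw [hcc n hn]⟩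

theorem smoothMpcOn_const (A : Mpc hbar J) : SmoothMpcOn I (fun _ : N => A) s :=
  ⟨fun _ => contMDiffOn_const, contMDiffOn_const⟩

theorem SmoothMpcOn.comp {F' : Type*} [NormedAddCommGroup F'] [NormedSpace ℝ F']
    {H' : Type*} [TopologicalSpace H'] {I' : ModelWithCorners ℝ F' H'}
    {N' : Type*} [TopologicalSpace N'] [ChartedSpace H' N'] {k : N' → N} {t : Set N'}
    (h : SmoothMpcOn I c s) (hk : ContMDiffOn I' I ∞ k t) (hts : Set.MapsTo k t s) :
    SmoothMpcOn I' (fun n => c (k n)) t :=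
  ⟨fun v => (h.1 v).comp hk hts, h.2.comp hk hts⟩

/-- Smoothness of a map to `Mp^c` is a local property. -/
theorem smoothMpcOn_of_locally (h : ∀ n ∈ s, ∃ u, IsOpen u ∧ n ∈ u ∧ SmoothMpcOn I c (s ∩ u)) :
    SmoothMpcOn I c s := by
  refine ⟨fun v => contMDiffOn_of_locally_contMDiffOn fun n hn => ?_,
    contMDiffOn_of_locally_contMDiffOn fun n hn => ?_⟩
  · obtain ⟨u, hu, hnu, hc⟩ := h n hn
    exact ⟨u, hu, hnu, hc.1 v⟩
  · obtain ⟨u, hu, hnu, hc⟩ := h n hn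
    exact ⟨u, hu, hnu, hc.2⟩

theorem contDiffAt_inverse {T : Herm J →L[ℝ] Herm J} (hT : IsUnit T) :
    ContDiffAt ℝ ∞ (Ring.inverse : (Herm J →L[ℝ] Herm J) → _) T := by
  have : CompleteSpace (Herm J) := FiniteDimensional.complete ℝ (Herm J)
  obtain ⟨u, rfl⟩ := hT
  exact contDiffAt_ringInverse ℝ u

theorem hermMap_inv (g : Sp Ω) : hermMap J (g⁻¹).1 = Ring.inverse (hermMap J g.1) := by
  have h1 : hermMap J g.1 * hermMap J (g⁻¹).1 = 1 := by
    rw [← hermMap_mul, ← hermMap_one (J := J)]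
    exact congrArg (fun a : Sp Ω => hermMap J a.1) (mul_inv_cancel g)
  have h2 : hermMap J (g⁻¹).1 * hermMap J g.1 = 1 := by
    rw [← hermMap_mul, ← hermMap_one (J := J)]
    exact congrArg (fun a : Sp Ω => hermMap J a.1) (inv_mul_cancel g)
  exact (Ring.inverse_unit ⟨hermMap J g.1, hermMap J (g⁻¹).1, h1, h2⟩).symm

theorem isUnit_hermMap (g : Sp Ω) : IsUnit (hermMap J g.1) := by
  refine isUnit_of_injective fun x y hxy => ?_
  rw [← (sympPair_hermMap J g).left_inv x, hxy, (sympPair_hermMap J g).left_inv]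

/-- Operator inversion is smooth at invertible operators, and unitarity turns λ into its conjugate.
-/
theorem SmoothMpcOn.inv (h : SmoothMpcOn I c s) : SmoothMpcOn I (fun n => (c n)⁻¹) s := by
  rw [smoothMpcOn_iff] at h ⊢
  refine ⟨fun n hn => ?_, ?_⟩
  · simp only [map_inv, hermMap_inv]
    exact (contDiffAt_inverse (isUnit_hermMap _)).contMDiffAt.comp_contMDiffWithinAt n (h.1 n hn)
  · simp only [mpcParam_inv]
    exact (ContinuousLinearMap.contMDiff
      (Complex.conjCLE : ℂ →L[ℝ] ℂ)).comp_contMDiffOn h.2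

theorem contDiffAt_sympZ {g gi : Herm J →L[ℝ] Herm J} (h : SympPair g gi) :
    ContDiffAt ℝ ∞ (sympZ : (Herm J →L[ℝ] Herm J) → _) g := by
  have h1 : ContDiff ℝ ∞ fun g : Herm J →L[ℝ] Herm J =>
      g.comp (Complex.I • ContinuousLinearMap.id ℝ (Herm J)) :=
    contDiff_id.clm_comp contDiff_const
  have h2 : ContDiff ℝ ∞ fun g : Herm J →L[ℝ] Herm J => Complex.I • g :=
    ContDiff.const_smul (R := ℂ) Complex.I (contDiff_id (E := Herm J →L[ℝ] Herm J))
  have h3 : ContDiff ℝ ∞ (linPart : (Herm J →L[ℝ] Herm J) → _) := h2.add h1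
  have h4 : ContDiff ℝ ∞ (antiPart : (Herm J →L[ℝ] Herm J) → _) := h2.sub h1
  exact h4.contDiffAt.mul ((contDiffAt_inverse h.isUnit_linPart).comp g h3.contDiffAt)

theorem SmoothMpcOn.contMDiffOn_sympZ (h : SmoothMpcOn I c s) :
    ContMDiffOn I 𝓘(ℝ, Herm J →L[ℝ] Herm J) ∞
      (fun n => sympZ (hermMap J (sigma hbar J (c n)).1)) s := fun n hn =>
  (contDiffAt_sympZ (sympPair_hermMap J _)).contMDiffAt.comp_contMDiffWithinAt n
    ((smoothMpcOn_iff.1 h).1 n hn)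

theorem contMDiffOn_complex_mul {a b : N → ℂ} (ha : ContMDiffOn I 𝓘(ℝ, ℂ) ∞ a s)
    (hb : ContMDiffOn I 𝓘(ℝ, ℂ) ∞ b s) : ContMDiffOn I 𝓘(ℝ, ℂ) ∞ (fun n => a n * b n) s :=
  (contDiff_mul (𝕜 := ℝ) (𝔸 := ℂ)).contMDiff.comp_contMDiffOn (ha.prodMk_space hb)

theorem SmoothMpcOn.mul (h : SmoothMpcOn I c s) (h' : SmoothMpcOn I c' s) :
    SmoothMpcOn I (fun n => c n * c' n) s := by
  refine smoothMpcOn_iff.2 ⟨?_, ?_⟩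
  · have h1 := (smoothMpcOn_iff.1 h).1.clm_comp (smoothMpcOn_iff.1 h').1
    refine h1.congr fun n _ => ?_
    rw [map_mul]
    exact hermMap_mul _ _
  · simp only [mpcParam_mul, ← map_inv]
    refine contMDiffOn_complex_mul (contMDiffOn_complex_mul h.2 h'.2)
      (contMDiffOn_complex_mul contMDiffOn_const fun n hn => ?_)
    have h1 := (h.inv.contMDiffOn_sympZ n hn).prodMk_space (h'.contMDiffOn_sympZ n hn)
    have h2 : ContDiffAt ℝ ∞ (gaussInner hbar) (sympZ (hermMap J (sigma hbar J (c n)⁻¹).1),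
        sympZ (hermMap J (sigma hbar J (c' n)).1)) := by
      -- Both operators Z are strict contractions, so the pair lies in the open set where the
      -- Gaussian integral is smooth.
      refine contDiffOn_gaussInner.contDiffAt (IsOpen.mem_nhds ?_
        ⟨(sympPair_hermMap J _).norm_sympZ_lt_one, (sympPair_hermMap J _).norm_sympZ_lt_one⟩)
      exact (isOpen_lt continuous_fst.norm continuous_const).inter
        (isOpen_lt continuous_snd.norm continuous_const)
    exact ContMDiffAt.comp_contMDiffWithinAt (g := gaussInner hbar) n h2.contMDiffAt h1

end

end MpcSmooth

/-! ### Maps of constant rank and submersions between vector spaces -/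

section ConstantRank

open Module Set Topology Metric

variable {E : Type uE} [NormedAddCommGroup E] [NormedSpace ℝ E] [FiniteDimensional ℝ E]
  {F : Type uF} [NormedAddCommGroup F] [NormedSpace ℝ F] [FiniteDimensional ℝ F]

/-- The inverse function theorem, with a smooth inverse on an open set. -/
theorem exists_smooth_local_inverse {f : F → E} {O : Set F} {x₀ : F} (hO : IsOpen O)
    (hx₀ : x₀ ∈ O) (hf : ContDiffOn ℝ ∞ f O) {e : F ≃L[ℝ] E}
    (he : HasFDerivAt f (e : F →L[ℝ] E) x₀) :
    ∃ H : OpenPartialHomeomorph F E, (H : F → E) = f ∧ x₀ ∈ H.source ∧ H.source ⊆ O ∧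
      ContDiffOn ℝ ∞ H.symm H.target := by
  have : CompleteSpace F := FiniteDimensional.complete ℝ F
  have hat : ∀ x ∈ O, ContDiffAt ℝ ∞ f x := fun x hx => hf.contDiffAt (hO.mem_nhds hx)
  set H₀ := (hat x₀ hx₀).toOpenPartialHomeomorph f he (by simp) with hH₀
  -- Shrinking to the open set where the derivative is invertible makes the inverse smooth on the
  -- whole target, not only near one point.
  set O' : Set F := O ∩ fderiv ℝ f ⁻¹' range ((↑) : (F ≃L[ℝ] E) → F →L[ℝ] E) with hO'
  have hO'o : IsOpen O' :=
    ((hf.fderiv_of_isOpen hO (m := 0) (by simp)).continuousOn).isOpen_inter_preimage hO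
      ContinuousLinearEquiv.isOpen
  refine ⟨H₀.restrOpen O' hO'o, rfl, ?_, ?_, ?_⟩
  · rw [OpenPartialHomeomorph.restrOpen_source]
    refine ⟨ContDiffAt.mem_toOpenPartialHomeomorph_source _ _ _, hx₀, e, he.fderiv.symm⟩
  · rw [OpenPartialHomeomorph.restrOpen_source]
    exact fun x hx => hx.2.1
  · intro y hy
    have hx := (H₀.restrOpen O' hO'o).map_target hy
    rw [OpenPartialHomeomorph.restrOpen_source] at hx
    obtain ⟨e', he'⟩ := hx.2.2
    refine ContDiffAt.contDiffWithinAt (OpenPartialHomeomorph.contDiffAt_symm _ hy (f₀' := e') ?_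
      (hat _ hx.2.1))
    rw [he']
    exact ((hat _ hx.2.1).differentiableAt (by simp)).hasFDerivAt

/-- An open smooth map whose rank is maximal at a point is a submersion at this point. -/
theorem range_fderiv_eq_top_of_rank_le {f : F → E} {O : Set F} {x₀ : F} (hO : IsOpen O)
    (hx₀ : x₀ ∈ O) (hf : ContDiffOn ℝ ∞ f O)
    (hr : ∀ x ∈ O, finrank ℝ (LinearMap.range (fderiv ℝ f x : F →ₗ[ℝ] E)) ≤
      finrank ℝ (LinearMap.range (fderiv ℝ f x₀ : F →ₗ[ℝ] E)))
    (hopen : ∀ u ⊆ O, IsOpen u → x₀ ∈ u → (interior (f '' u)).Nonempty) :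
    LinearMap.range (fderiv ℝ f x₀ : F →ₗ[ℝ] E) = ⊤ := by
  set A := fderiv ℝ f x₀ with hA
  set R : Submodule ℝ E := LinearMap.range (A : F →ₗ[ℝ] E) with hR
  set N : Submodule ℝ F := LinearMap.ker (A : F →ₗ[ℝ] E) with hN
  obtain ⟨π, hπ⟩ := Submodule.ClosedComplemented.of_finiteDimensional R
  obtain ⟨P, hP⟩ := Submodule.ClosedComplemented.of_finiteDimensional N
  have hat : ∀ x ∈ O, HasFDerivAt f (fderiv ℝ f x) x := fun x hx =>
    ((hf.contDiffAt (hO.mem_nhds hx)).differentiableAt (by simp)).hasFDerivAt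
  -- New coordinates as in the constant rank theorem: the projection of f to the range of its
  -- derivative at x₀, completed by the component along the kernel.
  set Φ : F → R × N := fun x => (π (f x), P x) with hΦ
  have hΦs : ContDiffOn ℝ ∞ Φ O := (π.contDiff.comp_contDiffOn hf).prodMk P.contDiff.contDiffOn
  have hinj : Function.Injective ((π.comp A).prod P : F →L[ℝ] R × N) := by
    rw [injective_iff_map_eq_zero]
    intro x hx
    have h1 : π (A x) = 0 := congrArg Prod.fst hx
    have h2 : P x = 0 := congrArg Prod.snd hx
    have h3 : A x = 0 := by
      have h4 := hπ ⟨A x, x, rfl⟩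
      rw [h1] at h4
      exact (congrArg Subtype.val h4).symm
    have h5 := hP ⟨x, h3⟩
    rw [h2] at h5
    exact (congrArg Subtype.val h5).symm
  have hdim : finrank ℝ F = finrank ℝ (R × N) := by
    rw [finrank_prod]
    exact ((A : F →ₗ[ℝ] E).finrank_range_add_finrank_ker).symm
  set e : F ≃L[ℝ] R × N := (LinearEquiv.ofInjectiveOfFinrankEq
    ((π.comp A).prod P : F →ₗ[ℝ] R × N) hinj hdim).toContinuousLinearEquiv with he
  have hΦd : HasFDerivAt Φ (e : F →L[ℝ] R × N) x₀ :=
    (π.hasFDerivAt.comp x₀ (hat x₀ hx₀)).prodMk P.hasFDerivAt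
  obtain ⟨H, hHΦ, hHx, hHO, hHs⟩ := exists_smooth_local_inverse hO hx₀ hΦs hΦd
  have hΦx : Φ x₀ ∈ H.target := by rw [← hHΦ]; exact H.map_source hHx
  obtain ⟨ε, hε, hball⟩ := Metric.isOpen_iff.1 H.open_target _ hΦx
  have hmem : ∀ b ∈ H.target, H.symm b ∈ O := fun b hb => hHO (H.map_target hb)
  have hsd : ∀ b ∈ H.target, HasFDerivAt H.symm (fderiv ℝ H.symm b) b := fun b hb =>
    ((hHs.contDiffAt (H.open_target.mem_nhds hb)).differentiableAt (by simp)).hasFDerivAt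
  have hg : ∀ b ∈ H.target, HasFDerivAt (fun b => f (H.symm b))
      ((fderiv ℝ f (H.symm b)).comp (fderiv ℝ H.symm b)) b := fun b hb =>
    (hat _ (hmem b hb)).comp b (hsd b hb)
  have hπg : ∀ b ∈ H.target, π (f (H.symm b)) = b.1 := by
    intro b hb
    have h1 := H.right_inv hb
    rw [hHΦ] at h1
    exact congrArg Prod.fst h1
  -- In these coordinates π∘f is the first projection. The rank bound makes π injective on the range
  -- of the derivative of f at the corresponding point, so kernel directions, which π∘f ignores, are
  -- killed by f as well.
  have hzero : ∀ b ∈ H.target, ∀ ν : N,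
      ((fderiv ℝ f (H.symm b)).comp (fderiv ℝ H.symm b)) (0, ν) = 0 := by
    intro b hb ν
    set D := (fderiv ℝ f (H.symm b)).comp (fderiv ℝ H.symm b) with hD
    have h1 : π.comp D = ContinuousLinearMap.fst ℝ R N := by
      have h2 : HasFDerivAt (fun b => π (f (H.symm b))) (π.comp D) b :=
        π.hasFDerivAt.comp b (hg b hb)
      have h3 : HasFDerivAt (fun b : R × N => π (f (H.symm b)))
          (ContinuousLinearMap.fst ℝ R N) b :=
        hasFDerivAt_fst.congr_of_eventuallyEq
          (Filter.eventuallyEq_of_mem (H.open_target.mem_nhds hb) hπg)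
      exact h2.unique h3
    set S : Submodule ℝ E := LinearMap.range (fderiv ℝ f (H.symm b) : F →ₗ[ℝ] E) with hS
    set πS : S →ₗ[ℝ] R := (π : E →ₗ[ℝ] R).domRestrict S with hπS
    have hsurj : Function.Surjective πS := by
      intro r
      refine ⟨⟨D (r, 0), fderiv ℝ H.symm b (r, 0), rfl⟩, ?_⟩
      exact DFunLike.congr_fun h1 (r, 0)
    have hle : finrank ℝ S ≤ finrank ℝ R := hr _ (hmem b hb)
    have hge : finrank ℝ R ≤ finrank ℝ S := LinearMap.finrank_le_finrank_of_surjective hsurj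
    have hinjS : Function.Injective πS :=
      (LinearMap.injective_iff_surjective_of_finrank_eq_finrank (le_antisymm hle hge)).2 hsurj
    have h4 : (⟨D (0, ν), fderiv ℝ H.symm b (0, ν), rfl⟩ : S) = 0 := by
      apply hinjS
      rw [map_zero]
      exact DFunLike.congr_fun h1 (0, ν)
    exact congrArg Subtype.val h4
  have hconst : ∀ b ∈ ball (Φ x₀) ε, f (H.symm b) = f (H.symm (b.1, (Φ x₀).2)) := by
    intro b hb
    rw [← ball_prod_same] at hb
    have hsub : ∀ n ∈ ball (Φ x₀).2 ε, (b.1, n) ∈ H.target := fun n hn =>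
      hball (by rw [← ball_prod_same]; exact ⟨hb.1, hn⟩)
    have hd : ∀ n ∈ ball (Φ x₀).2 ε,
        HasFDerivAt (fun n => f (H.symm (b.1, n))) (0 : N →L[ℝ] E) n := by
      intro n hn
      have h1 := (hg _ (hsub n hn)).comp n ((hasFDerivAt_const b.1 n).prodMk (hasFDerivAt_id n))
      refine h1.congr_fderiv ?_
      ext ν
      exact hzero _ (hsub n hn) ν
    exact isOpen_ball.is_const_of_fderiv_eq_zero (𝕜 := ℝ) (f := fun n => f (H.symm (b.1, n)))
      (convex_ball _ _).isPreconnected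
      (fun n hn => (hd n hn).differentiableAt.differentiableWithinAt) (fun n hn => (hd n hn).fderiv)
      hb.2 (mem_ball_self hε)
  -- If the rank were too small, f would locally factor through a ball of smaller dimension; the C¹
  -- image of that ball has dense complement, contradicting the interior point of the image.
  by_contra hne
  have hlt : finrank ℝ R < finrank ℝ E := by
    refine lt_of_le_of_ne (Submodule.finrank_le R) fun h => hne (Submodule.eq_top_of_finrank_eq h)
  set u : Set F := H.source ∩ H ⁻¹' ball (Φ x₀) ε with hu
  have huo : IsOpen u := H.isOpen_inter_preimage isOpen_ball
  have hux : x₀ ∈ u := ⟨hHx, by rw [mem_preimage, hHΦ]; exact mem_ball_self hε⟩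
  obtain ⟨y, hy⟩ := hopen u (fun x hx => hHO hx.1) huo hux
  have himg : f '' u ⊆ (fun r : R => f (H.symm (r, (Φ x₀).2))) '' ball (Φ x₀).1 ε := by
    rintro _ ⟨x, hx, rfl⟩
    have h1 : H x ∈ ball (Φ x₀) ε := hx.2
    have h2 := hconst _ h1
    rw [H.left_inv hx.1] at h2
    rw [← ball_prod_same] at h1
    exact ⟨(H x).1, h1.1, h2.symm⟩
  have hsm : ContDiffOn ℝ 1 (fun r : R => f (H.symm (r, (Φ x₀).2))) (ball (Φ x₀).1 ε) := by
    have h1 : ContDiffOn ℝ 1 (fun b => f (H.symm b)) H.target :=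
      (hf.comp hHs hmem).of_le (by norm_num)
    refine h1.comp (contDiff_id.prodMk contDiff_const).contDiffOn fun r hr => hball ?_
    rw [← ball_prod_same]
    exact ⟨hr, mem_ball_self hε⟩
  have hdense := hsm.dense_compl_image_of_dimH_lt_finrank (convex_ball _ _) subset_rfl (by
    refine lt_of_le_of_lt (dimH_mono (subset_univ _)) ?_
    rw [Real.dimH_univ_eq_finrank]
    exact_mod_cast hlt)
  have hempty := interior_eq_empty_iff_dense_compl.2 hdense
  have := interior_mono himg hy
  rw [hempty] at this
  exact this

/-- Submersions have smooth local sections. -/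
theorem exists_smooth_local_section {f : F → E} {O : Set F} {x₀ : F} (hO : IsOpen O)
    (hx₀ : x₀ ∈ O) (hf : ContDiffOn ℝ ∞ f O)
    (hsurj : LinearMap.range (fderiv ℝ f x₀ : F →ₗ[ℝ] E) = ⊤) :
    ∃ (u : Set E) (s : E → F), IsOpen u ∧ f x₀ ∈ u ∧ ContDiffOn ℝ ∞ s u ∧
      ∀ y ∈ u, s y ∈ O ∧ f (s y) = y := by
  obtain ⟨B, hB⟩ := (fderiv ℝ f x₀ : F →ₗ[ℝ] E).exists_rightInverse_of_surjective hsurj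
  set B' : E →L[ℝ] F := LinearMap.toContinuousLinearMap B with hB'
  -- Restricting f to the affine slice spanned by a right inverse of its derivative gives derivative
  -- the identity, so the inverse function theorem yields the section.
  set a : E → F := fun y => x₀ + B' y with ha
  have has : ContDiff ℝ ∞ a := contDiff_const.add B'.contDiff
  have ha0 : a 0 = x₀ := by simp [ha]
  have hks : ContDiffOn ℝ ∞ (fun y => f (a y)) (a ⁻¹' O) := hf.comp has.contDiffOn fun y hy => hy
  have hd : HasFDerivAt (fun y => f (a y))
      ((ContinuousLinearEquiv.refl ℝ E : E ≃L[ℝ] E) : E →L[ℝ] E) 0 := by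
    have h1 : HasFDerivAt f (fderiv ℝ f x₀) (a 0) := by
      rw [ha0]
      exact ((hf.contDiffAt (hO.mem_nhds hx₀)).differentiableAt (by simp)).hasFDerivAt
    have h2 : HasFDerivAt a B' 0 := B'.hasFDerivAt.const_add x₀
    refine (h1.comp 0 h2).congr_fderiv ?_
    ext y
    exact LinearMap.congr_fun hB y
  obtain ⟨H, hHk, hH0, hHO, hHs⟩ := exists_smooth_local_inverse (hO.preimage has.continuous)
    (show (0 : E) ∈ a ⁻¹' O by rw [mem_preimage, ha0]; exact hx₀) hks hd
  refine ⟨H.target, fun y => a (H.symm y), H.open_target, ?_, has.comp_contDiffOn hHs,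
    fun y hy => ⟨hHO (H.map_target hy), ?_⟩⟩
  · have h1 := H.map_source hH0
    rw [hHk] at h1
    simpa only [ha0] using h1
  · have h1 := H.right_inv hy
    rwa [hHk] at h1

end ConstantRank

/-! ### Smooth local sections of orbit maps -/

section OrbitSections

variable {E : Type uE} [NormedAddCommGroup E] [NormedSpace ℝ E]
  {M : Type uM} [TopologicalSpace M] [ChartedSpace E M] [IsManifold 𝓘(ℝ, E) ∞ M]
  {F : Type uF} [NormedAddCommGroup F] [NormedSpace ℝ F]
  {N : Type uG} [TopologicalSpace N] [ChartedSpace F N] [IsManifold 𝓘(ℝ, F) ∞ N]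

theorem isOpen_domain_inCharts {h : N → M} (hh : Continuous h) (n : N) (m : M) :
    IsOpen ((chartAt F n).target ∩ (chartAt F n).symm ⁻¹' (h ⁻¹' (chartAt E m).source)) :=
  (chartAt F n).isOpen_inter_preimage_symm ((chartAt E m).open_source.preimage hh)

theorem contDiffOn_inCharts {h : N → M} (hh : ContMDiff 𝓘(ℝ, F) 𝓘(ℝ, E) ∞ h) (n : N) (m : M) :
    ContDiffOn ℝ ∞ (fun a => chartAt E m (h ((chartAt F n).symm a)))
      ((chartAt F n).target ∩ (chartAt F n).symm ⁻¹' (h ⁻¹' (chartAt E m).source)) := by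
  rw [← contMDiffOn_iff_contDiffOn]
  have h1 : ContMDiffOn 𝓘(ℝ, F) 𝓘(ℝ, F) ∞ (chartAt F n).symm (chartAt F n).target :=
    contMDiffOn_chart_symm
  have h2 : ContMDiffOn 𝓘(ℝ, E) 𝓘(ℝ, E) ∞ (chartAt E m) (chartAt E m).source :=
    contMDiffOn_chart
  exact h2.comp (hh.comp_contMDiffOn (h1.mono Set.inter_subset_left)) fun a ha => ha.2

variable {G : Type uG} [TopologicalSpace G] [ChartedSpace F G] [Group G] [MulAction G M]

theorem contMDiff_orbit_map
    (hs : ContMDiff (𝓘(ℝ, F).prod 𝓘(ℝ, E)) 𝓘(ℝ, E) ∞ (fun y : G × M => y.1 • y.2)) (p : M) :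
    ContMDiff 𝓘(ℝ, F) 𝓘(ℝ, E) ∞ (fun g : G => g • p) :=
  hs.comp (contMDiff_id.prodMk contMDiff_const)

theorem contMDiff_action_map
    (hs : ContMDiff (𝓘(ℝ, F).prod 𝓘(ℝ, E)) 𝓘(ℝ, E) ∞ (fun y : G × M => y.1 • y.2)) (g : G) :
    ContMDiff 𝓘(ℝ, E) 𝓘(ℝ, E) ∞ (fun p : M => g • p) :=
  hs.comp (contMDiff_const.prodMk contMDiff_id)

variable [LieGroup 𝓘(ℝ, F) ∞ G] [FiniteDimensional ℝ E] [FiniteDimensional ℝ F]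
  [T2Space M] [SecondCountableTopology M] [T2Space G] [SecondCountableTopology G]

/-- A Baire category argument: G is σ-compact because it is locally compact and second countable,
and M is locally compact and Hausdorff. -/
theorem isOpenMap_smul_of_smooth [MulAction.IsPretransitive G M]
    (hs : ContMDiff (𝓘(ℝ, F).prod 𝓘(ℝ, E)) 𝓘(ℝ, E) ∞ (fun y : G × M => y.1 • y.2)) (p₀ : M) :
    IsOpenMap (fun g : G => g • p₀) := by
  have : IsTopologicalGroup G := topologicalGroup_of_lieGroup 𝓘(ℝ, F) ∞
  have : LocallyCompactSpace G := Manifold.locallyCompact_of_finiteDimensional 𝓘(ℝ, F)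
  have : LocallyCompactSpace M := Manifold.locallyCompact_of_finiteDimensional 𝓘(ℝ, E)
  have : ContinuousSMul G M := ⟨hs.continuous⟩
  exact isOpenMap_smul_of_sigmaCompact p₀

/-- In charts, the rank of an orbit map is maximal at `1`. -/
theorem finrank_range_fderiv_orbit_le
    (hs : ContMDiff (𝓘(ℝ, F).prod 𝓘(ℝ, E)) 𝓘(ℝ, E) ∞ (fun y : G × M => y.1 • y.2)) (p₀ : M)
    {f : F → E} (hf : f = fun a => chartAt E p₀ ((chartAt F (1 : G)).symm a • p₀)) {x : F}
    (hx : x ∈ (chartAt F (1 : G)).target) (hx' : (chartAt F (1 : G)).symm x • p₀ ∈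
      (chartAt E p₀).source) :
    Module.finrank ℝ (LinearMap.range (fderiv ℝ f x : F →ₗ[ℝ] E)) ≤
      Module.finrank ℝ (LinearMap.range (fderiv ℝ f (chartAt F (1 : G) 1) : F →ₗ[ℝ] E)) := by
  set φ := chartAt F (1 : G) with hφ
  set ψ := chartAt E p₀ with hψ
  have h1φ : (1 : G) ∈ φ.source := mem_chart_source F 1
  have h0ψ : p₀ ∈ ψ.source := mem_chart_source E p₀
  set g := φ.symm x with hg
  have hL : ContMDiff 𝓘(ℝ, F) 𝓘(ℝ, F) ∞ (fun k : G => g⁻¹ * k) := contMDiff_mul_left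
  have hA := contMDiff_action_map hs g
  have hR := contMDiff_orbit_map hs p₀
  have hLO := isOpen_domain_inCharts (E := F) (F := F) hL.continuous (1 : G) (1 : G)
  have hAO := isOpen_domain_inCharts (E := E) (F := E) hA.continuous p₀ p₀
  have hRO := isOpen_domain_inCharts (E := E) (F := F) hR.continuous (1 : G) p₀
  set a : F → F := fun y => φ (g⁻¹ * φ.symm y) with ha
  set b : E → E := fun y => ψ (g • ψ.symm y) with hb
  have hxL : x ∈ φ.target ∩ φ.symm ⁻¹' ((fun k : G => g⁻¹ * k) ⁻¹' φ.source) :=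
    ⟨hx, by simp only [Set.mem_preimage, ← hg, inv_mul_cancel]; exact h1φ⟩
  have hax : a x = φ 1 := by simp only [ha, ← hg, inv_mul_cancel]
  have hf1 : f (φ 1) = ψ p₀ := by rw [hf]; simp only [φ.left_inv h1φ, one_smul]
  have had : DifferentiableAt ℝ a x :=
    ((contDiffOn_inCharts hL 1 1).contDiffAt (hLO.mem_nhds hxL)).differentiableAt (by simp)
  have hfd : DifferentiableAt ℝ f (a x) := by
    rw [hax, hf]
    refine ((contDiffOn_inCharts hR 1 p₀).contDiffAt (hRO.mem_nhds ⟨φ.map_source h1φ, ?_⟩)).differentiableAt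
      (by simp)
    simp only [Set.mem_preimage, ← hφ, φ.left_inv h1φ, one_smul]
    exact h0ψ
  have hbd : DifferentiableAt ℝ b (f (a x)) := by
    rw [hax, hf1]
    refine ((contDiffOn_inCharts hA p₀ p₀).contDiffAt (hAO.mem_nhds ⟨ψ.map_source h0ψ, ?_⟩)).differentiableAt
      (by simp)
    simp only [Set.mem_preimage, ← hψ, ψ.left_inv h0ψ]
    exact hx'
  -- Equivariance k p₀ = g·((g⁻¹k) p₀), read in charts. The derivative at x factors through the
  -- derivative at the chart point of 1, which bounds the rank.
  have hev : f =ᶠ[nhds x] fun y => b (f (a y)) := by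
    have ho : IsOpen ((φ.target ∩ φ.symm ⁻¹' ((fun k : G => g⁻¹ * k) ⁻¹' φ.source)) ∩
        (φ.target ∩ φ.symm ⁻¹' ((fun k : G => (g⁻¹ * k) • p₀) ⁻¹' ψ.source))) :=
      hLO.inter (isOpen_domain_inCharts (E := E) (F := F) (hR.continuous.comp hL.continuous) 1 p₀)
    refine Filter.eventually_of_mem (ho.mem_nhds ⟨hxL, hx, ?_⟩) ?_
    · simp only [Set.mem_preimage, ← hg, inv_mul_cancel, one_smul]
      exact h0ψ
    · rintro y ⟨⟨_, h2⟩, _, h4⟩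
      simp only [Set.mem_preimage] at h2 h4
      simp only [hf, ha, hb]
      rw [φ.left_inv h2, ψ.left_inv h4, smul_smul, mul_inv_cancel_left]
  have hder : fderiv ℝ f x = (fderiv ℝ b (f (a x))).comp
      ((fderiv ℝ f (a x)).comp (fderiv ℝ a x)) := by
    rw [hev.fderiv_eq]
    exact (hbd.hasFDerivAt.comp x (hfd.hasFDerivAt.comp x had.hasFDerivAt)).fderiv
  rw [hder, ← hax]
  have hle : LinearMap.range ((fderiv ℝ b (f (a x))).comp
      ((fderiv ℝ f (a x)).comp (fderiv ℝ a x)) : F →ₗ[ℝ] E) ≤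
      (LinearMap.range (fderiv ℝ f (a x) : F →ₗ[ℝ] E)).map
        (fderiv ℝ b (f (a x)) : E →ₗ[ℝ] E) := by
    rintro _ ⟨v, rfl⟩
    exact ⟨_, ⟨fderiv ℝ a x v, rfl⟩, rfl⟩
  exact (Submodule.finrank_mono hle).trans (Submodule.finrank_map_le _ _)

/-- Openness and maximal rank at 1 make the orbit map a submersion there; its local section is
transported back through the charts. -/
theorem exists_local_section_orbit_base [MulAction.IsPretransitive G M]
    (hs : ContMDiff (𝓘(ℝ, F).prod 𝓘(ℝ, E)) 𝓘(ℝ, E) ∞ (fun y : G × M => y.1 • y.2)) (p₀ : M) :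
    ∃ (u : Set M) (t : M → G), IsOpen u ∧ p₀ ∈ u ∧ ContMDiffOn 𝓘(ℝ, E) 𝓘(ℝ, F) ∞ t u ∧
      ∀ y ∈ u, t y • p₀ = y := by
  set φ := chartAt F (1 : G) with hφ
  set ψ := chartAt E p₀ with hψ
  have h1φ : (1 : G) ∈ φ.source := mem_chart_source F 1
  have h0ψ : p₀ ∈ ψ.source := mem_chart_source E p₀
  have hR := contMDiff_orbit_map hs p₀
  have hRO := isOpen_domain_inCharts (E := E) (F := F) hR.continuous (1 : G) p₀
  set f : F → E := fun a => ψ (φ.symm a • p₀) with hf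
  set O := φ.target ∩ φ.symm ⁻¹' ((fun g : G => g • p₀) ⁻¹' ψ.source) with hO
  have hfO : ContDiffOn ℝ ∞ f O := contDiffOn_inCharts hR 1 p₀
  have hx₀ : φ 1 ∈ O := ⟨φ.map_source h1φ, by
    simp only [Set.mem_preimage, φ.left_inv h1φ, one_smul]; exact h0ψ⟩
  have hf1 : f (φ 1) = ψ p₀ := by simp only [hf, φ.left_inv h1φ, one_smul]
  have hsurj := range_fderiv_eq_top_of_rank_le hRO hx₀ hfO
    (fun x hx => finrank_range_fderiv_orbit_le hs p₀ hf hx.1 hx.2) (by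
      intro u huO hu hxu
      have h1 : IsOpen (φ.symm '' u) := φ.symm.isOpen_image_of_subset_source hu
        fun a ha => (huO ha).1
      have h2 := isOpenMap_smul_of_smooth hs p₀ _ h1
      have h3 : IsOpen (ψ '' ((fun g : G => g • p₀) '' (φ.symm '' u))) := by
        refine ψ.isOpen_image_of_subset_source h2 ?_
        rintro _ ⟨_, ⟨a, ha, rfl⟩, rfl⟩
        exact (huO ha).2
      have h4 : f '' u = ψ '' ((fun g : G => g • p₀) '' (φ.symm '' u)) := by
        simp only [Set.image_image, hf]
      rw [h4, h3.interior_eq, ← h4]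
      exact ⟨_, _, hxu, rfl⟩)
  obtain ⟨u, s, hu, hxu, hsu, hsO⟩ := exists_smooth_local_section hRO hx₀ hfO hsurj
  rw [hf1] at hxu
  refine ⟨ψ.source ∩ ψ ⁻¹' u, fun y => φ.symm (s (ψ y)), ψ.isOpen_inter_preimage hu,
    ⟨h0ψ, hxu⟩, ?_, ?_⟩
  · have h1 : ContMDiffOn 𝓘(ℝ, F) 𝓘(ℝ, F) ∞ φ.symm φ.target := contMDiffOn_chart_symm
    have h2 : ContMDiffOn 𝓘(ℝ, E) 𝓘(ℝ, E) ∞ ψ ψ.source := contMDiffOn_chart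
    exact h1.comp (hsu.contMDiffOn.comp (h2.mono Set.inter_subset_left) fun y hy => hy.2)
      fun y hy => (hsO _ hy.2).1.1
  · rintro y ⟨hy, hyu⟩
    obtain ⟨h1, h2⟩ := hsO _ hyu
    exact ψ.injOn h1.2 hy h2

/-- The orbit map `g ↦ g p₀` of a smooth transitive action has smooth local sections. -/
theorem exists_local_section_orbit [MulAction.IsPretransitive G M]
    (hs : ContMDiff (𝓘(ℝ, F).prod 𝓘(ℝ, E)) 𝓘(ℝ, E) ∞ (fun y : G × M => y.1 • y.2)) (p₀ x : M) :
    ∃ (u : Set M) (t : M → G), IsOpen u ∧ x ∈ u ∧ ContMDiffOn 𝓘(ℝ, E) 𝓘(ℝ, F) ∞ t u ∧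
      ∀ y ∈ u, t y • p₀ = y := by
  obtain ⟨g, rfl⟩ := MulAction.exists_smul_eq G p₀ x
  obtain ⟨u, t, hu, hp, ht, htp⟩ := exists_local_section_orbit_base hs p₀
  have hA := contMDiff_action_map hs g⁻¹
  have hL : ContMDiff 𝓘(ℝ, F) 𝓘(ℝ, F) ∞ (fun k : G => g * k) := contMDiff_mul_left
  -- A section near p₀ is moved to a section near g p₀ by y ↦ g t(g⁻¹y).
  refine ⟨(fun y => g⁻¹ • y) ⁻¹' u, fun y => g * t (g⁻¹ • y), hu.preimage hA.continuous, ?_,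
    hL.comp_contMDiffOn (ht.comp hA.contMDiffOn fun y hy => hy), fun y hy => ?_⟩
  · simpa using hp
  · rw [mul_smul, htp _ hy, smul_inv_smul]

end OrbitSections

/-! ### The structure `G ×_{K,τ'} Mp^c(V, Ω, j)` is invariant -/

section Bundles

variable {E : Type uE} [NormedAddCommGroup E] [NormedSpace ℝ E]
  {M : Type uM} [TopologicalSpace M] [ChartedSpace E M]
  {V : Type uV} [AddCommGroup V] [Module ℝ V] {Ω : SymplecticForm V}
  {ωM : SymplecticStructure E M}

theorem SpBundle.rmul_injective (b : SpBundle Ω ωM) {A A' : Sp Ω} (h : b.rmul A = b.rmul A') :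
    A = A' := by
  refine Subtype.ext (LinearEquiv.ext fun v => b.frame.equiv.injective ?_)
  have h1 := congrArg (fun d => d.eval v) h
  simp only [SpBundle.eval, SpBundle.rmul, Bundle.TotalSpace.mk_inj] at h1
  exact h1

theorem SpBundle.exists_rmul_eq (b b' : SpBundle Ω ωM) (h : b.base = b'.base) :
    ∃ A : Sp Ω, b.rmul A = b' := by
  obtain ⟨x, e, he⟩ := b
  obtain ⟨y, e', he'⟩ := b'
  obtain rfl : x = y := h
  refine ⟨⟨e'.trans e.symm, fun v w => ?_⟩, ?_⟩
  · rw [← he, ← he']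
    simp
  · refine SpBundle.ext_eval fun v => ?_
    exact congrArg (Bundle.TotalSpace.mk x) (e.apply_symm_apply (e' v))

variable {F : Type uF} [NormedAddCommGroup F] [NormedSpace ℝ F]
  {G : Type uG} [TopologicalSpace G] [ChartedSpace F G] [Group G] [MulAction G M]
  {hG : IsSymplecticAction F G ωM} {p₀ : M} {f₀ : SympFrame Ω ωM p₀}
  [FiniteDimensional ℝ V] {hbar : ℝ} [Fact (0 < hbar)] {J : PCCS Ω}

/-! ### Smoothness of the induced action on tangent vectors -/

section Smooth

variable [IsManifold 𝓘(ℝ, E) ∞ M] [IsManifold 𝓘(ℝ, F) ∞ G]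

/-- The velocity `g_* w` depends smoothly on `g`. -/
theorem contMDiff_tangentMap_action (hG : IsSymplecticAction F G ωM) (w : TangentBundle 𝓘(ℝ, E) M) :
    ContMDiff 𝓘(ℝ, F) 𝓘(ℝ, E).tangent ∞
      (fun g : G => tangentMap 𝓘(ℝ, E) 𝓘(ℝ, E) (fun y : M => g • y) w) := by
  -- The vector g_* w is the tangent map of the whole action G × M → M at the pair (0_g, w), and the
  -- zero section is smooth in g.
  have s0 : ContMDiff 𝓘(ℝ, F) 𝓘(ℝ, F).tangent ∞
      (fun g : G => (⟨g, 0⟩ : TangentBundle 𝓘(ℝ, F) G)) := Bundle.contMDiff_zeroSection _ _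
  have s1 : ContMDiff 𝓘(ℝ, F) (𝓘(ℝ, F).tangent.prod 𝓘(ℝ, E).tangent) ∞
      (fun g : G => ((⟨g, 0⟩ : TangentBundle 𝓘(ℝ, F) G), w)) := s0.prodMk contMDiff_const
  have s2 : ContMDiff (𝓘(ℝ, F).tangent.prod 𝓘(ℝ, E).tangent) (𝓘(ℝ, F).prod 𝓘(ℝ, E)).tangent ∞
      (equivTangentBundleProd 𝓘(ℝ, F) G 𝓘(ℝ, E) M).symm := contMDiff_equivTangentBundleProd_symm
  have s3 : ContMDiff (𝓘(ℝ, F).prod 𝓘(ℝ, E)).tangent 𝓘(ℝ, E).tangent ∞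
      (tangentMap (𝓘(ℝ, F).prod 𝓘(ℝ, E)) 𝓘(ℝ, E) (fun y : G × M => y.1 • y.2)) :=
    hG.smooth.contMDiff_tangentMap (by simp)
  convert (s3.comp s2).comp s1 with g
  simp only [Function.comp_apply, tangentMap]
  congr 1
  rw [mfderiv_prod_eq_add_apply (hG.smooth.mdifferentiableAt (by simp))]
  change _ = mfderiv 𝓘(ℝ, F) 𝓘(ℝ, E) (fun z : G => z • w.proj) g 0 +
    mfderiv 𝓘(ℝ, E) 𝓘(ℝ, E) (fun z : M => g • z) w.proj w.snd
  rw [map_zero, zero_add]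

end Smooth

/-- The extension by `1` to `G` of a lift. -/
def IsotropyLift.ext (L : IsotropyLift hbar J hG f₀) (g : G) : Mpc hbar J :=
  open scoped Classical in if h : g • p₀ = p₀ then L.hom ⟨g, h⟩ else 1

theorem IsotropyLift.ext_eq (L : IsotropyLift hbar J hG f₀) {g : G} (h : g • p₀ = p₀) :
    L.ext g = L.hom ⟨g, h⟩ := dif_pos h

/-- A lift is smooth on K only through local extensions to open sets of G. A smooth map into G with
values in K agrees locally with a composite through such an extension, so no manifold structure on K
is needed. -/
theorem IsotropyLift.smoothMpcOn_ext (L : IsotropyLift hbar J hG f₀)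
    {F' : Type*} [NormedAddCommGroup F'] [NormedSpace ℝ F']
    {H' : Type*} [TopologicalSpace H'] {I' : ModelWithCorners ℝ F' H'}
    {N : Type*} [TopologicalSpace N] [ChartedSpace H' N] {k : N → G} {s : Set N}
    (hk : ContMDiffOn I' 𝓘(ℝ, F) ∞ k s) (hks : ∀ n ∈ s, k n • p₀ = p₀) :
    SmoothMpcOn I' (fun n => L.ext (k n)) s := by
  refine smoothMpcOn_of_locally fun n hn => ?_
  obtain ⟨u, c, hu, hnu, hc, hcL⟩ := L.smooth ⟨k n, hks n hn⟩
  obtain ⟨w, hw, hwu⟩ := continuousOn_iff'.1 hk.continuousOn u hu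
  refine ⟨w, hw, (hwu ▸ (⟨hnu, hn⟩ : n ∈ k ⁻¹' u ∩ s) : n ∈ w ∩ s).1, ?_⟩
  have hmaps : ∀ m ∈ s ∩ w, k m ∈ u := fun m hm =>
    (hwu.symm ▸ (⟨hm.2, hm.1⟩ : m ∈ w ∩ s) : m ∈ k ⁻¹' u ∩ s).1
  refine (hc.comp (hk.mono Set.inter_subset_left) hmaps).congr fun m hm => ?_
  rw [L.ext_eq (hks m hm.1)]
  exact (hcL ⟨k m, hks m hm.1⟩ (hmaps m hm)).symm

variable (L : IsotropyLift hbar J hG f₀)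

/-- Representatives over the same point differ by g⁻¹g' in K; this formula produces all transition
functions of the associated bundle. -/
theorem AssocSpace.mk_eq_mk_ext {g g' : G} (h : g • p₀ = g' • p₀) (B : Mpc hbar J) :
    AssocSpace.mk L g' B = AssocSpace.mk L g (L.ext (g⁻¹ * g') * B) := by
  have hk : (g⁻¹ * g') • p₀ = p₀ := by rw [mul_smul, ← h, inv_smul_smul]
  rw [L.ext_eq hk]
  exact Quotient.sound ⟨(⟨g⁻¹ * g', hk⟩ : MulAction.stabilizer G p₀)⁻¹, by simp⟩

theorem AssocSpace.mk_right_injective {g : G} {B B' : Mpc hbar J}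
    (h : AssocSpace.mk L g B = AssocSpace.mk L g B') : B = B' := by
  obtain ⟨k, hk⟩ := Quotient.exact h
  obtain ⟨h1, h2⟩ := Prod.mk.inj hk
  have : k = 1 := Subtype.ext (by simpa using h1)
  simpa [this] using h2.symm

theorem AssocSpace.exists_mk (q : AssocSpace L) : ∃ g B, q = AssocSpace.mk L g B :=
  Quotient.inductionOn q fun y => ⟨y.1, y.2, rfl⟩

theorem assocMpc_proj_mk (g : G) (B : Mpc hbar J) :
    (assocMpc L).proj (AssocSpace.mk L g B) = g • p₀ := rfl

theorem assocMpc_rmul_mk (g : G) (B A : Mpc hbar J) :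
    (assocMpc L).rmul (AssocSpace.mk L g B) A = AssocSpace.mk L g (B * A) := rfl

theorem assocMpc_smul_mk (g g' : G) (B : Mpc hbar J) :
    (assocMpc L).smul g (AssocSpace.mk L g' B) = AssocSpace.mk L (g * g') B := rfl

theorem assocMpc_φ_mk (g : G) (B : Mpc hbar J) :
    (assocMpc L).φ (AssocSpace.mk L g B) = (f₀.pt.push hG g).rmul (sigma hbar J B) := rfl

variable [LieGroup 𝓘(ℝ, F) ∞ G]

/-- A transition function of `G ×_{K,τ'} Mp^c(V, Ω, j)`. -/
theorem smoothMpcOn_ext_inv_mul {F' : Type*} [NormedAddCommGroup F'] [NormedSpace ℝ F']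
    {H' : Type*} [TopologicalSpace H'] {I' : ModelWithCorners ℝ F' H'}
    {N : Type*} [TopologicalSpace N] [ChartedSpace H' N] {a b : N → G} {s : Set N}
    (ha : ContMDiffOn I' 𝓘(ℝ, F) ∞ a s) (hb : ContMDiffOn I' 𝓘(ℝ, F) ∞ b s)
    (hab : ∀ n ∈ s, a n • p₀ = b n • p₀) :
    SmoothMpcOn I' (fun n => L.ext ((a n)⁻¹ * b n)) s :=
  L.smoothMpcOn_ext (ha.inv.mul hb) fun n hn => by rw [mul_smul, ← hab n hn, inv_smul_smul]

variable [IsManifold 𝓘(ℝ, E) ∞ M] [FiniteDimensional ℝ E] [FiniteDimensional ℝ F] [T2Space M]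
  [SecondCountableTopology M] [T2Space G] [SecondCountableTopology G]
  [MulAction.IsPretransitive G M]

theorem assocMpc_isPrincipal : (assocMpc L).toMpcBundleData.IsPrincipal E where
  rmul_one p := by
    obtain ⟨g, B, rfl⟩ := AssocSpace.exists_mk L p
    rw [assocMpc_rmul_mk, mul_one]
  rmul_mul p A A' := by
    obtain ⟨g, B, rfl⟩ := AssocSpace.exists_mk L p
    simp only [assocMpc_rmul_mk, mul_assoc]
  proj_rmul p A := by
    obtain ⟨g, B, rfl⟩ := AssocSpace.exists_mk L p
    rfl
  simply_transitive p q h := by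
    obtain ⟨g, B, rfl⟩ := AssocSpace.exists_mk L p
    obtain ⟨g', B', rfl⟩ := AssocSpace.exists_mk L q
    rw [AssocSpace.mk_eq_mk_ext L h]
    refine ⟨B⁻¹ * (L.ext (g⁻¹ * g') * B'), ?_, fun A hA => ?_⟩
    · simp only [assocMpc_rmul_mk, mul_inv_cancel_left]
    · rw [← AssocSpace.mk_right_injective L hA, inv_mul_cancel_left]
  isOpen a ha := ha.1
  proj_section := by
    rintro a ⟨_, t, _, ht, hat⟩ x hx
    rw [hat, assocMpc_proj_mk, ht x hx]
  cover x := by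
    obtain ⟨u, t, hu, hx, ht, htp⟩ := exists_local_section_orbit hG.smooth p₀ x
    exact ⟨(u, fun y => AssocSpace.mk L (t y) 1), ⟨hu, t, ht, htp, fun _ => rfl⟩, hx⟩
  transition := by
    rintro a ⟨_, t, ht, htp, hat⟩ a' ⟨_, t', ht', htp', hat'⟩
    have h : ∀ x ∈ a.1 ∩ a'.1, t x • p₀ = t' x • p₀ := fun x hx => by
      rw [htp x hx.1, htp' x hx.2]
    refine ⟨fun x => L.ext ((t x)⁻¹ * t' x), fun x hx => ?_, smoothMpcOn_ext_inv_mul L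
      (ht.mono Set.inter_subset_left) (ht'.mono Set.inter_subset_right) h⟩
    rw [hat, hat', assocMpc_rmul_mk, AssocSpace.mk_eq_mk_ext L (h x hx), mul_one, one_mul]

theorem assocMpc_isInvariant : (assocMpc L).IsInvariant hG where
  mpc :=
    { principal := assocMpc_isPrincipal L
      fibre_preserving := fun p => by
        obtain ⟨g, B, rfl⟩ := AssocSpace.exists_mk L p
        rfl
      equivariant := fun p A => by
        obtain ⟨g, B, rfl⟩ := AssocSpace.exists_mk L p
        rw [assocMpc_rmul_mk, assocMpc_φ_mk, assocMpc_φ_mk, map_mul, SpBundle.rmul_mul]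
      smooth := by
        rintro a ⟨_, t, ht, _, hat⟩ v
        have h1 := (contMDiff_tangentMap_action hG (f₀.pt.eval v)).comp_contMDiffOn ht
        refine h1.congr fun x _ => ?_
        rw [hat, assocMpc_φ_mk, map_one]
        rfl }
  one_smul p := by
    obtain ⟨g, B, rfl⟩ := AssocSpace.exists_mk L p
    rw [assocMpc_smul_mk, one_mul]
  mul_smul g h p := by
    obtain ⟨g', B, rfl⟩ := AssocSpace.exists_mk L p
    simp only [assocMpc_smul_mk, mul_assoc]
  smul_rmul g p A := by
    obtain ⟨g', B, rfl⟩ := AssocSpace.exists_mk L p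
    rfl
  φ_smul g p := by
    obtain ⟨g', B, rfl⟩ := AssocSpace.exists_mk L p
    rw [assocMpc_smul_mk, assocMpc_φ_mk, assocMpc_φ_mk, SpBundle.push_mul, SpBundle.push_rmul]
  smooth_smul := by
    rintro a ⟨_, t, ht, htp, hat⟩ a' ⟨_, t', ht', htp', hat'⟩
    set s : Set (G × M) := {y | y.2 ∈ a.1 ∧ y.1 • y.2 ∈ a'.1} with hs
    have h : ∀ y ∈ s, t' (y.1 • y.2) • p₀ = (y.1 * t y.2) • p₀ := fun y hy => by
      rw [htp' _ hy.2, mul_smul, htp _ hy.1]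
    -- With h = t'(gx)⁻¹ g t(x), which fixes p₀, g·[t(x), 1] equals [t'(gx), τ'(h)].
    refine ⟨fun y => L.ext ((t' (y.1 • y.2))⁻¹ * (y.1 * t y.2)), fun y hy hy' => ?_,
      smoothMpcOn_ext_inv_mul L (ht'.comp hG.smooth.contMDiffOn fun y hy => hy.2)
        (contMDiff_fst.contMDiffOn.mul (ht.comp contMDiff_snd.contMDiffOn fun y hy => hy.1)) h⟩
    rw [hat, hat', assocMpc_smul_mk, assocMpc_rmul_mk,
      AssocSpace.mk_eq_mk_ext L (h y ⟨hy, hy'⟩), mul_one, one_mul]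

end Bundles

/-! ### Invariant structures are associated to lifts -/

section Classification

variable {E : Type uE} [NormedAddCommGroup E] [NormedSpace ℝ E]
  {M : Type uM} [TopologicalSpace M] [ChartedSpace E M] [IsManifold 𝓘(ℝ, E) ∞ M]
  {V : Type uV} [AddCommGroup V] [Module ℝ V] [FiniteDimensional ℝ V] {Ω : SymplecticForm V}
  {ωM : SymplecticStructure E M}
  {F : Type uF} [NormedAddCommGroup F] [NormedSpace ℝ F]
  {G : Type uG} [TopologicalSpace G] [ChartedSpace F G] [Group G] [MulAction G M]
  {hG : IsSymplecticAction F G ωM} {p₀ : M} {f₀ : SympFrame Ω ωM p₀}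
  {hbar : ℝ} [Fact (0 < hbar)] {J : PCCS Ω}
  {P : Type uP} {S : InvMpcData ωM G hbar J P}

/-! ### The lift read off at a point of the fibre, and the comparison isomorphism -/

namespace InvMpcData.IsInvariant

theorem proj_smul (hS : S.IsInvariant hG) (g : G) (p : P) : S.proj (S.smul g p) = g • S.proj p := by
  rw [← hS.mpc.fibre_preserving, ← hS.mpc.fibre_preserving, hS.φ_smul]
  rfl

theorem rmul_injective (hS : S.IsInvariant hG) (p : P) {A A' : Mpc hbar J}
    (h : S.rmul p A = S.rmul p A') : A = A' :=
  (hS.mpc.principal.simply_transitive p (S.rmul p A')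
    (hS.mpc.principal.proj_rmul p A').symm).unique h rfl

/-- Every symplectic frame at a point is the image of a point of the total space. -/
theorem exists_φ_eq (hS : S.IsInvariant hG) (b : SpBundle Ω ωM) : ∃ p, S.φ p = b := by
  obtain ⟨a, ha, hba⟩ := hS.mpc.principal.cover b.base
  obtain ⟨g, hg⟩ := (S.φ (a.2 b.base)).exists_rmul_eq b (by
    rw [hS.mpc.fibre_preserving, hS.mpc.principal.proj_section a ha _ hba])
  -- Surjectivity of σ lets a change of frame be realised by the right action on the total space.
  obtain ⟨A, rfl⟩ := sigma_surjective (hbar := hbar) (J := J) g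
  exact ⟨S.rmul (a.2 b.base) A, by rw [hS.mpc.equivariant, hg]⟩

/-- The orbit maps of the action of `G` on the total space are smooth. -/
theorem exists_smooth_orbit (hS : S.IsInvariant hG) (p : P) {a : Set M × (M → P)}
    (ha : a ∈ S.sections) : ∃ d : G → Mpc hbar J,
      (∀ g, g • S.proj p ∈ a.1 → S.smul g p = S.rmul (a.2 (g • S.proj p)) (d g)) ∧
      SmoothMpcOn 𝓘(ℝ, F) d {g | g • S.proj p ∈ a.1} := by
  obtain ⟨a₀, ha₀, hp⟩ := hS.mpc.principal.cover (S.proj p)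
  obtain ⟨A, hA, -⟩ := hS.mpc.principal.simply_transitive (a₀.2 (S.proj p)) p
    (hS.mpc.principal.proj_section a₀ ha₀ _ hp)
  obtain ⟨c, hc, hcs⟩ := hS.smooth_smul a₀ ha₀ a ha
  refine ⟨fun g => c (g, S.proj p) * A, fun g hg => ?_, ?_⟩
  · rw [hS.mpc.principal.rmul_mul, ← hc (g, S.proj p) hp hg, ← hS.smul_rmul, hA]
  · exact (hcs.comp (contMDiff_id.prodMk contMDiff_const).contMDiffOn
      fun g hg => ⟨hp, hg⟩).mul (smoothMpcOn_const A)

theorem proj_eq_of_φ_eq (hS : S.IsInvariant hG) {p : P} (hp : S.φ p = f₀.pt) :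
    S.proj p = p₀ := by
  rw [← hS.mpc.fibre_preserving, hp]
  rfl

theorem existsUnique_rmul_eq_smul (hS : S.IsInvariant hG) {p : P} (hp : S.φ p = f₀.pt)
    (k : MulAction.stabilizer G p₀) : ∃! A, S.rmul p A = S.smul (k : G) p :=
  hS.mpc.principal.simply_transitive _ _ (by
    rw [hS.proj_smul, hS.proj_eq_of_φ_eq hp]
    exact k.2.symm)

/-- The action of the stabilizer on the fibre, read at a point of the fibre. -/
def stabilizerHom (hS : S.IsInvariant hG) {p : P} (hp : S.φ p = f₀.pt)
    (k : MulAction.stabilizer G p₀) : Mpc hbar J :=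
  (hS.existsUnique_rmul_eq_smul hp k).choose

theorem rmul_stabilizerHom (hS : S.IsInvariant hG) {p : P} (hp : S.φ p = f₀.pt)
    (k : MulAction.stabilizer G p₀) : S.rmul p (hS.stabilizerHom hp k) = S.smul (k : G) p :=
  (hS.existsUnique_rmul_eq_smul hp k).choose_spec.1

/-- Because the actions commute, (kl)·p = k·(p·τ'(l)) = (k·p)·τ'(l) = p·τ'(k)τ'(l); freeness on the
fibre allows cancelling p. -/
theorem stabilizerHom_mul (hS : S.IsInvariant hG) {p : P} (hp : S.φ p = f₀.pt)
    (k l : MulAction.stabilizer G p₀) :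
    hS.stabilizerHom hp (k * l) = hS.stabilizerHom hp k * hS.stabilizerHom hp l := by
  refine hS.rmul_injective p ?_
  rw [hS.mpc.principal.rmul_mul, rmul_stabilizerHom, rmul_stabilizerHom, ← hS.smul_rmul,
    rmul_stabilizerHom, Subgroup.coe_mul, hS.mul_smul]

/-- The lift of the isotropy representation defined by a point `p` with `φ p = f₀`. -/
def lift (hS : S.IsInvariant hG) {p : P} (hp : S.φ p = f₀.pt) : IsotropyLift hbar J hG f₀ where
  hom := MonoidHom.mk' (hS.stabilizerHom hp) (hS.stabilizerHom_mul hp)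
  smooth k₀ := by
    have hpp := hS.proj_eq_of_φ_eq hp
    obtain ⟨a, ha, hpa⟩ := hS.mpc.principal.cover p₀
    obtain ⟨A, hA, -⟩ := hS.mpc.principal.simply_transitive (a.2 p₀) p (by
      rw [hpp, hS.mpc.principal.proj_section a ha _ hpa])
    obtain ⟨d, hd, hds⟩ := hS.exists_smooth_orbit p ha
    rw [hpp] at hds
    -- With s the section `a.2`, p = s(p₀)·A and g·p = s(gp₀)·d(g); for g in K this says g·p =
    -- p·A⁻¹d(g), so A⁻¹d is a smooth extension of the homomorphism.
    refine ⟨{g | g • p₀ ∈ a.1}, fun g => A⁻¹ * d g, ?_, ?_, (smoothMpcOn_const _).mul hds,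
      fun k hk => hS.rmul_injective p ?_⟩
    · exact (hS.mpc.principal.isOpen a ha).preimage (contMDiff_orbit_map hG.smooth p₀).continuous
    · have hk₀ : (k₀ : G) • p₀ = p₀ := k₀.2
      simpa only [Set.mem_ofPred_eq, hk₀] using hpa
    · have hk' : (k : G) • p₀ = p₀ := k.2
      have h1 := hd k (by rw [hpp]; exact hk)
      rw [hpp, hk'] at h1
      rw [MonoidHom.mk'_apply, rmul_stabilizerHom, h1, ← hA, ← hS.mpc.principal.rmul_mul,
        mul_inv_cancel_left]
  lifts k := by
    -- Compute φ(k·p) in two ways: by equivariance under G it is k_*∘f₀, by equivariance under Mp^c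
    -- it is f₀∘σ(τ'(k)).
    refine f₀.pt.rmul_injective ?_
    rw [← push_eq_rmul_isotropyRep, ← hp, ← hS.mpc.equivariant, MonoidHom.mk'_apply,
      rmul_stabilizerHom, hS.φ_smul]

/-- The map `[g, B] ↦ g·(p·B)`. -/
def ofAssoc (hS : S.IsInvariant hG) {p : P} (hp : S.φ p = f₀.pt) : AssocSpace (hS.lift hp) → P :=
  Quotient.lift (fun y => S.smul y.1 (S.rmul p y.2)) (by
    rintro y _ ⟨k, rfl⟩
    have h1 : S.rmul p ((hS.lift hp).hom k) = S.smul (k : G) p := hS.rmul_stabilizerHom hp k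
    change S.smul y.1 (S.rmul p y.2) =
      S.smul (y.1 * k) (S.rmul p (((hS.lift hp).hom k)⁻¹ * y.2))
    rw [hS.mul_smul, hS.smul_rmul k, ← h1, ← hS.mpc.principal.rmul_mul, mul_inv_cancel_left])

theorem ofAssoc_mk (hS : S.IsInvariant hG) {p : P} (hp : S.φ p = f₀.pt) (g : G)
    (B : Mpc hbar J) :
    hS.ofAssoc hp (AssocSpace.mk (hS.lift hp) g B) = S.smul g (S.rmul p B) := rfl

theorem proj_ofAssoc (hS : S.IsInvariant hG) {p : P} (hp : S.φ p = f₀.pt)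
    (q : AssocSpace (hS.lift hp)) : S.proj (hS.ofAssoc hp q) = (assocMpc (hS.lift hp)).proj q := by
  obtain ⟨g, B, rfl⟩ := AssocSpace.exists_mk _ q
  rw [ofAssoc_mk, hS.proj_smul, hS.mpc.principal.proj_rmul, hS.proj_eq_of_φ_eq hp,
    assocMpc_proj_mk]

theorem smul_injective (hS : S.IsInvariant hG) (g : G) : Function.Injective (S.smul g) := by
  intro q q' h
  rw [← hS.one_smul q, ← inv_mul_cancel g, hS.mul_smul, h, ← hS.mul_smul, inv_mul_cancel,
    hS.one_smul]

/-- Points with the same image lie over the same point of M, so they have representatives with the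
same g, and freeness applies. Surjectivity combines transitivity on M with transitivity on the
fibres. -/
theorem ofAssoc_bijective [MulAction.IsPretransitive G M] (hS : S.IsInvariant hG) {p : P}
    (hp : S.φ p = f₀.pt) : Function.Bijective (hS.ofAssoc hp) := by
  refine ⟨fun q q' h => ?_, fun q => ?_⟩
  · have h1 := congrArg S.proj h
    rw [proj_ofAssoc, proj_ofAssoc] at h1
    obtain ⟨g, B, rfl⟩ := AssocSpace.exists_mk _ q
    obtain ⟨g', B', rfl⟩ := AssocSpace.exists_mk _ q'
    rw [AssocSpace.mk_eq_mk_ext _ h1] at h ⊢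
    rw [ofAssoc_mk, ofAssoc_mk] at h
    rw [hS.rmul_injective p (hS.smul_injective g h)]
  · obtain ⟨g, hg⟩ := MulAction.exists_smul_eq G p₀ (S.proj q)
    obtain ⟨A, hA, -⟩ := hS.mpc.principal.simply_transitive (S.smul g p) q (by
      rw [hS.proj_smul, hS.proj_eq_of_φ_eq hp, hg])
    exact ⟨AssocSpace.mk _ g A, by rw [ofAssoc_mk, hS.smul_rmul, hA]⟩

theorem ofAssoc_rmul (hS : S.IsInvariant hG) {p : P} (hp : S.φ p = f₀.pt)
    (q : AssocSpace (hS.lift hp)) (A : Mpc hbar J) :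
    hS.ofAssoc hp ((assocMpc (hS.lift hp)).rmul q A) = S.rmul (hS.ofAssoc hp q) A := by
  obtain ⟨g, B, rfl⟩ := AssocSpace.exists_mk _ q
  rw [assocMpc_rmul_mk, ofAssoc_mk, ofAssoc_mk, ← hS.smul_rmul, hS.mpc.principal.rmul_mul]

theorem φ_ofAssoc (hS : S.IsInvariant hG) {p : P} (hp : S.φ p = f₀.pt)
    (q : AssocSpace (hS.lift hp)) : S.φ (hS.ofAssoc hp q) = (assocMpc (hS.lift hp)).φ q := by
  obtain ⟨g, B, rfl⟩ := AssocSpace.exists_mk _ q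
  rw [ofAssoc_mk, hS.φ_smul, hS.mpc.equivariant, hp, assocMpc_φ_mk, SpBundle.push_rmul]

theorem ofAssoc_smul (hS : S.IsInvariant hG) {p : P} (hp : S.φ p = f₀.pt) (g : G)
    (q : AssocSpace (hS.lift hp)) :
    hS.ofAssoc hp ((assocMpc (hS.lift hp)).smul g q) = S.smul g (hS.ofAssoc hp q) := by
  obtain ⟨g', B, rfl⟩ := AssocSpace.exists_mk _ q
  rw [assocMpc_smul_mk, ofAssoc_mk, ofAssoc_mk, hS.mul_smul]

/-- An invariant `Mp^c`-structure on a homogeneous space is isomorphic to the one associated to the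
lift that it defines. -/
def isoAssoc [MulAction.IsPretransitive G M] (hS : S.IsInvariant hG) {p : P}
    (hp : S.φ p = f₀.pt) : InvMpcIso S (assocMpc (hS.lift hp)) :=
  let e := Equiv.ofBijective _ (hS.ofAssoc_bijective hp)
  have he : ∀ q, hS.ofAssoc hp (e.symm q) = q := e.apply_symm_apply
  { equiv := e.symm
    proj_equiv := fun q => by rw [← proj_ofAssoc, he]
    map_rmul := fun q A => e.injective (by
      change hS.ofAssoc hp _ = hS.ofAssoc hp _
      rw [ofAssoc_rmul, he, he])
    φ_equiv := fun q => by rw [← φ_ofAssoc, he]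
    map_smul := fun g q => e.injective (by
      change hS.ofAssoc hp _ = hS.ofAssoc hp _
      rw [ofAssoc_smul, he, he])
    smooth := by
      rintro a ha a' ⟨_, t, ht, htp, hat⟩
      have hpp := hS.proj_eq_of_φ_eq hp
      obtain ⟨d, hd, hds⟩ := hS.exists_smooth_orbit p ha
      -- From t(x)·p = s(x)·d(t(x)), with s the section `a.2`, s(x) is the image of [t(x),
      -- d(t(x))⁻¹].
      refine ⟨fun x => (d (t x))⁻¹, fun x hx => e.injective ?_, ?_⟩
      · change hS.ofAssoc hp _ = hS.ofAssoc hp _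
        have h1 : t x • S.proj p = x := by rw [hpp, htp x hx.2]
        have h2 := hd (t x) (by rw [h1]; exact hx.1)
        rw [he, hat, assocMpc_rmul_mk, one_mul, ofAssoc_mk, hS.smul_rmul, h2, h1,
          ← hS.mpc.principal.rmul_mul, mul_inv_cancel, hS.mpc.principal.rmul_one]
      · refine (hds.comp (ht.mono Set.inter_subset_right) fun x hx => ?_).inv
        change t x • S.proj p ∈ a.1
        rw [hpp, htp x hx.2]
        exact hx.1 }

theorem exists_lift_iso [LieGroup 𝓘(ℝ, F) ∞ G] [FiniteDimensional ℝ E] [FiniteDimensional ℝ F]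
    [T2Space M] [SecondCountableTopology M] [T2Space G] [SecondCountableTopology G]
    [MulAction.IsPretransitive G M] (f₀ : SympFrame Ω ωM p₀) (hS : S.IsInvariant hG) :
    ∃ L : IsotropyLift hbar J hG f₀, (assocMpc L).IsInvariant hG ∧
      Nonempty (InvMpcIso S (assocMpc L)) := by
  obtain ⟨p, hp⟩ := hS.exists_φ_eq f₀.pt
  exact ⟨hS.lift hp, assocMpc_isInvariant _, ⟨hS.isoAssoc hp⟩⟩

end InvMpcData.IsInvariant

end Classification

end

end MpcTheory

/-! ### Existence and classification of invariant Mp^c-structures -/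

theorem mainTheorem10
    {V : Type uV} [AddCommGroup V] [Module ℝ V] [FiniteDimensional ℝ V]
    (Ω : MpcTheory.SymplecticForm V) (J : MpcTheory.PCCS Ω)
    (hbar : ℝ) [Fact (0 < hbar)]
    {E : Type uE} [NormedAddCommGroup E] [NormedSpace ℝ E] [FiniteDimensional ℝ E]
    {M : Type uM} [TopologicalSpace M] [ChartedSpace E M] [IsManifold 𝓘(ℝ, E) ∞ M]
    [T2Space M] [SecondCountableTopology M]
    (ωM : MpcTheory.SymplecticStructure E M)
    {F : Type uF} [NormedAddCommGroup F] [NormedSpace ℝ F] [FiniteDimensional ℝ F]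
    {G : Type uG} [TopologicalSpace G] [ChartedSpace F G] [Group G] [LieGroup 𝓘(ℝ, F) ∞ G]
    [T2Space G] [SecondCountableTopology G]
    [MulAction G M] [MulAction.IsPretransitive G M]
    (hG : MpcTheory.IsSymplecticAction F G ωM)
    (p₀ : M) (f₀ : MpcTheory.SympFrame Ω ωM p₀) :
    ((∃ (P : Type (max uG uV)) (S : MpcTheory.InvMpcData ωM G hbar J P), S.IsInvariant hG) ↔
      Nonempty (MpcTheory.IsotropyLift hbar J hG f₀)) ∧
    ∀ (P : Type uP) (S : MpcTheory.InvMpcData ωM G hbar J P), S.IsInvariant hG →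
      ∃ L : MpcTheory.IsotropyLift hbar J hG f₀,
        (MpcTheory.assocMpc L).IsInvariant hG ∧
        Nonempty (MpcTheory.InvMpcIso S (MpcTheory.assocMpc L)) := by
  refine ⟨⟨fun ⟨P, S, hS⟩ => ?_, fun ⟨L⟩ => ?_⟩, fun P S hS => hS.exists_lift_iso f₀⟩
  · obtain ⟨L, -⟩ := hS.exists_lift_iso f₀
    exact ⟨L⟩
  -- The associated space lives in `Type (max uG uV)`, which is why the existence clause uses this
  -- universe; the classification clause allows any universe for the total space.
  · exact ⟨MpcTheory.AssocSpace L, MpcTheory.assocMpc L, MpcTheory.assocMpc_isInvariant L⟩
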